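/- Let $(M,d,\mu)$ be a metric space with a Borel measure for which balls have finite measure and which is doubling: $\mu(B(x,2r))\le C_0\,\mu(B(x,r))$ for all $x\in M$, $r>0$ (for instance, a complete Riemannian manifold with its geodesic distance and its Riemannian measure, satisfying the doubling property). Put $d:=\log_2 C_0$. Assume that there is $c>0$ with $\mu(B(x,1))\ge c$ for all $x\in M$. Let $0\le\omega<\pi/2$, $S_\nu=\{z\in\mathbb C: |\arg z|\le \nu\}\cup\{0\}$, and let $L$ be a densely defined linear operator of type $\omega$ on $L^2(M,\mu)$ (complex valued functions): $\sigma(L)\subset S_\omega$ and, for every $\nu>\omega$, $\|(L-\lambda)^{-1}\|_{L^2\to L^2}\le c_\nu|\lambda|^{-1}$ for all $\lambda\notin S_\nu$. Let $e^{-zL}$, $|\arg z|<\pi/2-\omega$, be the holomorphic semigroup generated by $-L$. Let $m>1$, $0<s_-<2$, $\delta>1$, and assume the $L^{s_-}$–$L^\infty$ off-diagonal decay: for every $\theta<\pi/2-\omega$ there is a constant $C$ such that for all $z\ne0$ with $|\arg z|\le\theta$, every ball $B$ of radius $|z|^{1/m}$ and every $f\in L^2$, $$\|e^{-zL}f\|_{L^\infty(B)}\le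 C\sum_{k\ge0}2^{-\delta k}\Big(\frac1{\mu(2^kB)}\int_{2^kB}|f|^{s_-}\,d\mu\Big)^{1/s_-}.$$ For $s>0$ and $1\le p<\infty$ let $W^{s,p}_L=\{f\in L^p:\ L^{s/m}f\in L^p\}$, with norm $\|f\|_{L^p}+\|L^{s/m}f\|_{L^p}$; here the fractional power $L^{s/m}$, defined on $L^2$ by the holomorphic functional calculus, is extended to $L^p$ as the closure in $L^p\times L^p$ of its graph restricted to pairs $(f,L^{s/m}f)$ of functions in $L^2\cap L^p$. Let $s>0$ and let $1\le p<\infty$ with $p\ge s_-$. (1) If $p\le q\le\infty$ and $\frac1q>\frac1p-\frac sd$ (that is, $d\,(\frac1p-\frac1q)<s$), then $W^{s,p}_L\hookrightarrow L^q$ continuously: there is a constant $C$ with $\|f\|_{L^q}\le C\big(\|f\|_{L^p}+\|L^{s/m}f\|_{L^p}\big)$ for all $f\in W^{s,p}_L$. (2) In particular, if $s>d/p$, then $W^{s,p}_L\hookrightarrow L^\infty$ continuously. -/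

import Mathlib

open MeasureTheory
open scoped ENNReal NNReal

noncomputable section

namespace SemigroupSobolev

/-! ### Operators of type `ω` and their holomorphic functional calculus -/

section Calculus

variable {H : Type*} [NormedAddCommGroup H] [NormedSpace ℂ H]

/-- The closed sector `S_ω = {z | |arg z| ≤ ω} ∪ {0}` (recall `Complex.arg 0 = 0`). -/
def sector (ω : ℝ) : Set ℂ := {z | |z.arg| ≤ ω} ∪ {0}

/-- `R` is the bounded inverse `(z - L)⁻¹` of `z - L : D(L) → H`. -/
def IsResolventAt (L : H →ₗ.[ℂ] H) (z : ℂ) (R : H →L[ℂ] H) : Prop :=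
  (∀ f : H, ∃ h : R f ∈ L.domain, z • R f - L ⟨R f, h⟩ = f) ∧
    ∀ f : L.domain, R (z • (f : H) - L f) = f

/-- The spectrum of the unbounded operator `L`. -/
def spectrumOf (L : H →ₗ.[ℂ] H) : Set ℂ := {z | ¬ ∃ R : H →L[ℂ] H, IsResolventAt L z R}

open Classical in
/-- The resolvent `(z - L)⁻¹`, with the value `0` for `z` in the spectrum. -/
def res (L : H →ₗ.[ℂ] H) (z : ℂ) : H →L[ℂ] H :=
  if h : ∃ R : H →L[ℂ] H, IsResolventAt L z R then h.choose else 0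

/-- The resolvent at a point is unique, so that `res` is determined by `L`. -/
theorem IsResolventAt.unique {L : H →ₗ.[ℂ] H} {z : ℂ} {R R' : H →L[ℂ] H}
    (h : IsResolventAt L z R) (h' : IsResolventAt L z R') : R = R' := by
  ext f
  obtain ⟨hd, hf⟩ := h'.1 f
  have := h.2 ⟨R' f, hd⟩
  simpa [hf] using this

theorem res_spec {L : H →ₗ.[ℂ] H} {z : ℂ} (hz : z ∉ spectrumOf L) :
    IsResolventAt L z (res L z) := by
  have h : ∃ R : H →L[ℂ] H, IsResolventAt L z R := by
    simpa [spectrumOf] using hz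
  rw [res, dif_pos h]
  exact h.choose_spec

/-- `L` is a (densely defined) operator of type `ω`: its spectrum is contained in `S_ω`, and for
every `ν > ω` there is a constant `c_ν` with `‖(L - z)⁻¹‖ ≤ c_ν / |z|` for all `z ∉ S_ν`. -/
structure IsOfType (L : H →ₗ.[ℂ] H) (ω : ℝ) : Prop where
  dense_domain : Dense (L.domain : Set H)
  spectrum_subset : spectrumOf L ⊆ sector ω
  resolvent_bound : ∀ ν : ℝ, ω < ν → ∃ c : ℝ, ∀ z : ℂ, z ∉ sector ν → ‖res L z‖ ≤ c * ‖z‖⁻¹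

/-- The ray integral `∫_0^∞ ψ(r e^{iθ}) (r e^{iθ} - L)⁻¹ e^{iθ} dr`. -/
def rayIntegral (L : H →ₗ.[ℂ] H) (θ : ℝ) (ψ : ℂ → ℂ) : H →L[ℂ] H :=
  ∫ r in Set.Ioi (0 : ℝ),
    (ψ (r * Complex.exp (θ * Complex.I)) * Complex.exp (θ * Complex.I)) •
      res L (r * Complex.exp (θ * Complex.I))

/-- The operator `ψ(L) = (2πi)⁻¹ ∫_Γ ψ(z) (z - L)⁻¹ dz`, where `Γ` is the boundary of the sector
`S_θ`, with the sector on its left: in along the ray of angle `θ`, out along the ray of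
angle `-θ`. For `L` of type `ω` this is the holomorphic functional calculus, for `ψ` holomorphic
on the interior of `S_ν` with `|ψ(z)| ≤ C |z|^a / (1 + |z|^{2a})` for some `a > 0`,
and `ω < θ < ν`; the operator does not depend on the choice of `θ`. -/
def psiCalc (L : H →ₗ.[ℂ] H) (θ : ℝ) (ψ : ℂ → ℂ) : H →L[ℂ] H :=
  (2 * Real.pi * Complex.I : ℂ)⁻¹ • (rayIntegral L (-θ) ψ - rayIntegral L θ ψ)

/-- The operator `(1 + L)⁻¹ = -(-1 - L)⁻¹`. -/
def resOne (L : H →ₗ.[ℂ] H) : H →L[ℂ] H := - res L (-1)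

/-- The holomorphic semigroup `e^{-zL}`, `|arg z| < π/2 - ω`, of an operator of type `ω`, given by
the functional calculus: the function `u ↦ e^{-zu} - (1 + u)⁻¹` decays at `0` and at `∞` in the
sector `S_ν`, for every `ν < π/2 - |arg z|`, and
`e^{-zL} = (1 + L)⁻¹ + [e^{-zu} - (1 + u)⁻¹](L)`. -/
def semigroup (L : H →ₗ.[ℂ] H) (ω : ℝ) (z : ℂ) : H →L[ℂ] H :=
  resOne L +
    psiCalc L ((ω + (Real.pi / 2 - |z.arg|)) / 2) (fun u => Complex.exp (-z * u) - (1 + u)⁻¹)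

/-- `IsPow L ω α f g` says that `f` lies in the domain of the fractional power `L ^ α`, and that
`L ^ α f = g`. Here `α > 0`, and `L ^ α = (1 + L)^n [u^α (1 + u)^{-n}](L)` with its natural domain,
where `n` is an integer greater than `α` (here `⌊α⌋ + 1`). -/
def IsPow (L : H →ₗ.[ℂ] H) (ω α : ℝ) (f g : H) : Prop :=
  psiCalc L ((ω + Real.pi / 2) / 2)
      (fun u => u ^ (α : ℂ) * ((1 + u) ^ (⌊α⌋₊ + 1))⁻¹) f =
    (resOne L ^ (⌊α⌋₊ + 1)) g

end Calculus

section Space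

variable {M : Type*} [MetricSpace M] [MeasurableSpace M]

/-- The doubling property with constant `C₀`: balls have finite measure, and
`μ(B(x,2r)) ≤ C₀ μ(B(x,r))` for all `x` and all `r > 0`. -/
structure IsDoublingWith (μ : Measure M) (C₀ : ℝ) : Prop where
  ball_lt_top : ∀ (x : M) (r : ℝ), μ (Metric.ball x r) < ∞
  doubling : ∀ (x : M) (r : ℝ), 0 < r →
    μ (Metric.ball x (2 * r)) ≤ ENNReal.ofReal C₀ * μ (Metric.ball x r)

/-- The homogeneous dimension `d = log₂ C₀` attached to the doubling constant `C₀`. -/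
def homDim (C₀ : ℝ) : ℝ := Real.logb 2 C₀

/-- The average `(μ(B)⁻¹ ∫_B |f|^a dμ)^{1/a}`. -/
def avgPow (μ : Measure M) (a : ℝ) (f : M → ℂ) (B : Set M) : ℝ≥0∞ :=
  ((μ B)⁻¹ * ∫⁻ y in B, ‖f y‖ₑ ^ a ∂μ) ^ a⁻¹

/-- `L^{a} - L^∞` off-diagonal decay, of exponent `δ`, of the semigroup generated by an operator
`L` of type `ω` and of order `m` on `L²`: for `z ≠ 0` in the sector of half-angle `π/2 - ω`, for
every ball `B` of radius `|z|^{1/m}` and every `f ∈ L²`,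
`‖e^{-zL} f‖_{L^∞(B)} ≤ C ∑_{k ≥ 0} 2^{-δk} (μ(2^k B)⁻¹ ∫_{2^k B} |f|^a dμ)^{1/a}`,
with a constant `C` that is uniform on every smaller sector `|arg z| ≤ θ < π/2 - ω`. -/
def HasOffDiagonalDecay (μ : Measure M) (L : Lp ℂ 2 μ →ₗ.[ℂ] Lp ℂ 2 μ) (ω m a δ : ℝ) : Prop :=
  ∀ θ : ℝ, θ < Real.pi / 2 - ω → ∃ C : ℝ≥0, ∀ z : ℂ, z ≠ 0 → |z.arg| ≤ θ →
    ∀ (x : M) (f : Lp ℂ 2 μ),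
      eLpNorm (semigroup L ω z f) ∞ (μ.restrict (Metric.ball x (‖z‖ ^ m⁻¹))) ≤
        C * ∑' k : ℕ, ENNReal.ofReal ((2 : ℝ) ^ (-δ * k)) *
          avgPow μ a f (Metric.ball x ((2 : ℝ) ^ k * ‖z‖ ^ m⁻¹))

/-- `IsPowLp μ L ω α p f g` says that `L ^ α f = g` in `L^p`, where the fractional power `L ^ α`,
which is given on `L²`, is extended to `L^p` as the closure in `L^p × L^p` of the restriction of
its graph to pairs of functions that are in `L² ∩ L^p`. -/
def IsPowLp (μ : Measure M) (L : Lp ℂ 2 μ →ₗ.[ℂ] Lp ℂ 2 μ) (ω α : ℝ) (p : ℝ≥0∞) [Fact (1 ≤ p)]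
    (f g : Lp ℂ p μ) : Prop :=
  (f, g) ∈ closure {u : Lp ℂ p μ × Lp ℂ p μ |
    ∃ f₂ g₂ : Lp ℂ 2 μ, IsPow L ω α f₂ g₂ ∧ u.1 =ᵐ[μ] f₂ ∧ u.2 =ᵐ[μ] g₂}

/-- The space `W^{s,p}_L = {f ∈ L^p | L^{s/m} f ∈ L^p}`, for `L` of type `ω` and order `m`. -/
def sobolevSpace (μ : Measure M) (L : Lp ℂ 2 μ →ₗ.[ℂ] Lp ℂ 2 μ) (ω m s : ℝ) (p : ℝ≥0∞)
    [Fact (1 ≤ p)] : Set (Lp ℂ p μ) :=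
  {f | ∃ g : Lp ℂ p μ, IsPowLp μ L ω (s / m) p f g}

/-- The continuous embedding `W^{s,p}_L ↪ L^q`: there is a constant `C` such that every
`f ∈ W^{s,p}_L` is in `L^q`, with `‖f‖_q ≤ C (‖f‖_p + ‖g‖_p)` for `g = L^{s/m} f`. -/
def EmbedsInto (μ : Measure M) (L : Lp ℂ 2 μ →ₗ.[ℂ] Lp ℂ 2 μ) (ω m s : ℝ) (p : ℝ≥0∞)
    [Fact (1 ≤ p)] (q : ℝ≥0∞) : Prop :=
  ∃ C : ℝ≥0, ∀ f ∈ sobolevSpace μ L ω m s p,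
    MemLp f q μ ∧ ∀ g : Lp ℂ p μ, IsPowLp μ L ω (s / m) p f g →
      eLpNorm f q μ ≤ C * (eLpNorm f p μ + eLpNorm g p μ)

end Space

end SemigroupSobolev

end

/-! Write `α = s / m`, `R = (1 + L)⁻¹`, and let `n = ⌊α⌋ + 1 > α`. Everything rests on the
reproducing formula f = (1 - (1 - e^{-L})^n) f + ∫_0^∞ k(t) e^{-tL} L^α f dt, where `k` has Laplace
transform u^{-α} (1 - e^{-u})^n (`reproducing_formula`). The first term is a combination of e^{-jL}
f for 1 ≤ j ≤ n. The kernel is an n-th finite difference of t_+^{α-1} / Γ(α): it equals t^{α-1} /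
Γ(α) on (0, 1] and is O(t^{α-1-n}) at infinity, hence integrable. Taking differences instead of the
plain kernel t^{α-1} means that no decay of the semigroup for large t is needed; the price is the
term ‖f‖_p.

The semigroup is estimated from the off-diagonal decay, which bounds e^{-tL} f at y by a weighted
sum of averages over balls centred at y. Tonelli and doubling make it bounded on L^p, uniformly in
t. Doubling together with μ(B(x,1)) ≥ c gives μ(B(x,r)) ≥ (c / C₀) min(1, r^d), so the norm from L^p
to L^∞ is at most a constant times max(1, t^{-d/(mp)}). By interpolation the norm from L^p to L^q is
at most a constant times max(1, t^{-κ}), with κ = d(1/p - 1/q)/m. The hypothesis on q says κ < α,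
which makes k(t) max(1, t^{-κ}) integrable (`integrableOn_diffKernel_mul`). Minkowski's inequality
then bounds ‖f‖_q for f in L², and Fatou's lemma carries the bound to the closure that defines L^α
on L^p.

Semigroup and powers are given by contour integrals, so the formula has to be derived from these. In
the coordinate z = e^ζ the contour is a pair of horizontal lines and Cauchy's theorem is used in
strips. One residue computation (`psiCalc_div_sq`) and the product rule for resolvents
(`neg_res_mul_psiCalc`) generate the rest: Euler's formula, e^{-tL} = lim ((k/t)(k/t + L)⁻¹)^k,
transfers the product rule to the semigroup, and Fubini's theorem inserts the Laplace transform of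
`k`. -/

noncomputable section

namespace SemigroupSobolev

/-! ### The resolvent identity and holomorphy of the resolvent -/

section Resolvent

variable {H : Type*} [NormedAddCommGroup H] [NormedSpace ℂ H]

/-- Being outside the sector is expressed through `re z < ‖z‖ cos ν` because this is visibly an open
condition and avoids the discontinuity of `arg`. -/
theorem notMem_sector {ν : ℝ} (hπ : ν ≤ Real.pi) {z : ℂ}
    (h : z.re < ‖z‖ * Real.cos ν) : z ∉ sector ν := by
  rintro (hz | hz)
  · have h1 : Real.cos ν ≤ Real.cos |z.arg| :=
      Real.cos_le_cos_of_nonneg_of_le_pi (abs_nonneg _) hπ hz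
    rw [Real.cos_abs] at h1
    have := Complex.norm_mul_cos_arg z
    nlinarith [norm_nonneg z]
  · rw [Set.mem_singleton_iff] at hz
    simp [hz] at h

theorem IsResolventAt.sub_eq {L : H →ₗ.[ℂ] H} {z w : ℂ} {R R' : H →L[ℂ] H}
    (h : IsResolventAt L z R) (h' : IsResolventAt L w R') :
    R - R' = (w - z) • (R * R') := by
  ext f
  obtain ⟨hd, hf⟩ := h'.1 f
  have h1 : R (z • R' f - L ⟨R' f, hd⟩) = R' f := h.2 ⟨R' f, hd⟩
  have h2 : z • R' f - L ⟨R' f, hd⟩ = f + (z - w) • R' f := by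
    rw [sub_eq_iff_eq_add] at hf
    rw [sub_smul, hf]
    abel
  rw [h2, map_add, map_smul] at h1
  change R f - R' f = (w - z) • R (R' f)
  rw [sub_eq_iff_eq_add, ← neg_sub z w, neg_smul, neg_add_eq_sub, eq_sub_iff_add_eq, h1]

theorem res_sub_res {L : H →ₗ.[ℂ] H} {z w : ℂ} (hz : z ∉ spectrumOf L) (hw : w ∉ spectrumOf L) :
    res L z - res L w = (w - z) • (res L z * res L w) :=
  (res_spec hz).sub_eq (res_spec hw)

theorem res_mul_comm {L : H →ₗ.[ℂ] H} {z w : ℂ} (hz : z ∉ spectrumOf L)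
    (hw : w ∉ spectrumOf L) : res L z * res L w = res L w * res L z := by
  rcases eq_or_ne z w with rfl | hne
  · rfl
  have h1 := res_sub_res hz hw
  have h2 := res_sub_res hw hz
  have h3 : (w - z) • (res L z * res L w) = (w - z) • (res L w * res L z) := by
    rw [← h1, ← neg_sub, h2, ← neg_smul, neg_sub]
  exact smul_right_injective _ (sub_ne_zero.2 hne.symm) h3

theorem res_apply_eq_zero {L : H →ₗ.[ℂ] H} {z : ℂ} (hz : z ∉ spectrumOf L) {f : H}
    (h : res L z f = 0) : f = 0 := by
  obtain ⟨hd, hf⟩ := (res_spec hz).1 f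
  have : (⟨res L z f, hd⟩ : L.domain) = 0 := Subtype.ext h
  rw [this, h] at hf
  simpa using hf.symm

theorem IsOfType.notMem_spectrum {L : H →ₗ.[ℂ] H} {ω ν : ℝ} (hL : IsOfType L ω) (h : ω < ν)
    (hπ : ν ≤ Real.pi) {z : ℂ} (hz : z.re < ‖z‖ * Real.cos ν) : z ∉ spectrumOf L := by
  refine fun hs => notMem_sector hπ hz ?_
  rcases hL.spectrum_subset hs with h1 | h1
  · exact Or.inl (le_trans h1 h.le)
  · exact Or.inr h1

/-- The resolvent bound is locally uniform, so the resolvent identity gives continuity; the same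
identity then shows that the slope at `z` is `-(res L w * res L z)`, which converges. -/
theorem IsOfType.hasDerivAt_res {L : H →ₗ.[ℂ] H} {ω ν : ℝ} (hL : IsOfType L ω)
    (h : ω < ν) (hπ : ν ≤ Real.pi) {z : ℂ} (hz : z.re < ‖z‖ * Real.cos ν) :
    HasDerivAt (res L) (-(res L z * res L z)) z := by
  have hopen : IsOpen {z : ℂ | z.re < ‖z‖ * Real.cos ν} :=
    isOpen_lt Complex.continuous_re (by fun_prop)
  obtain ⟨c, hc⟩ := hL.resolvent_bound ν h
  have hz0 : z ≠ 0 := by rintro rfl; simp at hz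
  have hev : ∀ᶠ w in nhds z, w ∈ {z : ℂ | z.re < ‖z‖ * Real.cos ν} := hopen.mem_nhds hz
  have hbd : Filter.Tendsto (fun w : ℂ => ‖w - z‖ * (c * ‖w‖⁻¹ * ‖res L z‖)) (nhds z) (nhds 0) := by
    have h1 : Filter.Tendsto (fun w : ℂ => ‖w - z‖ * (c * ‖w‖⁻¹ * ‖res L z‖)) (nhds z)
        (nhds (‖z - z‖ * (c * ‖z‖⁻¹ * ‖res L z‖))) := by
      have : ‖z‖ ≠ 0 := norm_ne_zero_iff.2 hz0
      refine ContinuousAt.tendsto ?_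
      fun_prop (disch := assumption)
    simpa using h1
  have hcont : Filter.Tendsto (res L) (nhds z) (nhds (res L z)) := by
    rw [tendsto_iff_norm_sub_tendsto_zero]
    refine squeeze_zero' (Filter.Eventually.of_forall fun _ => norm_nonneg _) ?_ hbd
    filter_upwards [hev] with w hw
    rw [res_sub_res (hL.notMem_spectrum h hπ hw) (hL.notMem_spectrum h hπ hz), norm_smul,
      ← norm_neg, neg_sub]
    gcongr
    refine (norm_mul_le _ _).trans ?_
    gcongr
    exact hc w (notMem_sector hπ hw)
  rw [hasDerivAt_iff_tendsto_slope]
  have h1 : Filter.Tendsto (fun w => -(res L w * res L z)) (nhdsWithin z {z}ᶜ)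
      (nhds (-(res L z * res L z))) :=
    ((hcont.mono_left nhdsWithin_le_nhds).mul_const _).neg
  refine h1.congr' ?_
  filter_upwards [nhdsWithin_le_nhds hev, self_mem_nhdsWithin] with w hw hne
  rw [slope_def_module,
    res_sub_res (hL.notMem_spectrum h hπ hw) (hL.notMem_spectrum h hπ hz), smul_smul,
    ← neg_sub w z, mul_neg, inv_mul_cancel₀ (sub_ne_zero.2 hne), neg_one_smul]

theorem IsOfType.differentiableOn_res {L : H →ₗ.[ℂ] H} {ω ν : ℝ} (hL : IsOfType L ω)
    (h : ω < ν) (hπ : ν ≤ Real.pi) :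
    DifferentiableOn ℂ (res L) {z | z.re < ‖z‖ * Real.cos ν} :=
  fun _ hz => (hL.hasDerivAt_res h hπ hz).differentiableAt.differentiableWithinAt

end Resolvent

/-! ### Cauchy's theorem in horizontal strips -/

section Strip

variable {E : Type*} [NormedAddCommGroup E]

theorem integrable_exp_neg_mul_abs {κ : ℝ} (hκ : 0 < κ) :
    Integrable (fun x : ℝ => Real.exp (-κ * |x|)) := by
  have h1 : IntegrableOn (fun x : ℝ => Real.exp (-κ * |x|)) (Set.Ioi 0) :=
    (integrableOn_exp_mul_Ioi (neg_neg_of_pos hκ) 0).congr_fun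
      (fun x hx => by simp only [abs_of_pos (Set.mem_Ioi.1 hx)]) measurableSet_Ioi
  have h2 : IntegrableOn (fun x : ℝ => Real.exp (-κ * |x|)) (Set.Iic 0) :=
    (integrableOn_exp_mul_Iic hκ 0).congr_fun
      (fun x hx => by simp only [abs_of_nonpos (Set.mem_Iic.1 hx)]; ring_nf) measurableSet_Iic
  have := h2.union h1
  rwa [Set.Iic_union_Ioi, integrableOn_univ] at this

/-- The part |Re ζ| ≤ 1 of the strip is compact, so continuity supplies the bound there. This allows
decay estimates that fail near a removable singularity at 0. -/
theorem exists_bound_of_continuousOn_strip {F : ℂ → E} {a b C κ : ℝ}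
    (hF : ContinuousOn F {ζ | ζ.im ∈ Set.Icc a b})
    (hb : ∀ ζ : ℂ, ζ.im ∈ Set.Icc a b → 1 ≤ |ζ.re| → ‖F ζ‖ ≤ C * Real.exp (-κ * |ζ.re|)) :
    ∃ C' : ℝ, ∀ ζ : ℂ, ζ.im ∈ Set.Icc a b → ‖F ζ‖ ≤ C' * Real.exp (-κ * |ζ.re|) := by
  have hK : IsCompact (Set.Icc (-1) 1 ×ℂ Set.Icc a b) := isCompact_Icc.reProdIm isCompact_Icc
  have hc : ContinuousOn (fun ζ : ℂ => ‖F ζ‖ * Real.exp (κ * |ζ.re|))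
      (Set.Icc (-1) 1 ×ℂ Set.Icc a b) := by
    refine (hF.mono fun ζ hζ => hζ.2).norm.mul (Continuous.continuousOn ?_)
    fun_prop
  obtain ⟨C₁, hC₁⟩ := hK.exists_bound_of_continuousOn hc
  refine ⟨max C C₁, fun ζ hζ => ?_⟩
  by_cases h : 1 ≤ |ζ.re|
  · refine (hb ζ hζ h).trans ?_
    gcongr
    exact le_max_left _ _
  · have h1 := hC₁ ζ ⟨abs_le.1 (not_le.1 h).le, hζ⟩
    rw [Real.norm_of_nonneg (by positivity)] at h1
    have h2 : ‖F ζ‖ = ‖F ζ‖ * Real.exp (κ * |ζ.re|) * Real.exp (-κ * |ζ.re|) := by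
      rw [mul_assoc, ← Real.exp_add]; simp
    rw [h2]
    gcongr
    exact h1.trans (le_max_right _ _)

theorem integrable_line {F : ℂ → E} {y C κ : ℝ} (hκ : 0 < κ)
    (hF : Continuous fun x : ℝ => F (x + y * Complex.I))
    (hb : ∀ x : ℝ, ‖F (x + y * Complex.I)‖ ≤ C * Real.exp (-κ * |x|)) :
    Integrable fun x : ℝ => F (x + y * Complex.I) :=
  ((integrable_exp_neg_mul_abs hκ).const_mul C).mono' hF.aestronglyMeasurable
    (Filter.Eventually.of_forall hb)

/-- Cauchy's theorem in a horizontal strip. -/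
theorem integral_line_eq_integral_line [NormedSpace ℂ E] [CompleteSpace E] {F : ℂ → E}
    {a b C κ : ℝ} (hab : a ≤ b)
    (hκ : 0 < κ) (hF : DifferentiableOn ℂ F {ζ | ζ.im ∈ Set.Icc a b})
    (hb : ∀ ζ : ℂ, ζ.im ∈ Set.Icc a b → 1 ≤ |ζ.re| → ‖F ζ‖ ≤ C * Real.exp (-κ * |ζ.re|)) :
    ∫ x : ℝ, F (x + a * Complex.I) = ∫ x : ℝ, F (x + b * Complex.I) := by
  obtain ⟨C', hC'⟩ := exists_bound_of_continuousOn_strip hF.continuousOn hb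
  have hline : ∀ y ∈ Set.Icc a b, Integrable fun x : ℝ => F (x + y * Complex.I) := by
    intro y hy
    refine integrable_line (C := C') hκ ?_ ?_
    · refine hF.continuousOn.comp_continuous (by fun_prop) fun x => ?_
      simpa using hy
    · intro x
      have := hC' (x + y * Complex.I) (by simpa using hy)
      simpa using this
  have htend : ∀ y ∈ Set.Icc a b, Filter.Tendsto
      (fun T : ℝ => ∫ x in (-T)..T, F (x + y * Complex.I)) Filter.atTop
      (nhds (∫ x : ℝ, F (x + y * Complex.I))) := fun y hy =>
    intervalIntegral_tendsto_integral (hline y hy) Filter.tendsto_neg_atTop_atBot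
      Filter.tendsto_id
  have hzero : Filter.Tendsto (fun T : ℝ => C' * Real.exp (-κ * T) * |b - a|) Filter.atTop
      (nhds 0) := by
    have h1 : Filter.Tendsto (fun T : ℝ => Real.exp (-κ * T)) Filter.atTop (nhds 0) :=
      Real.tendsto_exp_atBot.comp
        (Filter.Tendsto.const_mul_atTop_of_neg (neg_neg_of_pos hκ) Filter.tendsto_id)
    simpa using (h1.const_mul C').mul_const |b - a|
  -- The vertical sides of the rectangle have fixed length, and the integrand on them is O(e^{-κT}).
  have hvert : ∀ σ : ℝ, σ = 1 ∨ σ = -1 → Filter.Tendsto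
      (fun T : ℝ => ∫ y in a..b, F ((σ * T : ℝ) + y * Complex.I)) Filter.atTop (nhds 0) := by
    intro σ hσ
    refine squeeze_zero_norm' ?_ hzero
    filter_upwards [Filter.eventually_ge_atTop 0] with T hT
    refine intervalIntegral.norm_integral_le_of_norm_le_const fun y hy => ?_
    rw [Set.uIoc_of_le hab] at hy
    have := hC' ((σ * T : ℝ) + y * Complex.I) (by simpa using ⟨hy.1.le, hy.2⟩)
    have habs : |σ * T| = T := by
      rcases hσ with rfl | rfl <;> simp [abs_of_nonneg hT]
    simpa [habs, -Complex.ofReal_mul] using this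
  have hrect : ∀ T : ℝ, 0 ≤ T →
      (∫ x in (-T)..T, F (x + a * Complex.I)) - (∫ x in (-T)..T, F (x + b * Complex.I)) +
      Complex.I • (∫ y in a..b, F ((1 * T : ℝ) + y * Complex.I)) -
      Complex.I • (∫ y in a..b, F ((-1 * T : ℝ) + y * Complex.I)) = 0 := by
    intro T hT
    have := Complex.integral_boundary_rect_eq_zero_of_differentiableOn F (-T + a * Complex.I)
      (T + b * Complex.I) (hF.mono fun ζ hζ => by
        have := hζ.2
        simp only [Complex.add_im, Complex.neg_im, Complex.ofReal_im, Complex.mul_im,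
          Complex.ofReal_re, Complex.I_im, Complex.I_re, mul_one, mul_zero, add_zero, neg_zero,
          zero_add, Set.uIcc_of_le hab] at this
        exact this)
    simpa using this
  have hlim := ((htend a ⟨le_rfl, hab⟩).sub (htend b ⟨hab, le_rfl⟩)).add
    ((hvert 1 (Or.inl rfl)).const_smul Complex.I) |>.sub
    ((hvert (-1) (Or.inr rfl)).const_smul Complex.I)
  have h0 := tendsto_nhds_unique (hlim.congr' (by
    filter_upwards [Filter.eventually_ge_atTop 0] with T hT using hrect T hT)) tendsto_const_nhds
  simpa [sub_eq_zero] using h0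

end Strip

/-! ### The functional calculus in logarithmic coordinates -/

section Calculus

variable {H : Type*} [NormedAddCommGroup H] [NormedSpace ℂ H]

/-- The angle `θ` of the contour lies strictly between the angle `ω` of `L` and `π / 2`. -/
structure IsContourAngle (L : H →ₗ.[ℂ] H) (ω θ : ℝ) : Prop where
  isOfType : IsOfType L ω
  nonneg : 0 ≤ ω
  lt : ω < θ
  lt_pi_div_two : θ < Real.pi / 2

/-- Holomorphic functions on the right half plane that decay like a power at `0` and at `∞`
in the sector of half-angle `θ`. -/
structure SectorDecay (θ : ℝ) (ψ : ℂ → ℂ) : Prop where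
  differentiableOn : DifferentiableOn ℂ ψ {z | 0 < z.re}
  bound : ∃ C κ : ℝ, 0 < κ ∧ ∀ ζ : ℂ, |ζ.im| ≤ θ →
    ‖ψ (Complex.exp ζ)‖ ≤ C * Real.exp (-κ * |ζ.re|)

/-- The integrand of the functional calculus in logarithmic coordinates. -/
def logKernel (L : H →ₗ.[ℂ] H) (ψ : ℂ → ℂ) (ζ : ℂ) : H →L[ℂ] H :=
  (ψ (Complex.exp ζ) * Complex.exp ζ) • res L (Complex.exp ζ)

/-- Substitute r = e^x. The Jacobian e^x and the factor e^{iθ} combine to the factor e^ζ of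
`logKernel`, and the corner of the contour at 0 is sent to infinity. -/
theorem rayIntegral_eq (L : H →ₗ.[ℂ] H) (θ : ℝ) (ψ : ℂ → ℂ) :
    rayIntegral L θ ψ = ∫ x : ℝ, logKernel L ψ (x + θ * Complex.I) := by
  have h := integral_image_eq_integral_abs_deriv_smul (F := H →L[ℂ] H) (s := Set.univ)
    (f := Real.exp) (f' := Real.exp) MeasurableSet.univ
    (fun x _ => (Real.hasDerivAt_exp x).hasDerivWithinAt) Real.exp_injective.injOn
    (fun r : ℝ => (ψ (r * Complex.exp (θ * Complex.I)) * Complex.exp (θ * Complex.I)) •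
      res L (r * Complex.exp (θ * Complex.I)))
  rw [Set.image_univ, Real.range_exp, setIntegral_univ] at h
  rw [rayIntegral, h]
  congr 1
  ext1 x
  rw [logKernel, Complex.exp_add, abs_of_pos (Real.exp_pos x), ← Complex.ofReal_exp,
    ← Complex.coe_smul (Real.exp x), smul_smul]
  congr 1
  ring

theorem psiCalc_eq (L : H →ₗ.[ℂ] H) (θ : ℝ) (ψ : ℂ → ℂ) :
    psiCalc L θ ψ = (2 * Real.pi * Complex.I : ℂ)⁻¹ •
      ((∫ x : ℝ, logKernel L ψ (x + (-θ : ℝ) * Complex.I)) -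
        ∫ x : ℝ, logKernel L ψ (x + θ * Complex.I)) := by
  rw [psiCalc, rayIntegral_eq, rayIntegral_eq]

theorem exp_line_re (x y : ℝ) :
    (Complex.exp (x + y * Complex.I)).re = Real.exp x * Real.cos y := by
  simp [Complex.exp_re]

theorem norm_exp_line (x y : ℝ) : ‖Complex.exp (x + y * Complex.I)‖ = Real.exp x := by
  simp [Complex.norm_exp]

theorem exp_re_pos {ζ : ℂ} (h : |ζ.im| < Real.pi / 2) : 0 < (Complex.exp ζ).re := by
  rw [Complex.exp_re]
  exact mul_pos (Real.exp_pos _) (Real.cos_pos_of_mem_Ioo (abs_lt.1 h))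

theorem norm_div_add_le_one {l : ℝ} (hl : 0 ≤ l) {z : ℂ} (hz : 0 < z.re) : ‖z / (l + z)‖ ≤ 1 := by
  rw [norm_div]
  refine div_le_one_of_le₀ ?_ (norm_nonneg _)
  rw [← sq_le_sq₀ (norm_nonneg _) (norm_nonneg _), Complex.sq_norm, Complex.sq_norm,
    Complex.normSq_apply, Complex.normSq_apply]
  simp
  nlinarith [mul_nonneg hl hz.le]

theorem add_ne_zero_of_re_pos {l : ℝ} (hl : 0 ≤ l) {z : ℂ} (hz : 0 < z.re) : (l + z : ℂ) ≠ 0 := by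
  intro h
  have := congrArg Complex.re h
  simp at this
  linarith

namespace SectorDecay

variable {θ : ℝ} {ψ φ : ℂ → ℂ}

theorem mul_bounded (h : SectorDecay θ ψ) (hθ : θ < Real.pi / 2) {g : ℂ → ℂ}
    (hg : DifferentiableOn ℂ g {z | 0 < z.re}) {B : ℝ} (hB : ∀ z : ℂ, 0 < z.re → ‖g z‖ ≤ B) :
    SectorDecay θ (fun u => g u * ψ u) := by
  refine ⟨hg.mul h.differentiableOn, ?_⟩
  obtain ⟨C, κ, hκ, hC⟩ := h.bound
  refine ⟨B * C, κ, hκ, fun ζ hζ => ?_⟩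
  rw [norm_mul, mul_assoc]
  have := hB _ (exp_re_pos (hζ.trans_lt hθ))
  exact mul_le_mul this (hC ζ hζ) (norm_nonneg _) ((norm_nonneg _).trans this)

theorem const_mul (h : SectorDecay θ ψ) (c : ℂ) : SectorDecay θ (fun u => c * ψ u) := by
  refine ⟨h.differentiableOn.const_mul c, ?_⟩
  obtain ⟨C, κ, hκ, hC⟩ := h.bound
  refine ⟨‖c‖ * C, κ, hκ, fun ζ hζ => ?_⟩
  rw [norm_mul, mul_assoc]
  gcongr
  exact hC ζ hζ

theorem add (h : SectorDecay θ ψ) (h' : SectorDecay θ φ) : SectorDecay θ (fun u => ψ u + φ u) := by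
  refine ⟨h.differentiableOn.add h'.differentiableOn, ?_⟩
  obtain ⟨C, κ, hκ, hC⟩ := h.bound
  obtain ⟨C', κ', hκ', hC'⟩ := h'.bound
  refine ⟨|C| + |C'|, min κ κ', lt_min hκ hκ', fun ζ hζ => (norm_add_le _ _).trans ?_⟩
  rw [add_mul]
  refine add_le_add ((hC ζ hζ).trans ?_) ((hC' ζ hζ).trans ?_)
  · gcongr
    · exact le_abs_self C
    · exact min_le_left _ _
  · gcongr
    · exact le_abs_self C'
    · exact min_le_right _ _

theorem sum {ι : Type*} (s : Finset ι) {ψ : ι → ℂ → ℂ} (h : ∀ i ∈ s, SectorDecay θ (ψ i)) :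
    SectorDecay θ (fun u => ∑ i ∈ s, ψ i u) := by
  classical
  induction s using Finset.induction_on with
  | empty =>
    refine ⟨by simp, 0, 1, one_pos, by simp⟩
  | insert a s ha ih =>
    simp only [Finset.sum_insert ha]
    exact (h a (Finset.mem_insert_self _ _)).add
      (ih fun i hi => h i (Finset.mem_insert_of_mem hi))

theorem div_add (h : SectorDecay θ ψ) (hθ : θ < Real.pi / 2) {l : ℝ} (hl : 0 < l) :
    SectorDecay θ (fun u => (l + u)⁻¹ * ψ u) := by
  refine h.mul_bounded hθ (B := l⁻¹) ?_ ?_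
  · exact DifferentiableOn.inv (by fun_prop) fun z hz => add_ne_zero_of_re_pos hl.le hz
  · intro z hz
    rw [norm_inv]
    gcongr
    refine le_trans ?_ (Complex.re_le_norm _)
    have hz' : 0 < z.re := hz
    simpa using hz'.le

/-- The first bound is used for |z| ≤ 1, the second for |z| ≥ 1. The constant is kept explicit
because dominated convergence later needs it uniform along a sequence of symbols. -/
theorem of_bounds (hd : DifferentiableOn ℂ ψ {z | 0 < z.re}) {A B : ℝ}
    (hA : ∀ ζ : ℂ, |ζ.im| ≤ θ → ‖ψ (Complex.exp ζ)‖ ≤ A * Real.exp ζ.re)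
    (hB : ∀ ζ : ℂ, |ζ.im| ≤ θ → ‖ψ (Complex.exp ζ)‖ ≤ B * Real.exp (-ζ.re)) :
    SectorDecay θ ψ ∧ ∀ ζ : ℂ, |ζ.im| ≤ θ →
      ‖ψ (Complex.exp ζ)‖ ≤ max A B * Real.exp (-1 * |ζ.re|) := by
  have h : ∀ ζ : ℂ, |ζ.im| ≤ θ →
      ‖ψ (Complex.exp ζ)‖ ≤ max A B * Real.exp (-1 * |ζ.re|) := by
    intro ζ hζ
    rcases le_total 0 ζ.re with h0 | h0
    · rw [abs_of_nonneg h0, neg_one_mul]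
      refine (hB ζ hζ).trans ?_
      gcongr
      exact le_max_right _ _
    · rw [abs_of_nonpos h0, neg_one_mul, neg_neg]
      refine (hA ζ hζ).trans ?_
      gcongr
      exact le_max_left _ _
  exact ⟨⟨hd, max A B, 1, one_pos, h⟩, h⟩

end SectorDecay

namespace IsContourAngle

variable {L : H →ₗ.[ℂ] H} {ω θ : ℝ}

theorem pos (h : IsContourAngle L ω θ) : 0 < θ := h.nonneg.trans_lt h.lt

/-- The intermediate angle `(ω + θ) / 2` leaves room on both sides: it exceeds `ω`, so the resolvent
bound applies outside its sector, and the contour at angle `θ` stays outside that sector. -/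
theorem line_mem (h : IsContourAngle L ω θ) {y : ℝ} (hy : |y| = θ) (x : ℝ) :
    Complex.exp (x + y * Complex.I) ∈ {z : ℂ | z.re < ‖z‖ * Real.cos ((ω + θ) / 2)} := by
  rw [Set.mem_ofPred_eq, exp_line_re, norm_exp_line, ← Real.cos_abs, hy]
  have := h.nonneg
  have := h.lt
  have := h.lt_pi_div_two
  have := Real.pi_pos
  have := Real.cos_lt_cos_of_nonneg_of_le_pi (x := (ω + θ) / 2) (y := θ)
    (by linarith) (by linarith) (by linarith)
  gcongr

theorem lt_mid (h : IsContourAngle L ω θ) : ω < (ω + θ) / 2 := by linarith [h.lt]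

theorem mid_le (h : IsContourAngle L ω θ) : (ω + θ) / 2 ≤ Real.pi := by
  linarith [h.lt, h.lt_pi_div_two, Real.pi_pos]

theorem line_notMem (h : IsContourAngle L ω θ) {y : ℝ} (hy : |y| = θ) (x : ℝ) :
    Complex.exp (x + y * Complex.I) ∉ spectrumOf L :=
  h.isOfType.notMem_spectrum h.lt_mid h.mid_le (h.line_mem hy x)

theorem neg_notMem (h : IsContourAngle L ω θ) {l : ℝ} (hl : 0 < l) :
    (-l : ℂ) ∉ spectrumOf L := by
  refine h.isOfType.notMem_spectrum h.lt_mid h.mid_le ?_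
  have : 0 < Real.cos ((ω + θ) / 2) := Real.cos_pos_of_mem_Ioo
    ⟨by linarith [h.lt, h.nonneg, Real.pi_pos], by linarith [h.lt, h.lt_pi_div_two]⟩
  have h2 : 0 < ‖(-l : ℂ)‖ * Real.cos ((ω + θ) / 2) := by
    rw [norm_neg, Complex.norm_real, Real.norm_of_nonneg hl.le]
    positivity
  refine lt_trans ?_ h2
  simpa using hl

theorem continuous_res_line (h : IsContourAngle L ω θ) {y : ℝ} (hy : |y| = θ) :
    Continuous fun x : ℝ => res L (Complex.exp (x + y * Complex.I)) :=
  (h.isOfType.differentiableOn_res h.lt_mid h.mid_le).continuousOn.comp_continuous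
    (by fun_prop) (h.line_mem hy)

theorem exists_bound (h : IsContourAngle L ω θ) : ∃ c : ℝ, 0 ≤ c ∧ ∀ y : ℝ, |y| = θ → ∀ x : ℝ,
    Real.exp x * ‖res L (Complex.exp (x + y * Complex.I))‖ ≤ c := by
  obtain ⟨c, hc⟩ := h.isOfType.resolvent_bound _ h.lt_mid
  refine ⟨|c|, abs_nonneg c, fun y hy x => ?_⟩
  have := hc _ (notMem_sector h.mid_le (h.line_mem hy x))
  rw [norm_exp_line] at this
  calc _ ≤ Real.exp x * (c * (Real.exp x)⁻¹) := by gcongr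
    _ = c := by field_simp
    _ ≤ |c| := le_abs_self c

/-- The bound on ‖z (z - L)⁻¹‖ absorbs the factor e^ζ, so convergence depends on the decay of `ψ`
alone, with `c` independent of `ψ`. -/
theorem norm_logKernel_le (h : IsContourAngle L ω θ) : ∃ c : ℝ, 0 ≤ c ∧ ∀ y : ℝ, |y| = θ →
    ∀ (x : ℝ) (ψ : ℂ → ℂ), ‖logKernel L ψ (x + y * Complex.I)‖ ≤
      c * ‖ψ (Complex.exp (x + y * Complex.I))‖ := by
  obtain ⟨c, hc0, hc⟩ := h.exists_bound
  refine ⟨c, hc0, fun y hy x ψ => ?_⟩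
  rw [logKernel, norm_smul, norm_mul, norm_exp_line, mul_assoc, mul_comm]
  gcongr
  exact hc y hy x

theorem continuous_comp_line (h : IsContourAngle L ω θ) {y : ℝ} (hy : |y| = θ) {ψ : ℂ → ℂ}
    (hψ : DifferentiableOn ℂ ψ {z | 0 < z.re}) :
    Continuous fun x : ℝ => ψ (Complex.exp (x + y * Complex.I)) :=
  hψ.continuousOn.comp_continuous (by fun_prop) fun x =>
    exp_re_pos (by simpa [hy] using h.lt_pi_div_two)

theorem continuous_logKernel (h : IsContourAngle L ω θ) {y : ℝ} (hy : |y| = θ) {ψ : ℂ → ℂ}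
    (hψ : DifferentiableOn ℂ ψ {z | 0 < z.re}) :
    Continuous fun x : ℝ => logKernel L ψ (x + y * Complex.I) :=
  ((h.continuous_comp_line hy hψ).mul (by fun_prop)).smul (h.continuous_res_line hy)

theorem integrable_logKernel (h : IsContourAngle L ω θ) {y : ℝ} (hy : |y| = θ) {ψ : ℂ → ℂ}
    (hψ : SectorDecay θ ψ) : Integrable fun x : ℝ => logKernel L ψ (x + y * Complex.I) := by
  obtain ⟨C, κ, hκ, hC⟩ := hψ.bound
  obtain ⟨c, hc0, hc⟩ := h.norm_logKernel_le
  refine integrable_line (C := c * C) hκ (h.continuous_logKernel hy hψ.differentiableOn)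
    fun x => (hc y hy x ψ).trans ?_
  rw [mul_assoc]
  gcongr
  simpa using hC (x + y * Complex.I) (by simp [hy])

theorem abs_eq (h : IsContourAngle L ω θ) : |θ| = θ := abs_of_pos h.pos

theorem abs_neg_eq (h : IsContourAngle L ω θ) : |(-θ)| = θ := by rw [abs_neg, h.abs_eq]

theorem psiCalc_congr (h : IsContourAngle L ω θ) {ψ φ : ℂ → ℂ}
    (hψ : ∀ u : ℂ, 0 < u.re → ψ u = φ u) : psiCalc L θ ψ = psiCalc L θ φ := by
  have key : ∀ y : ℝ, |y| = θ → ∀ x : ℝ,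
      logKernel L ψ (x + y * Complex.I) = logKernel L φ (x + y * Complex.I) := by
    intro y hy x
    rw [logKernel, logKernel, hψ _ (exp_re_pos (by simpa [hy] using h.lt_pi_div_two))]
  rw [psiCalc_eq, psiCalc_eq]
  simp only [key θ h.abs_eq, key (-θ) h.abs_neg_eq]

theorem psiCalc_add (h : IsContourAngle L ω θ) {ψ φ : ℂ → ℂ} (hψ : SectorDecay θ ψ)
    (hφ : SectorDecay θ φ) :
    psiCalc L θ (fun u => ψ u + φ u) = psiCalc L θ ψ + psiCalc L θ φ := by
  have key : ∀ ζ, logKernel L (fun u => ψ u + φ u) ζ = logKernel L ψ ζ + logKernel L φ ζ := by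
    intro ζ
    simp only [logKernel, add_mul, add_smul]
  simp only [psiCalc_eq, key]
  rw [integral_add (h.integrable_logKernel h.abs_neg_eq hψ)
    (h.integrable_logKernel h.abs_neg_eq hφ), integral_add (h.integrable_logKernel h.abs_eq hψ)
    (h.integrable_logKernel h.abs_eq hφ), ← smul_add]
  congr 1
  abel

theorem psiCalc_const_mul (L : H →ₗ.[ℂ] H) (θ : ℝ) (c : ℂ) (ψ : ℂ → ℂ) :
    psiCalc L θ (fun u => c * ψ u) = c • psiCalc L θ ψ := by
  have key : ∀ ζ, logKernel L (fun u => c * ψ u) ζ = c • logKernel L ψ ζ := by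
    intro ζ
    simp only [logKernel, mul_assoc, smul_smul]
  simp only [psiCalc_eq, key, integral_smul]
  rw [← smul_sub, smul_comm]

theorem psiCalc_sum (h : IsContourAngle L ω θ) {ι : Type*} (s : Finset ι) {ψ : ι → ℂ → ℂ}
    (hψ : ∀ i ∈ s, SectorDecay θ (ψ i)) :
    psiCalc L θ (fun u => ∑ i ∈ s, ψ i u) = ∑ i ∈ s, psiCalc L θ (ψ i) := by
  classical
  induction s using Finset.induction_on with
  | empty =>
    have := psiCalc_const_mul L θ 0 (fun _ => 0)
    simpa using this
  | insert a s ha ih =>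
    simp only [Finset.sum_insert ha]
    rw [h.psiCalc_add (hψ a (Finset.mem_insert_self _ _))
      (SectorDecay.sum s fun i hi => hψ i (Finset.mem_insert_of_mem hi)),
      ih fun i hi => hψ i (Finset.mem_insert_of_mem hi)]

theorem mul_psiCalc (h : IsContourAngle L ω θ) [CompleteSpace H] {ψ : ℂ → ℂ} (hψ : SectorDecay θ ψ)
    (A : H →L[ℂ] H) :
    A * psiCalc L θ ψ = (2 * Real.pi * Complex.I : ℂ)⁻¹ •
      ((∫ x : ℝ, A * logKernel L ψ (x + (-θ : ℝ) * Complex.I)) -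
        ∫ x : ℝ, A * logKernel L ψ (x + θ * Complex.I)) := by
  rw [psiCalc_eq, mul_smul_comm, mul_sub,
    integral_const_mul_of_integrable (h.integrable_logKernel h.abs_neg_eq hψ),
    integral_const_mul_of_integrable (h.integrable_logKernel h.abs_eq hψ)]

theorem psiCalc_mul (h : IsContourAngle L ω θ) [CompleteSpace H] {ψ : ℂ → ℂ} (hψ : SectorDecay θ ψ)
    (A : H →L[ℂ] H) :
    psiCalc L θ ψ * A = (2 * Real.pi * Complex.I : ℂ)⁻¹ •
      ((∫ x : ℝ, logKernel L ψ (x + (-θ : ℝ) * Complex.I) * A) -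
        ∫ x : ℝ, logKernel L ψ (x + θ * Complex.I) * A) := by
  rw [psiCalc_eq, smul_mul_assoc, sub_mul,
    integral_mul_const_of_integrable (h.integrable_logKernel h.abs_neg_eq hψ),
    integral_mul_const_of_integrable (h.integrable_logKernel h.abs_eq hψ)]

theorem psiCalc_comm_res (h : IsContourAngle L ω θ) [CompleteSpace H] {ψ : ℂ → ℂ}
    (hψ : SectorDecay θ ψ) {l : ℝ} (hl : 0 < l) :
    psiCalc L θ ψ * res L (-l) = res L (-l) * psiCalc L θ ψ := by
  rw [h.psiCalc_mul hψ, h.mul_psiCalc hψ]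
  simp only [logKernel, smul_mul_assoc, mul_smul_comm,
    fun x : ℝ => res_mul_comm (h.line_notMem h.abs_eq x) (h.neg_notMem hl),
    fun x : ℝ => res_mul_comm (h.line_notMem h.abs_neg_eq x) (h.neg_notMem hl)]

/-- The functional calculus is multiplicative with respect to resolvents. -/
theorem neg_res_mul_psiCalc (h : IsContourAngle L ω θ) [CompleteSpace H] {ψ : ℂ → ℂ}
    (hψ : SectorDecay θ ψ) {l : ℝ} (hl : 0 < l) :
    -res L (-l) * psiCalc L θ ψ = psiCalc L θ (fun u => (l + u)⁻¹ * ψ u) := by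
  have hψ' := hψ.div_add h.lt_pi_div_two hl
  -- `F` is the scalar coefficient of `res L (-l)` left over when the resolvent identity splits the
  -- product of resolvents. Since `-l` lies outside the sector, `F` is holomorphic between the two
  -- lines; its integrals over them agree and cancel in `psiCalc`.
  set F : ℂ → ℂ := fun ζ =>
    Complex.exp ζ / (l + Complex.exp ζ) * ψ (Complex.exp ζ) with hF
  obtain ⟨C, κ, hκ, hC⟩ := hψ.bound
  have hFb : ∀ ζ : ℂ, |ζ.im| ≤ θ → ‖F ζ‖ ≤ C * Real.exp (-κ * |ζ.re|) := by
    intro ζ hζ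
    rw [hF, norm_mul]
    refine (mul_le_of_le_one_left (norm_nonneg _) ?_).trans (hC ζ hζ)
    exact norm_div_add_le_one hl.le (exp_re_pos (hζ.trans_lt h.lt_pi_div_two))
  have hFd : DifferentiableOn ℂ F {ζ | ζ.im ∈ Set.Icc (-θ) θ} := by
    have hm : Set.MapsTo Complex.exp {ζ : ℂ | ζ.im ∈ Set.Icc (-θ) θ} {z | 0 < z.re} :=
      fun ζ hζ => exp_re_pos ((abs_le.2 hζ).trans_lt h.lt_pi_div_two)
    refine DifferentiableOn.mul (DifferentiableOn.div (by fun_prop) (by fun_prop)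
      fun ζ hζ => add_ne_zero_of_re_pos hl.le (hm hζ)) ?_
    exact hψ.differentiableOn.comp (Differentiable.differentiableOn (by fun_prop)) hm
  have hcauchy := integral_line_eq_integral_line (F := F) (a := -θ) (b := θ)
    (by linarith [h.pos]) hκ hFd fun ζ hζ _ => hFb ζ (abs_le.2 hζ)
  have hker : ∀ y : ℝ, |y| = θ → ∀ x : ℝ, -res L (-l) * logKernel L ψ (x + y * Complex.I) =
      logKernel L (fun u => (l + u)⁻¹ * ψ u) (x + y * Complex.I) -
        F (x + y * Complex.I) • res L (-l) := by
    intro y hy x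
    have hne := add_ne_zero_of_re_pos hl.le
      (exp_re_pos (ζ := x + y * Complex.I) (by simpa [hy] using h.lt_pi_div_two))
    have h1 := res_sub_res (h.neg_notMem hl) (h.line_notMem hy x)
    have h2 : -(res L (-l) * res L (Complex.exp (x + y * Complex.I))) =
        (l + Complex.exp (x + y * Complex.I))⁻¹ •
          (res L (Complex.exp (x + y * Complex.I)) - res L (-l)) := by
      rw [eq_inv_smul_iff₀ hne, smul_neg, neg_eq_iff_eq_neg, neg_sub, h1]
      congr 1
      ring
    simp only [logKernel, hF]
    rw [mul_smul_comm, neg_mul, h2, smul_smul, smul_sub]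
    congr 2 <;> field_simp
  have hFi : ∀ y : ℝ, |y| = θ → Integrable fun x : ℝ => F (x + y * Complex.I) • res L (-l) := by
    intro y hy
    refine Integrable.smul_const ?_ _
    refine integrable_line (C := C) hκ (hFd.continuousOn.comp_continuous (by fun_prop) fun x => ?_)
      fun x => ?_
    · simpa using abs_le.1 hy.le
    · simpa using hFb (x + y * Complex.I) (by simp [hy])
  rw [h.mul_psiCalc hψ, psiCalc_eq]
  simp only [hker θ h.abs_eq, hker (-θ) h.abs_neg_eq]
  rw [integral_sub (h.integrable_logKernel h.abs_neg_eq hψ') (hFi _ h.abs_neg_eq),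
    integral_sub (h.integrable_logKernel h.abs_eq hψ') (hFi _ h.abs_eq),
    integral_smul_const, integral_smul_const, hcauchy]
  congr 1
  abel

/-- Dominated convergence for the functional calculus. -/
theorem tendsto_psiCalc (h : IsContourAngle L ω θ) {ψ : ℕ → ℂ → ℂ} {φ : ℂ → ℂ} {C κ : ℝ}
    (hκ : 0 < κ) (hd : ∀ᶠ n in Filter.atTop, DifferentiableOn ℂ (ψ n) {z | 0 < z.re})
    (hb : ∀ᶠ n in Filter.atTop, ∀ ζ : ℂ, |ζ.im| ≤ θ →
      ‖ψ n (Complex.exp ζ)‖ ≤ C * Real.exp (-κ * |ζ.re|))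
    (hlim : ∀ z : ℂ, 0 < z.re → Filter.Tendsto (fun n => ψ n z) Filter.atTop (nhds (φ z))) :
    Filter.Tendsto (fun n => psiCalc L θ (ψ n)) Filter.atTop (nhds (psiCalc L θ φ)) := by
  obtain ⟨c, hc0, hc⟩ := h.norm_logKernel_le
  have key : ∀ y : ℝ, |y| = θ → Filter.Tendsto
      (fun n => ∫ x : ℝ, logKernel L (ψ n) (x + y * Complex.I)) Filter.atTop
      (nhds (∫ x : ℝ, logKernel L φ (x + y * Complex.I))) := by
    intro y hy
    refine tendsto_integral_filter_of_dominated_convergence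
      (fun x => c * (C * Real.exp (-κ * |x|))) ?_ ?_
      (((integrable_exp_neg_mul_abs hκ).const_mul C).const_mul c) ?_
    · filter_upwards [hd] with n hn using (h.continuous_logKernel hy hn).aestronglyMeasurable
    · filter_upwards [hb] with n hn
      refine Filter.Eventually.of_forall fun x => (hc y hy x _).trans ?_
      gcongr
      simpa using hn (x + y * Complex.I) (by simp [hy])
    · refine Filter.Eventually.of_forall fun x => ?_
      exact ((hlim _ (exp_re_pos (by simpa [hy] using h.lt_pi_div_two))).mul_const _).smul_const _
  simp only [psiCalc_eq]
  exact ((key _ h.abs_neg_eq).sub (key _ h.abs_eq)).const_smul _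

end IsContourAngle

end Calculus

/-! ### Moments of a kernel with a double pole -/

section Residue

theorem one_sub_exp_ne_zero {ζ : ℂ} (h : |ζ.im| ≤ Real.pi) (hne : ζ ≠ 0) :
    1 - Complex.exp ζ ≠ 0 := by
  intro h0
  obtain ⟨n, hn⟩ := Complex.exp_eq_one_iff.1 (sub_eq_zero.1 h0).symm
  have him : ζ.im = n * (2 * Real.pi) := by rw [hn]; simp
  have hn0 : n = 0 := by
    by_contra hn0
    have h1 : (1 : ℝ) ≤ |(n : ℝ)| := by exact_mod_cast Int.one_le_abs hn0
    rw [him, abs_mul, abs_of_pos Real.two_pi_pos] at h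
    nlinarith [Real.pi_pos]
  exact hne (by rw [hn, hn0]; simp)

/-- The kernel `e^ζ / (1 - e^ζ)²`, with a double pole at `0`. -/
def poleKernel (ζ : ℂ) : ℂ := Complex.exp ζ / (1 - Complex.exp ζ) ^ 2

theorem norm_poleKernel_le {ζ : ℂ} (h : 1 ≤ |ζ.re|) :
    ‖poleKernel ζ‖ ≤ 4 * Real.exp (-|ζ.re|) := by
  have he : Real.exp (-1) ≤ 1 / 2 := by
    rw [Real.exp_neg, one_div]
    have := Real.add_one_le_exp 1
    gcongr
    linarith
  have h1 : |1 - Real.exp ζ.re| ≤ ‖1 - Complex.exp ζ‖ := by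
    have := abs_norm_sub_norm_le 1 (Complex.exp ζ)
    rwa [norm_one, Complex.norm_exp] at this
  rw [poleKernel, norm_div, norm_pow, Complex.norm_exp]
  have hpos := Real.exp_pos ζ.re
  rcases le_total 0 ζ.re with h0 | h0
  · rw [abs_of_nonneg h0] at h ⊢
    have h2 : Real.exp (-ζ.re) ≤ 1 / 2 := (Real.exp_le_exp.2 (by linarith)).trans he
    have h3 : Real.exp ζ.re * Real.exp (-ζ.re) = 1 := by rw [← Real.exp_add]; simp
    have h4 : Real.exp ζ.re / 2 ≤ ‖1 - Complex.exp ζ‖ := by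
      have := neg_abs_le (1 - Real.exp ζ.re)
      nlinarith
    calc Real.exp ζ.re / ‖1 - Complex.exp ζ‖ ^ 2 ≤ Real.exp ζ.re / (Real.exp ζ.re / 2) ^ 2 := by
          gcongr
      _ = 4 * Real.exp (-ζ.re) := by rw [Real.exp_neg]; field_simp; norm_num
  · rw [abs_of_nonpos h0] at h ⊢
    have h2 : Real.exp (ζ.re) ≤ 1 / 2 := (Real.exp_le_exp.2 (by linarith)).trans he
    have h4 : 1 / 2 ≤ ‖1 - Complex.exp ζ‖ := by
      have := le_abs_self (1 - Real.exp ζ.re)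
      linarith
    calc Real.exp ζ.re / ‖1 - Complex.exp ζ‖ ^ 2 ≤ Real.exp ζ.re / (1 / 2) ^ 2 := by
          gcongr
      _ = 4 * Real.exp (- -ζ.re) := by rw [neg_neg]; ring

/-- A linear factor costs half of the exponential rate, since |x| e^{-|x|/2} ≤ 2. -/
theorem abs_mul_exp_le {A B x : ℝ} (hA : 0 ≤ A) (hB : 0 ≤ B) :
    (A + B * |x|) * Real.exp (-|x|) ≤ (A + 2 * B) * Real.exp (-(1 / 2) * |x|) := by
  have h1 : Real.exp (-|x|) = Real.exp (-(1 / 2) * |x|) * Real.exp (-(|x| / 2)) := by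
    rw [← Real.exp_add]; ring_nf
  have h2 : Real.exp (|x| / 2) * Real.exp (-(|x| / 2)) = 1 := by rw [← Real.exp_add]; simp
  have h3 := Real.add_one_le_exp (|x| / 2)
  have h4 : Real.exp (-(|x| / 2)) ≤ 1 := Real.exp_le_one_iff.2 (by have := abs_nonneg x; linarith)
  have h5 : |x| * Real.exp (-(|x| / 2)) ≤ 2 := by
    nlinarith [Real.exp_pos (-(|x| / 2))]
  rw [h1, mul_comm (A + B * |x|), mul_assoc, mul_comm]
  gcongr
  nlinarith

theorem differentiableOn_poleKernel {s : Set ℂ} (h : ∀ ζ ∈ s, 1 - Complex.exp ζ ≠ 0) :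
    DifferentiableOn ℂ poleKernel s :=
  DifferentiableOn.div (by fun_prop) (by fun_prop) fun ζ hζ => pow_ne_zero 2 (h ζ hζ)

/-- At height ±π the exponential changes sign, and the kernel becomes minus the logistic density:
real, even and of total mass -1. -/
theorem poleKernel_line {σ : ℝ} (hσ : |σ| = 1) (x : ℝ) :
    poleKernel (x + (σ * Real.pi : ℝ) * Complex.I) =
      ((-(Real.exp x / (1 + Real.exp x) ^ 2) : ℝ) : ℂ) := by
  have : Complex.exp ((σ * Real.pi : ℝ) * Complex.I) = -1 := by
    rcases eq_or_eq_neg_of_abs_eq hσ with rfl | rfl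
    · simp
    · simp [Complex.exp_neg]
  rw [poleKernel, Complex.exp_add, this]
  push_cast
  ring

theorem integrable_logistic : Integrable fun x : ℝ => Real.exp x / (1 + Real.exp x) ^ 2 := by
  refine (integrable_exp_neg_mul_abs one_pos).mono' ?_ (Filter.Eventually.of_forall fun x => ?_)
  · exact Continuous.aestronglyMeasurable (by fun_prop (disch := intros; positivity))
  · rw [Real.norm_of_nonneg (by positivity), neg_one_mul]
    have hpos := Real.exp_pos x
    rcases le_total 0 x with h0 | h0
    · rw [abs_of_nonneg h0, Real.exp_neg, div_le_iff₀ (by positivity), ← div_eq_inv_mul,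
        le_div_iff₀ hpos]
      nlinarith
    · rw [abs_of_nonpos h0, neg_neg]
      exact div_le_self hpos.le (by nlinarith)

theorem integral_logistic : ∫ x : ℝ, Real.exp x / (1 + Real.exp x) ^ 2 = 1 := by
  have hd : ∀ x : ℝ, HasDerivAt (fun x => -(1 + Real.exp x)⁻¹)
      (Real.exp x / (1 + Real.exp x) ^ 2) x := by
    intro x
    have h1 := ((Real.hasDerivAt_exp x).const_add 1).inv (by positivity)
    have h2 := h1.neg
    rwa [neg_div, neg_neg] at h2
  have hbot : Filter.Tendsto (fun x => -(1 + Real.exp x)⁻¹) Filter.atBot (nhds (-1)) := by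
    have := ((Real.tendsto_exp_atBot.const_add 1).inv₀ (by norm_num)).neg
    simpa using this
  have htop : Filter.Tendsto (fun x => -(1 + Real.exp x)⁻¹) Filter.atTop (nhds 0) := by
    have := (tendsto_inv_atTop_zero.comp
      (Filter.tendsto_atTop_add_const_left _ 1 Real.tendsto_exp_atTop)).neg
    simpa [Function.comp_def] using this
  rw [integral_of_hasDerivAt_of_tendsto hd integrable_logistic hbot htop]
  norm_num

theorem logistic_neg (x : ℝ) :
    Real.exp (-x) / (1 + Real.exp (-x)) ^ 2 = Real.exp x / (1 + Real.exp x) ^ 2 := by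
  rw [Real.exp_neg]
  have := Real.exp_pos x
  field_simp
  ring

/-- No pole lies between the heights `σ * β` and `σ * π`, so the line may be pushed to `σ * π`.
There the first moment is that of an even density shifted by iσπ: the real part of the variable
contributes nothing and the shift contributes iσπ times the mass -1. Hence the answer does not
depend on `β`. -/
theorem integral_mul_poleKernel {σ β : ℝ} (hσ : |σ| = 1) (hβ : 0 < β) (hβ' : β ≤ Real.pi) :
    (∫ x : ℝ, poleKernel (x + (σ * β : ℝ) * Complex.I) = -1) ∧
    ∫ x : ℝ, (x + (σ * β : ℝ) * Complex.I) * poleKernel (x + (σ * β : ℝ) * Complex.I) =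
      -(σ * Real.pi * Complex.I) := by
  have hne : ∀ y : ℝ, y ∈ Set.uIcc (σ * β) (σ * Real.pi) → 0 < |y| ∧ |y| ≤ Real.pi := by
    intro y hy
    rcases eq_or_eq_neg_of_abs_eq hσ with rfl | rfl
    · rw [one_mul, one_mul, Set.uIcc_of_le hβ'] at hy
      rw [abs_of_pos (hβ.trans_le hy.1)]
      exact ⟨hβ.trans_le hy.1, hy.2⟩
    · rw [neg_one_mul, neg_one_mul, Set.uIcc_of_ge (neg_le_neg hβ')] at hy
      have : y < 0 := by linarith [hy.2]
      rw [abs_of_neg this]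
      exact ⟨by linarith, by linarith [hy.1]⟩
  have hd : DifferentiableOn ℂ poleKernel {ζ | ζ.im ∈ Set.uIcc (σ * β) (σ * Real.pi)} :=
    differentiableOn_poleKernel fun ζ hζ => one_sub_exp_ne_zero (hne _ hζ).2 (by
      rintro rfl
      simpa using (hne _ hζ).1)
  have hb1 : ∀ ζ : ℂ, ζ.im ∈ Set.uIcc (σ * β) (σ * Real.pi) → 1 ≤ |ζ.re| →
      ‖poleKernel ζ‖ ≤ 4 * Real.exp (-1 * |ζ.re|) := fun ζ _ h1 => by
    simpa using norm_poleKernel_le h1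
  have hb2 : ∀ ζ : ℂ, ζ.im ∈ Set.uIcc (σ * β) (σ * Real.pi) → 1 ≤ |ζ.re| →
      ‖ζ * poleKernel ζ‖ ≤ (Real.pi * 4 + 2 * 4) * Real.exp (-(1 / 2) * |ζ.re|) := by
    intro ζ hζ h1
    refine le_trans ?_ (abs_mul_exp_le (by positivity) (by norm_num))
    rw [norm_mul]
    calc ‖ζ‖ * ‖poleKernel ζ‖ ≤ (|ζ.re| + Real.pi) * (4 * Real.exp (-|ζ.re|)) := by
          gcongr
          · exact (Complex.norm_le_abs_re_add_abs_im ζ).trans (by linarith [(hne _ hζ).2])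
          · exact norm_poleKernel_le h1
      _ = _ := by ring
  have hshift : ∀ (F : ℂ → ℂ) (C κ : ℝ), 0 < κ →
      DifferentiableOn ℂ F {ζ | ζ.im ∈ Set.uIcc (σ * β) (σ * Real.pi)} →
      (∀ ζ : ℂ, ζ.im ∈ Set.uIcc (σ * β) (σ * Real.pi) → 1 ≤ |ζ.re| →
        ‖F ζ‖ ≤ C * Real.exp (-κ * |ζ.re|)) →
      ∫ x : ℝ, F (x + (σ * β : ℝ) * Complex.I) = ∫ x : ℝ, F (x + (σ * Real.pi : ℝ) * Complex.I) := by
    intro F C κ hκ hF hb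
    rcases le_total (σ * β) (σ * Real.pi) with hle | hle
    · rw [Set.uIcc_of_le hle] at hF hb
      exact integral_line_eq_integral_line hle hκ hF hb
    · rw [Set.uIcc_of_ge hle] at hF hb
      exact (integral_line_eq_integral_line hle hκ hF hb).symm
  have h1 := hshift _ _ _ one_pos hd hb1
  have h2 := hshift _ _ _ (by norm_num) (differentiableOn_id.mul hd) hb2
  have hval : ∫ x : ℝ, poleKernel (x + (σ * Real.pi : ℝ) * Complex.I) = -1 := by
    simp only [poleKernel_line hσ, integral_complex_ofReal, integral_neg, integral_logistic]
    simp
  refine ⟨h1.trans hval, h2.trans ?_⟩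
  have hodd : ∫ x : ℝ, (x : ℂ) * poleKernel (x + (σ * Real.pi : ℝ) * Complex.I) = 0 := by
    have h3 := integral_neg_eq_self
      (fun x : ℝ => (x : ℂ) * poleKernel (x + (σ * Real.pi : ℝ) * Complex.I)) volume
    simp only [poleKernel_line hσ, logistic_neg] at h3 ⊢
    simp only [Complex.ofReal_neg, neg_mul, integral_neg, mul_neg] at h3 ⊢
    rw [neg_neg] at h3
    rw [neg_eq_zero]
    exact self_eq_neg.1 h3
  have hpi : Integrable fun x : ℝ => poleKernel (x + (σ * Real.pi : ℝ) * Complex.I) := by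
    simp only [poleKernel_line hσ]
    exact integrable_logistic.neg.ofReal
  have hall : Integrable fun x : ℝ => (x + (σ * Real.pi : ℝ) * Complex.I) *
      poleKernel (x + (σ * Real.pi : ℝ) * Complex.I) := by
    obtain ⟨C', hC'⟩ := exists_bound_of_continuousOn_strip (a := σ * Real.pi) (b := σ * Real.pi)
      ((differentiableOn_id.mul hd).continuousOn.mono fun ζ hζ => by
        have : ζ.im = σ * Real.pi := le_antisymm hζ.2 hζ.1
        rw [Set.mem_ofPred_eq, this]
        exact Set.right_mem_uIcc)
      fun ζ hζ => hb2 ζ (by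
        have : ζ.im = σ * Real.pi := le_antisymm hζ.2 hζ.1
        rw [this]
        exact Set.right_mem_uIcc)
    refine integrable_line (F := fun ζ => ζ * poleKernel ζ) (C := C') (κ := 1 / 2) (by norm_num)
      ((differentiableOn_id.mul hd).continuousOn.comp_continuous (by fun_prop) fun x => ?_)
      fun x => ?_
    · simp
    · have := hC' (x + (σ * Real.pi : ℝ) * Complex.I) (by simp)
      simpa using this
  have hx : Integrable fun x : ℝ => (x : ℂ) *
      poleKernel (x + (σ * Real.pi : ℝ) * Complex.I) := by
    have := hall.sub (hpi.const_mul ((σ * Real.pi : ℝ) * Complex.I))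
    refine this.congr (Filter.Eventually.of_forall fun x => ?_)
    simp only [Pi.sub_apply]
    ring
  change ∫ x : ℝ, ((x : ℂ) + (σ * Real.pi : ℝ) * Complex.I) *
    poleKernel (x + (σ * Real.pi : ℝ) * Complex.I) = _
  simp only [add_mul]
  rw [integral_add hx (hpi.const_mul _), hodd, integral_const_mul, hval]
  push_cast
  ring

end Residue

/-! ### The residue computation for u / (1 + u)² -/

section BaseIdentity

variable {H : Type*} [NormedAddCommGroup H] [NormedSpace ℂ H] {L : H →ₗ.[ℂ] H} {ω θ : ℝ}

namespace IsContourAngle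

theorem neg_exp_mem (h : IsContourAngle L ω θ) {ζ : ℂ} (hζ : |ζ.im| < Real.pi - (ω + θ) / 2) :
    -Complex.exp ζ ∈ {z : ℂ | z.re < ‖z‖ * Real.cos ((ω + θ) / 2)} := by
  rw [Set.mem_ofPred_eq, Complex.neg_re, norm_neg, Complex.norm_exp, Complex.exp_re]
  have h1 := Real.cos_lt_cos_of_nonneg_of_le_pi (abs_nonneg ζ.im)
    (by linarith [h.nonneg, h.lt]) hζ
  rw [Real.cos_abs, Real.cos_pi_sub] at h1
  nlinarith [Real.exp_pos ζ.re]

theorem differentiableOn_exp_smul_res (h : IsContourAngle L ω θ) :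
    DifferentiableOn ℂ (fun ζ : ℂ => -Complex.exp ζ • res L (-Complex.exp ζ))
      {ζ | |ζ.im| < Real.pi - (ω + θ) / 2} := by
  have he : DifferentiableOn ℂ (fun ζ : ℂ => -Complex.exp ζ)
      {ζ | |ζ.im| < Real.pi - (ω + θ) / 2} := Differentiable.differentiableOn (by fun_prop)
  exact he.smul ((h.isOfType.differentiableOn_res h.lt_mid h.mid_le).comp he
    fun _ hζ => h.neg_exp_mem hζ)

/-- The remainder of the second order expansion of `z (z - L)⁻¹`, `z = -e^ζ`, at `ζ = 0`. -/
def expansionRemainder (L : H →ₗ.[ℂ] H) (ζ : ℂ) : H →L[ℂ] H :=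
  -Complex.exp ζ • res L (-Complex.exp ζ) - resOne L - ζ • (resOne L - resOne L * resOne L)

theorem differentiableOn_expansionRemainder (h : IsContourAngle L ω θ) :
    DifferentiableOn ℂ (expansionRemainder L) {ζ | |ζ.im| < Real.pi - (ω + θ) / 2} :=
  (h.differentiableOn_exp_smul_res.sub_const _).sub (by fun_prop)

/-- Together with the value 0 at 0 this is the double zero that cancels the double pole of
`poleKernel`. -/
theorem hasDerivAt_expansionRemainder (h : IsContourAngle L ω θ) :
    HasDerivAt (expansionRemainder L) 0 0 := by
  have hmem := h.neg_exp_mem (ζ := 0) (by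
    have := h.lt; have := h.lt_pi_div_two; have := Real.pi_pos; simp; linarith)
  have h0 : HasDerivAt (fun ζ : ℂ => -Complex.exp ζ) (-1) 0 := by
    have := (Complex.hasDerivAt_exp 0).neg
    rwa [Complex.exp_zero] at this
  have h1 := (h.isOfType.hasDerivAt_res h.lt_mid h.mid_le hmem).scomp (0 : ℂ) h0
  have h2 := ((h0.smul h1).sub_const (resOne L)).sub
    ((hasDerivAt_id (0 : ℂ)).smul_const (resOne L - resOne L * resOne L))
  refine h2.congr_deriv ?_
  simp [resOne]
  abel

theorem expansionRemainder_zero (L : H →ₗ.[ℂ] H) : expansionRemainder L 0 = 0 := by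
  simp [expansionRemainder, resOne]

theorem norm_expansionRemainder_le (h : IsContourAngle L ω θ) : ∃ A B : ℝ, 0 ≤ A ∧ 0 ≤ B ∧
    ∀ ζ : ℂ, |ζ.im| ≤ Real.pi - θ → ‖expansionRemainder L ζ‖ ≤ A + B * |ζ.re| := by
  obtain ⟨c, hc⟩ := h.isOfType.resolvent_bound _ h.lt_mid
  set K := resOne L - resOne L * resOne L with hK
  refine ⟨|c| + ‖resOne L‖ + Real.pi * ‖K‖, ‖K‖, by positivity, by positivity, fun ζ hζ => ?_⟩
  have hmem := h.neg_exp_mem (ζ := ζ) (by linarith [h.lt])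
  have h1 : ‖-Complex.exp ζ • res L (-Complex.exp ζ)‖ ≤ |c| := by
    have := hc _ (notMem_sector h.mid_le hmem)
    rw [norm_smul]
    rw [norm_neg] at this ⊢
    have hp : 0 < ‖Complex.exp ζ‖ := norm_pos_iff.2 (Complex.exp_ne_zero _)
    calc _ ≤ ‖Complex.exp ζ‖ * (c * ‖Complex.exp ζ‖⁻¹) := by gcongr
      _ = c := by field_simp
      _ ≤ |c| := le_abs_self c
  have h2 : ‖ζ • K‖ ≤ (|ζ.re| + Real.pi) * ‖K‖ := by
    rw [norm_smul]
    gcongr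
    exact (Complex.norm_le_abs_re_add_abs_im ζ).trans (by linarith [h.pos])
  rw [expansionRemainder, ← hK]
  calc _ ≤ ‖-Complex.exp ζ • res L (-Complex.exp ζ)‖ + ‖resOne L‖ + ‖ζ • K‖ :=
        (norm_sub_le _ _).trans (by gcongr; exact norm_sub_le _ _)
    _ ≤ |c| + ‖resOne L‖ + (|ζ.re| + Real.pi) * ‖K‖ := by gcongr
    _ = _ := by ring

/-- Cauchy's theorem outside the sector, after subtraction of the pole at `-1`. -/
theorem integral_expansionRemainder (h : IsContourAngle L ω θ) [CompleteSpace H] :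
    (∀ y : ℝ, |y| = Real.pi - θ → Integrable fun x : ℝ =>
      poleKernel (x + y * Complex.I) • expansionRemainder L (x + y * Complex.I)) ∧
    ∫ x : ℝ, poleKernel (x + (-(Real.pi - θ) : ℝ) * Complex.I) •
      expansionRemainder L (x + (-(Real.pi - θ) : ℝ) * Complex.I) =
    ∫ x : ℝ, poleKernel (x + (Real.pi - θ : ℝ) * Complex.I) •
      expansionRemainder L (x + (Real.pi - θ : ℝ) * Complex.I) := by
  have hβ : 0 < Real.pi - θ := by linarith [h.lt_pi_div_two, Real.pi_pos]
  set S : Set ℂ := {ζ | |ζ.im| < Real.pi - (ω + θ) / 2} with hS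
  have hSo : IsOpen S := isOpen_lt (by fun_prop) continuous_const
  have hS0 : S ∈ nhds (0 : ℂ) := hSo.mem_nhds (by
    have := h.lt; have := h.lt_pi_div_two; have := Real.pi_pos
    rw [hS, Set.mem_ofPred_eq]; simp; linarith)
  have hSπ : ∀ ζ ∈ S, |ζ.im| ≤ Real.pi := fun ζ (hζ : |ζ.im| < _) => by
    linarith [h.nonneg, h.pos]
  -- Removal of the singularity: `W₂` is the remainder divided by ζ², and `D` is (1 - e^ζ)/ζ, both
  -- extended holomorphically over 0. As `D` has no zeros in the strip, (e^ζ / D²) W₂ is holomorphic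
  -- there and equals the integrand away from 0.
  set W₁ := dslope (expansionRemainder L) 0 with hW₁
  set W₂ := dslope W₁ 0 with hW₂
  set D := dslope (fun ζ : ℂ => 1 - Complex.exp ζ) 0 with hD
  have hW₁d : DifferentiableOn ℂ W₁ S :=
    (Complex.differentiableOn_dslope hS0).2 h.differentiableOn_expansionRemainder
  have hW₂d : DifferentiableOn ℂ W₂ S := (Complex.differentiableOn_dslope hS0).2 hW₁d
  have hDd : DifferentiableOn ℂ D S := (Complex.differentiableOn_dslope hS0).2 (by fun_prop)
  have hD0 : D 0 = -1 := by
    rw [hD, dslope_same]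
    simp
  have hDne : ∀ ζ ∈ S, D ζ ≠ 0 := by
    intro ζ hζ
    rcases eq_or_ne ζ 0 with rfl | hne
    · rw [hD0]; norm_num
    · rw [hD, dslope_of_ne _ hne, slope_def_module]
      simpa using ⟨hne, one_sub_exp_ne_zero (hSπ ζ hζ) hne⟩
  have hW₁0 : W₁ 0 = 0 := by
    rw [hW₁, dslope_same]; exact h.hasDerivAt_expansionRemainder.deriv
  set F : ℂ → (H →L[ℂ] H) := fun ζ => (Complex.exp ζ / D ζ ^ 2) • W₂ ζ with hF
  have hFd : DifferentiableOn ℂ F S :=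
    (DifferentiableOn.div (by fun_prop) (hDd.pow 2) fun ζ hζ => pow_ne_zero 2 (hDne ζ hζ)).smul
      hW₂d
  have hFeq : ∀ ζ : ℂ, ζ ∈ S → ζ ≠ 0 → F ζ = poleKernel ζ • expansionRemainder L ζ := by
    intro ζ hζ hne
    have hne' := one_sub_exp_ne_zero (hSπ ζ hζ) hne
    have e1 : W₁ ζ = ζ⁻¹ • expansionRemainder L ζ := by
      rw [hW₁, dslope_of_ne _ hne, slope_def_module, expansionRemainder_zero]; simp
    have e2 : W₂ ζ = ζ⁻¹ • ζ⁻¹ • expansionRemainder L ζ := by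
      rw [hW₂, dslope_of_ne _ hne, slope_def_module, hW₁0, e1]; simp
    have e3 : D ζ = ζ⁻¹ * (1 - Complex.exp ζ) := by
      rw [hD, dslope_of_ne _ hne, slope_def_module]; simp
    simp only [hF]
    rw [e2, e3, smul_smul, smul_smul, poleKernel]
    congr 1
    field_simp
  obtain ⟨A, B, hA, hB, hAB⟩ := h.norm_expansionRemainder_le
  have hsub : {ζ : ℂ | ζ.im ∈ Set.Icc (-(Real.pi - θ)) (Real.pi - θ)} ⊆ S := by
    intro ζ hζ
    have : |ζ.im| ≤ Real.pi - θ := abs_le.2 hζ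
    rw [hS, Set.mem_ofPred_eq]
    linarith [h.lt]
  have hFb : ∀ ζ : ℂ, ζ.im ∈ Set.Icc (-(Real.pi - θ)) (Real.pi - θ) → 1 ≤ |ζ.re| →
      ‖F ζ‖ ≤ 4 * (A + 2 * B) * Real.exp (-(1 / 2) * |ζ.re|) := by
    intro ζ hζ h1
    rw [hFeq ζ (hsub hζ) (by rintro rfl; norm_num at h1), norm_smul]
    calc _ ≤ 4 * Real.exp (-|ζ.re|) * (A + B * |ζ.re|) := by
          gcongr
          · exact norm_poleKernel_le h1
          · exact hAB ζ (abs_le.2 hζ)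
      _ = 4 * ((A + B * |ζ.re|) * Real.exp (-|ζ.re|)) := by ring
      _ ≤ 4 * ((A + 2 * B) * Real.exp (-(1 / 2) * |ζ.re|)) := by
          gcongr 4 * ?_
          exact abs_mul_exp_le hA hB
      _ = _ := by ring
  have hline : ∀ y : ℝ, |y| = Real.pi - θ → ∀ x : ℝ, F (x + y * Complex.I) =
      poleKernel (x + y * Complex.I) • expansionRemainder L (x + y * Complex.I) := by
    intro y hy x
    refine hFeq _ (hsub ?_) ?_
    · simpa using abs_le.1 hy.le
    · intro h0
      have := congrArg Complex.im h0
      simp at this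
      rw [this, abs_zero] at hy
      exact hβ.ne hy
  have hFs := integral_line_eq_integral_line (by linarith) (by norm_num) (hFd.mono hsub) hFb
  obtain ⟨C', hC'⟩ := exists_bound_of_continuousOn_strip (hFd.mono hsub).continuousOn hFb
  constructor
  · intro y hy
    simp only [← hline y hy]
    refine integrable_line (κ := 1 / 2) (C := C') (by norm_num)
      ((hFd.mono hsub).continuousOn.comp_continuous (by fun_prop) fun x => ?_) fun x => ?_
    · simpa using abs_le.1 hy.le
    · have := hC' (x + y * Complex.I) (by simpa using abs_le.1 hy.le)
      simpa using this
  · simpa only [hline _ (show |Real.pi - θ| = _ from abs_of_pos hβ),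
      hline _ (show |-(Real.pi - θ)| = Real.pi - θ by rw [abs_neg, abs_of_pos hβ])] using hFs

/-- Putting z = -e^ζ turns the line of height -σθ into the line of height σ(π - θ), in a strip that
contains the pole ζ = 0 but not the spectrum. Expanding z (z - L)⁻¹ to first order at that pole
leaves the remainder integral and the two moments of `poleKernel`. In the difference of the cases σ
= 1 and σ = -1 only the first moment survives. -/
theorem integral_logKernel_eq (h : IsContourAngle L ω θ) [CompleteSpace H] {σ : ℝ}
    (hσ : |σ| = 1) :
    ∫ x : ℝ, logKernel L (fun u => u / (1 + u) ^ 2) (x + (-(σ * θ) : ℝ) * Complex.I) =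
      -(∫ x : ℝ, poleKernel (x + (σ * (Real.pi - θ) : ℝ) * Complex.I) •
        expansionRemainder L (x + (σ * (Real.pi - θ) : ℝ) * Complex.I)) + resOne L +
        (σ * Real.pi * Complex.I) • (resOne L - resOne L * resOne L) := by
  have hβ : 0 < Real.pi - θ := by linarith [h.lt_pi_div_two, Real.pi_pos]
  obtain ⟨i1, i2⟩ := integral_mul_poleKernel hσ hβ (by linarith [h.pos])
  have habs : |σ * (Real.pi - θ)| = Real.pi - θ := by rw [abs_mul, hσ, one_mul, abs_of_pos hβ]
  have hI := h.integral_expansionRemainder.1 _ habs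
  set K := resOne L - resOne L * resOne L with hK
  have hexp : ∀ x : ℝ, Complex.exp (x + (-(σ * θ) : ℝ) * Complex.I) =
      -Complex.exp (x + (σ * (Real.pi - θ) : ℝ) * Complex.I) := by
    intro x
    rcases eq_or_eq_neg_of_abs_eq hσ with rfl | rfl
    · rw [show (x + (1 * (Real.pi - θ) : ℝ) * Complex.I : ℂ) =
        (x + (-(1 * θ) : ℝ) * Complex.I) + Real.pi * Complex.I by push_cast; ring,
        Complex.exp_add_pi_mul_I, neg_neg]
    · rw [show (x + (-1 * (Real.pi - θ) : ℝ) * Complex.I : ℂ) =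
        (x + (-(-1 * θ) : ℝ) * Complex.I) - Real.pi * Complex.I by push_cast; ring,
        Complex.exp_sub_pi_mul_I, neg_neg]
  have hker : ∀ x : ℝ,
      logKernel L (fun u => u / (1 + u) ^ 2) (x + (-(σ * θ) : ℝ) * Complex.I) =
      -(poleKernel (x + (σ * (Real.pi - θ) : ℝ) * Complex.I) •
        expansionRemainder L (x + (σ * (Real.pi - θ) : ℝ) * Complex.I)) -
        poleKernel (x + (σ * (Real.pi - θ) : ℝ) * Complex.I) • resOne L -
        ((x + (σ * (Real.pi - θ) : ℝ) * Complex.I) *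
          poleKernel (x + (σ * (Real.pi - θ) : ℝ) * Complex.I)) • K := by
    intro x
    rw [logKernel, hexp]
    set ζ : ℂ := x + (σ * (Real.pi - θ) : ℝ) * Complex.I
    have h1 : poleKernel ζ • expansionRemainder L ζ = (poleKernel ζ * -Complex.exp ζ) •
        res L (-Complex.exp ζ) - poleKernel ζ • resOne L - (ζ * poleKernel ζ) • K := by
      rw [expansionRemainder, ← hK, smul_sub, smul_sub, smul_smul, smul_smul, mul_comm ζ]
    have h2 : -Complex.exp ζ / (1 + -Complex.exp ζ) ^ 2 * -Complex.exp ζ =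
        -(poleKernel ζ * -Complex.exp ζ) := by
      rw [poleKernel, ← sub_eq_add_neg]; ring
    rw [h1, h2, neg_smul]
    abel
  -- The integral of a non-integrable function is 0 by convention, so the nonzero values found above
  -- force integrability.
  have e1 : Integrable fun x : ℝ => poleKernel (x + (σ * (Real.pi - θ) : ℝ) * Complex.I) := by
    by_contra hn
    rw [integral_undef hn] at i1
    norm_num at i1
  have e2 : Integrable fun x : ℝ => (x + (σ * (Real.pi - θ) : ℝ) * Complex.I) *
      poleKernel (x + (σ * (Real.pi - θ) : ℝ) * Complex.I) := by
    by_contra hn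
    rw [integral_undef hn] at i2
    have h3 : (σ : ℂ) ≠ 0 := by rintro h3; simp [Complex.ofReal_eq_zero.1 h3] at hσ
    have h4 : (Real.pi : ℂ) ≠ 0 := by exact_mod_cast Real.pi_ne_zero
    have := neg_ne_zero.2 (mul_ne_zero (mul_ne_zero h3 h4) Complex.I_ne_zero)
    exact this i2.symm
  simp only [hker]
  have hI' : Integrable fun x : ℝ => -(poleKernel (x + (σ * (Real.pi - θ) : ℝ) * Complex.I) •
        expansionRemainder L (x + (σ * (Real.pi - θ) : ℝ) * Complex.I)) := hI.neg
  rw [integral_sub (f := fun x : ℝ => _ - _) (hI'.sub (e1.smul_const _)) (e2.smul_const _),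
    integral_sub hI' (e1.smul_const _), integral_neg, integral_smul_const, integral_smul_const,
    i1, i2, neg_one_smul, neg_smul, sub_neg_eq_add, sub_neg_eq_add]

theorem psiCalc_div_sq (h : IsContourAngle L ω θ) [CompleteSpace H] :
    psiCalc L θ (fun u => u / (1 + u) ^ 2) = resOne L - resOne L * resOne L := by
  have h1 := h.integral_logKernel_eq (σ := 1) (by simp)
  have h2 := h.integral_logKernel_eq (σ := -1) (by simp)
  simp only [one_mul, neg_one_mul, neg_neg] at h1 h2
  rw [psiCalc_eq, h1, h2, h.integral_expansionRemainder.2]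
  have hne : (2 * Real.pi * Complex.I : ℂ) ≠ 0 := by simp [Real.pi_ne_zero]
  rw [inv_smul_eq_iff₀ hne]
  push_cast
  module

end IsContourAngle

end BaseIdentity

/-! ### Euler's formula and products with the semigroup -/

section SemigroupCalculus

variable {H : Type*} [NormedAddCommGroup H] [NormedSpace ℂ H] {L : H →ₗ.[ℂ] H} {ω θ : ℝ}

/-- The operator `(l + L)⁻¹` for `l > 0`. -/
def resAt (L : H →ₗ.[ℂ] H) (l : ℝ) : H →L[ℂ] H := -res L (-l)

theorem resAt_one (L : H →ₗ.[ℂ] H) : resAt L 1 = resOne L := by simp [resAt, resOne]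

theorem norm_inv_add_le {l : ℝ} (hl : 0 < l) {z : ℂ} (hz : 0 < z.re) : ‖(l + z)⁻¹‖ ≤ l⁻¹ := by
  rw [norm_inv]
  gcongr
  refine le_trans ?_ (Complex.re_le_norm _)
  simpa using hz.le

theorem norm_inv_add_le' {l : ℝ} (hl : 0 < l) {z : ℂ} (hz : 0 < z.re) :
    ‖(l + z)⁻¹‖ ≤ ‖z‖⁻¹ := by
  have h1 := norm_div_add_le_one hl.le hz
  have h2 : 0 < ‖z‖ := norm_pos_iff.2 (by rintro rfl; simp at hz)
  rw [div_eq_mul_inv, norm_mul] at h1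
  rw [← one_div ‖z‖, le_div_iff₀ h2]
  linarith

theorem one_add_ne_zero {z : ℂ} (hz : 0 < z.re) : 1 + z ≠ 0 := by
  simpa using add_ne_zero_of_re_pos zero_le_one hz

theorem SectorDecay.of_norm_bounds {ψ : ℂ → ℂ} (h0 : 0 ≤ θ) (hθ : θ < Real.pi / 2)
    (hd : DifferentiableOn ℂ ψ {z | 0 < z.re}) {A B : ℝ}
    (hA : ∀ z : ℂ, 0 < z.re → ‖ψ z‖ ≤ A * ‖z‖)
    (hB : ∀ z : ℂ, 0 < z.re → Real.cos θ * ‖z‖ ≤ z.re → ‖ψ z‖ ≤ B * ‖z‖⁻¹) :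
    SectorDecay θ ψ ∧ ∀ ζ : ℂ, |ζ.im| ≤ θ →
      ‖ψ (Complex.exp ζ)‖ ≤ max A B * Real.exp (-1 * |ζ.re|) := by
  refine SectorDecay.of_bounds hd (fun ζ hζ => ?_) fun ζ hζ => ?_
  · have := hA _ (exp_re_pos (hζ.trans_lt hθ))
    rwa [Complex.norm_exp] at this
  · have := hB _ (exp_re_pos (hζ.trans_lt hθ)) (by
      rw [Complex.norm_exp, Complex.exp_re, mul_comm, ← Real.cos_abs ζ.im]
      gcongr
      exact Real.cos_le_cos_of_nonneg_of_le_pi (abs_nonneg _) (by linarith [Real.pi_pos]) hζ)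
    rwa [Complex.norm_exp, ← Real.exp_neg] at this

theorem sectorDecay_div_mul (h0 : 0 ≤ θ) (hθ : θ < Real.pi / 2) {l : ℝ} (hl : 0 < l) :
    SectorDecay θ (fun u => u * ((1 + u)⁻¹ * (l + u)⁻¹)) := by
  have hone : ∀ z : ℂ, 0 < z.re → ‖(1 + z)⁻¹‖ ≤ 1 := fun z hz => by
    simpa using norm_inv_add_le one_pos hz
  have hone' : ∀ z : ℂ, 0 < z.re → ‖(1 + z)⁻¹‖ ≤ ‖z‖⁻¹ := fun z hz => by
    simpa using norm_inv_add_le' one_pos hz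
  refine (SectorDecay.of_norm_bounds (A := l⁻¹) (B := 1) h0 hθ ?_ (fun z hz => ?_)
    fun z hz _ => ?_).1
  · exact differentiableOn_id.mul ((DifferentiableOn.inv (by fun_prop)
      fun z hz => one_add_ne_zero hz).mul (DifferentiableOn.inv (by fun_prop)
      fun z hz => add_ne_zero_of_re_pos hl.le hz))
  · rw [norm_mul, norm_mul, mul_comm]
    gcongr
    calc _ ≤ 1 * l⁻¹ := by
          gcongr
          · exact hone z hz
          · exact norm_inv_add_le hl hz
      _ = _ := one_mul _
  · have h2 : 0 < ‖z‖ := norm_pos_iff.2 (by rintro rfl; simp at hz)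
    rw [norm_mul, norm_mul]
    calc _ ≤ ‖z‖ * (‖z‖⁻¹ * ‖z‖⁻¹) := by
          gcongr
          · exact hone' z hz
          · exact norm_inv_add_le' hl hz
      _ = _ := by field_simp

/-- The symbol of `(1 + L / l)^{-k} - (1 + L)⁻¹`. -/
def eulerSymbol (l : ℝ) (k : ℕ) (u : ℂ) : ℂ := (l / (l + u)) ^ k - (1 + u)⁻¹

theorem norm_euler_le_one {l : ℝ} (hl : 0 < l) {z : ℂ} (hz : 0 < z.re) : ‖l / (l + z)‖ ≤ 1 := by
  rw [div_eq_mul_inv, norm_mul, Complex.norm_real, Real.norm_of_nonneg hl.le]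
  calc l * ‖(l + z)⁻¹‖ ≤ l * l⁻¹ := by gcongr; exact norm_inv_add_le hl hz
    _ = 1 := mul_inv_cancel₀ hl.ne'

theorem norm_pow_sub_one_le {r : ℂ} (hr : ‖r‖ ≤ 1) (k : ℕ) : ‖r ^ k - 1‖ ≤ k * ‖r - 1‖ := by
  induction k with
  | zero => simp
  | succ k ih =>
    rw [show r ^ (k + 1) - 1 = r * (r ^ k - 1) + (r - 1) by ring]
    refine (norm_add_le _ _).trans ?_
    rw [norm_mul]
    push_cast
    have := mul_le_of_le_one_left (norm_nonneg (r ^ k - 1)) hr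
    linarith

/-- Near 0 use |r^k - 1| ≤ k |r - 1|; at infinity, Bernoulli's inequality for |(l + z)/l|^k. The
constants depend only on the ratio k / l, so for l = k / t they are the same for all k, as dominated
convergence requires. -/
theorem sectorDecay_eulerSymbol (h0 : 0 ≤ θ) (hθ : θ < Real.pi / 2) {l : ℝ} (hl : 0 < l) {k : ℕ}
    (hk : 0 < k) : SectorDecay θ (eulerSymbol l k) ∧ ∀ ζ : ℂ, |ζ.im| ≤ θ →
      ‖eulerSymbol l k (Complex.exp ζ)‖ ≤
        max (k / l + 1) (l / (k * Real.cos θ) + 1) * Real.exp (-1 * |ζ.re|) := by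
  have hone' : ∀ z : ℂ, 0 < z.re → ‖(1 + z)⁻¹‖ ≤ ‖z‖⁻¹ := fun z hz => by
    simpa using norm_inv_add_le' one_pos hz
  have hk' : (0 : ℝ) < k := by exact_mod_cast hk
  refine SectorDecay.of_norm_bounds h0 hθ ?_ (fun z hz => ?_) fun z hz hcos => ?_
  · refine DifferentiableOn.sub (DifferentiableOn.pow (DifferentiableOn.div (by fun_prop)
      (by fun_prop) fun z hz => add_ne_zero_of_re_pos hl.le hz) k) ?_
    exact DifferentiableOn.inv (by fun_prop) fun z hz => one_add_ne_zero hz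
  · have hne := add_ne_zero_of_re_pos hl.le hz
    have hne1 := one_add_ne_zero hz
    rw [eulerSymbol, show (l / (l + z)) ^ k - (1 + z)⁻¹ =
      ((l / (l + z)) ^ k - 1) + z * (1 + z)⁻¹ by field_simp; ring]
    refine (norm_add_le _ _).trans ?_
    rw [add_mul]
    gcongr
    · refine (norm_pow_sub_one_le (norm_euler_le_one hl hz) k).trans ?_
      rw [show (l : ℂ) / (l + z) - 1 = -(z * (l + z)⁻¹) by field_simp; ring, norm_neg, norm_mul]
      calc k * (‖z‖ * ‖(l + z)⁻¹‖) ≤ k * (‖z‖ * l⁻¹) := by gcongr; exact norm_inv_add_le hl hz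
        _ = _ := by ring
    · rw [norm_mul, mul_comm]
      gcongr
      simpa using norm_inv_add_le one_pos hz
  · rw [eulerSymbol, add_mul]
    refine (norm_sub_le _ _).trans ?_
    rw [one_mul]
    gcongr
    · have hzpos : 0 < ‖z‖ := norm_pos_iff.2 (by rintro rfl; simp at hz)
      have hcpos : 0 < Real.cos θ := Real.cos_pos_of_mem_Ioo ⟨by linarith [Real.pi_pos], hθ⟩
      have h1 : 1 + z.re / l ≤ ‖(l + z) / l‖ := by
        refine le_trans ?_ (Complex.re_le_norm _)
        rw [Complex.div_ofReal_re, Complex.add_re, Complex.ofReal_re, add_div, div_self hl.ne']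
      have h2 : 1 + k * (z.re / l) ≤ ‖(l + z) / l‖ ^ k :=
        (one_add_mul_le_pow (by have : 0 ≤ z.re / l := by positivity
                                linarith) k).trans (by gcongr)
      have h3 : k * Real.cos θ * ‖z‖ / l ≤ ‖(l + z) / l‖ ^ k := by
        refine le_trans ?_ h2
        have : k * Real.cos θ * ‖z‖ / l ≤ k * (z.re / l) := by
          rw [mul_assoc, mul_div_assoc]
          gcongr
        linarith
      rw [← inv_div, inv_pow, norm_inv, norm_pow]
      calc _ ≤ (k * Real.cos θ * ‖z‖ / l)⁻¹ := by gcongr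
        _ = _ := by field_simp
    · exact hone' z hz

namespace IsContourAngle

theorem resAt_sub (h : IsContourAngle L ω θ) {l l' : ℝ} (hl : 0 < l) (hl' : 0 < l') :
    resAt L l - resAt L l' = ((l' : ℂ) - l) • (resAt L l * resAt L l') := by
  have := res_sub_res (h.neg_notMem hl) (h.neg_notMem hl')
  simp only [resAt, neg_mul_neg]
  rw [neg_sub_neg, ← neg_sub, this, ← neg_smul]
  congr 1
  ring

theorem resAt_comm (h : IsContourAngle L ω θ) {l l' : ℝ} (hl : 0 < l) (hl' : 0 < l') :
    resAt L l * resAt L l' = resAt L l' * resAt L l := by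
  simp only [resAt, neg_mul_neg]
  exact res_mul_comm (h.neg_notMem hl) (h.neg_notMem hl')

theorem resOne_injective (h : IsContourAngle L ω θ) : Function.Injective (resOne L) := by
  rw [injective_iff_map_eq_zero]
  intro f hf
  refine res_apply_eq_zero (h.neg_notMem one_pos) (f := f) ?_
  rw [← resAt_one] at hf
  simpa [resAt] using hf

theorem resOne_mul_left_cancel (h : IsContourAngle L ω θ) {A B : H →L[ℂ] H}
    (hAB : resOne L * A = resOne L * B) : A = B := by
  ext f
  exact h.resOne_injective (congrArg (fun T : H →L[ℂ] H => T f) hAB)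

theorem tendsto_euler_symbol {t : ℝ} (ht : 0 < t) (u : ℂ) :
    Filter.Tendsto (fun k : ℕ => (((k / t : ℝ) : ℂ) / ((k / t : ℝ) + u)) ^ k) Filter.atTop
      (nhds (Complex.exp (-t * u))) := by
  have h1 := (Complex.tendsto_one_add_div_pow_exp (t * u)).inv₀ (Complex.exp_ne_zero _)
  rw [← Complex.exp_neg, ← neg_mul] at h1
  refine h1.congr' ?_
  filter_upwards [Filter.eventually_gt_atTop 0] with k hk
  have hk' : (k : ℂ) ≠ 0 := by exact_mod_cast hk.ne'
  have ht' : (t : ℂ) ≠ 0 := by exact_mod_cast ht.ne'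
  rw [← inv_pow]
  congr 1
  push_cast
  rw [show (k / t + u : ℂ) = k / t * (1 + t * u / k) by field_simp,
    div_mul_cancel_left₀ (div_ne_zero hk' ht')]

theorem semigroup_eq (L : H →ₗ.[ℂ] H) (ω : ℝ) {t : ℝ} (ht : 0 < t) : semigroup L ω t =
    resOne L + psiCalc L ((ω + Real.pi / 2) / 2)
      (fun u => Complex.exp (-t * u) - (1 + u)⁻¹) := by
  rw [semigroup, Complex.arg_ofReal_of_nonneg ht.le]
  simp

/-- The bounds for the Euler symbols with l = k / t do not depend on k and survive the pointwise
limit. -/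
theorem sectorDecay_semigroup (h : IsContourAngle L ω θ) {t : ℝ} (ht : 0 < t) :
    SectorDecay θ (fun u => Complex.exp (-t * u) - (1 + u)⁻¹) := by
  refine ⟨DifferentiableOn.sub (by fun_prop) (DifferentiableOn.inv (by fun_prop)
    fun z hz => one_add_ne_zero hz), max (t + 1) (1 / (t * Real.cos θ) + 1), 1, one_pos, ?_⟩
  intro ζ hζ
  refine le_of_tendsto ((tendsto_euler_symbol ht _).sub_const _).norm ?_
  filter_upwards [Filter.eventually_gt_atTop 0] with k hk
  have hk' : (0 : ℝ) < k := by exact_mod_cast hk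
  have := (sectorDecay_eulerSymbol (l := k / t) h.pos.le h.lt_pi_div_two (by positivity) hk).2
  have e1 : k / (k / t) = t := by field_simp
  have e2 : (k / t) / (k * Real.cos θ) = 1 / (t * Real.cos θ) := by field_simp
  rw [e1, e2] at this
  exact this ζ hζ

variable [CompleteSpace H]

theorem resAt_mul_psiCalc (h : IsContourAngle L ω θ) {ψ : ℂ → ℂ} (hψ : SectorDecay θ ψ)
    {l : ℝ} (hl : 0 < l) :
    resAt L l * psiCalc L θ ψ = psiCalc L θ (fun u => (l + u)⁻¹ * ψ u) :=
  h.neg_res_mul_psiCalc hψ hl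

theorem resOne_mul_psiCalc (h : IsContourAngle L ω θ) {ψ : ℂ → ℂ} (hψ : SectorDecay θ ψ) :
    resOne L * psiCalc L θ ψ = psiCalc L θ (fun u => (1 + u)⁻¹ * ψ u) := by
  rw [← resAt_one, h.resAt_mul_psiCalc hψ one_pos]
  simp

theorem psiCalc_mul_resOne (h : IsContourAngle L ω θ) {ψ : ℂ → ℂ} (hψ : SectorDecay θ ψ) :
    psiCalc L θ ψ * resOne L = resOne L * psiCalc L θ ψ := by
  rw [← resAt_one, resAt, mul_neg, neg_mul, h.psiCalc_comm_res hψ one_pos]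

/-- After multiplication by the injective operator (1 + L)⁻¹, the symbol becomes (l + u)⁻¹ times u /
(1 + u)², to which the base identity and the product rule apply. -/
theorem psiCalc_div_mul (h : IsContourAngle L ω θ) {l : ℝ} (hl : 0 < l) :
    psiCalc L θ (fun u => u * ((1 + u)⁻¹ * (l + u)⁻¹)) =
      resOne L - (l : ℂ) • (resAt L l * resOne L) := by
  refine h.resOne_mul_left_cancel ?_
  rw [h.resOne_mul_psiCalc (sectorDecay_div_mul h.pos.le h.lt_pi_div_two hl)]
  have h1 := h.resAt_mul_psiCalc (sectorDecay_div_mul h.pos.le h.lt_pi_div_two one_pos) hl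
  have h2 : psiCalc L θ (fun u => u * ((1 + u)⁻¹ * (((1 : ℝ) : ℂ) + u)⁻¹)) =
      resOne L - resOne L * resOne L := by
    rw [← h.psiCalc_div_sq]
    refine h.psiCalc_congr fun u hu => ?_
    have := one_add_ne_zero hu
    push_cast
    field_simp
  have h3 : psiCalc L θ (fun u => (1 + u)⁻¹ * (u * ((1 + u)⁻¹ * (l + u)⁻¹))) =
      resAt L l * (resOne L - resOne L * resOne L) := by
    rw [← h2, h1]
    refine h.psiCalc_congr fun u _ => ?_
    push_cast
    ring
  have h4 := h.resAt_sub hl one_pos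
  have h5 := h.resAt_comm hl one_pos
  rw [resAt_one] at h4 h5
  rw [h3]
  have h6 : resAt L l = resOne L + ((1 : ℝ) - l : ℂ) • (resAt L l * resOne L) := by
    rw [← h4]; abel
  have h7 : resAt L l * resOne L = resOne L * resOne L +
      ((1 : ℝ) - l : ℂ) • (resAt L l * resOne L * resOne L) := by
    nth_rw 1 [h6]
    rw [add_mul, smul_mul_assoc]
  rw [mul_sub, mul_sub, mul_smul_comm, ← mul_assoc, ← mul_assoc, ← h5]
  nth_rw 1 [h7]
  push_cast
  module

/-- The power of l / (l + u) tends to 1 at 0, so only its difference with (1 + u)⁻¹ is an admissible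
symbol. In the induction, multiplying that correction by l / (l + u) produces the extra symbol u /
((1 + u)(l + u)), known from `psiCalc_div_mul`. -/
theorem euler_eq (h : IsContourAngle L ω θ) {l : ℝ} (hl : 0 < l) (k : ℕ) :
    ((l : ℂ) • resAt L l) ^ (k + 1) = resOne L + psiCalc L θ (eulerSymbol l (k + 1)) := by
  induction k with
  | zero =>
    have h4 := h.resAt_sub hl one_pos
    rw [resAt_one] at h4
    have h5 : psiCalc L θ (eulerSymbol l (0 + 1)) =
        ((l : ℂ) - 1) • (resOne L - (l : ℂ) • (resAt L l * resOne L)) := by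
      rw [← h.psiCalc_div_mul hl, ← psiCalc_const_mul]
      refine h.psiCalc_congr fun u hu => ?_
      have := one_add_ne_zero hu
      have := add_ne_zero_of_re_pos hl.le hu
      rw [eulerSymbol, zero_add, pow_one]
      field_simp
      ring
    have h6 : resAt L l = resOne L + ((1 : ℝ) - l : ℂ) • (resAt L l * resOne L) := by
      rw [← h4]; abel
    rw [h5, zero_add, pow_one]
    nth_rw 1 [h6]
    push_cast
    module
  | succ k ih =>
    obtain ⟨hd, -⟩ := sectorDecay_eulerSymbol h.pos.le h.lt_pi_div_two hl k.succ_pos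
    have hdm := sectorDecay_div_mul h.pos.le h.lt_pi_div_two hl
    rw [pow_succ', ih, mul_add, smul_mul_assoc, smul_mul_assoc, h.resAt_mul_psiCalc hd hl,
      ← psiCalc_const_mul]
    have h1 : psiCalc L θ (fun u => (l : ℂ) * ((l + u)⁻¹ * eulerSymbol l (k + 1) u)) =
        psiCalc L θ (fun u => eulerSymbol l (k + 1 + 1) u + u * ((1 + u)⁻¹ * (l + u)⁻¹)) := by
      refine h.psiCalc_congr fun u hu => ?_
      have := one_add_ne_zero hu
      have := add_ne_zero_of_re_pos hl.le hu
      rw [eulerSymbol, eulerSymbol, pow_succ' _ (k + 1)]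
      field_simp
      ring
    rw [h1, h.psiCalc_add (sectorDecay_eulerSymbol h.pos.le h.lt_pi_div_two hl
      (Nat.succ_pos _)).1 hdm, h.psiCalc_div_mul hl]
    abel

theorem euler_mul_psiCalc (h : IsContourAngle L ω θ) {l : ℝ} (hl : 0 < l) (k : ℕ) {ψ : ℂ → ℂ}
    (hψ : SectorDecay θ ψ) : SectorDecay θ (fun u => (l / (l + u)) ^ k * ψ u) ∧
    ((l : ℂ) • resAt L l) ^ k * psiCalc L θ ψ = psiCalc L θ (fun u => (l / (l + u)) ^ k * ψ u) := by
  induction k with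
  | zero => simpa using hψ
  | succ k ih =>
    have h1 : ∀ u : ℂ, (l / (l + u)) ^ (k + 1) * ψ u =
        l * ((l + u)⁻¹ * ((l / (l + u)) ^ k * ψ u)) := fun u => by ring
    simp only [h1]
    refine ⟨(ih.1.div_add h.lt_pi_div_two hl).const_mul _, ?_⟩
    rw [pow_succ', mul_assoc, ih.2, smul_mul_assoc, h.resAt_mul_psiCalc ih.1 hl,
      psiCalc_const_mul]

/-- Euler's formula for the semigroup. -/
theorem tendsto_euler (h : IsContourAngle L ω ((ω + Real.pi / 2) / 2)) {t : ℝ} (ht : 0 < t) :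
    Filter.Tendsto (fun k : ℕ => (((k / t : ℝ) : ℂ) • resAt L (k / t)) ^ k) Filter.atTop
      (nhds (semigroup L ω t)) := by
  rw [semigroup_eq L ω ht]
  set θ := (ω + Real.pi / 2) / 2
  have h1 : Filter.Tendsto (fun k : ℕ => psiCalc L θ (eulerSymbol (k / t) k)) Filter.atTop
      (nhds (psiCalc L θ (fun u => Complex.exp (-t * u) - (1 + u)⁻¹))) := by
    refine h.tendsto_psiCalc (κ := 1) (C := max (t + 1) (1 / (t * Real.cos θ) + 1)) one_pos
      ?_ ?_ fun z _ => (tendsto_euler_symbol ht z).sub_const _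
    · filter_upwards [Filter.eventually_gt_atTop 0] with k hk
      have hk' : (0 : ℝ) < k := by exact_mod_cast hk
      exact (sectorDecay_eulerSymbol h.pos.le h.lt_pi_div_two (by positivity) hk).1.1
    · filter_upwards [Filter.eventually_gt_atTop 0] with k hk
      have hk' : (0 : ℝ) < k := by exact_mod_cast hk
      have := (sectorDecay_eulerSymbol (l := k / t) h.pos.le h.lt_pi_div_two (by positivity) hk).2
      have e1 : k / (k / t) = t := by field_simp
      have e2 : (k / t) / (k * Real.cos θ) = 1 / (t * Real.cos θ) := by field_simp
      rwa [e1, e2] at this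
  refine (h1.const_add (resOne L)).congr' ?_
  filter_upwards [Filter.eventually_gt_atTop 0] with k hk
  have hk' : (0 : ℝ) < k := by exact_mod_cast hk
  obtain ⟨j, rfl⟩ := Nat.exists_eq_succ_of_ne_zero hk.ne'
  exact (h.euler_eq (by positivity) j).symm

/-- The product rule is known for resolvents, hence for the Euler approximants; both sides pass to
the limit. A product rule for two general symbols is not needed. -/
theorem semigroup_mul_psiCalc (h : IsContourAngle L ω ((ω + Real.pi / 2) / 2)) {t : ℝ}
    (ht : 0 < t) {ψ : ℂ → ℂ} (hψ : SectorDecay ((ω + Real.pi / 2) / 2) ψ) :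
    semigroup L ω t * psiCalc L ((ω + Real.pi / 2) / 2) ψ =
      psiCalc L ((ω + Real.pi / 2) / 2) (fun u => Complex.exp (-t * u) * ψ u) := by
  set θ := (ω + Real.pi / 2) / 2
  obtain ⟨C, κ, hκ, hC⟩ := hψ.bound
  have h1 : Filter.Tendsto (fun k : ℕ => psiCalc L θ
      (fun u => (((k / t : ℝ) : ℂ) / ((k / t : ℝ) + u)) ^ k * ψ u)) Filter.atTop
      (nhds (psiCalc L θ (fun u => Complex.exp (-t * u) * ψ u))) := by
    refine h.tendsto_psiCalc hκ (C := C) ?_ ?_ fun z _ => (tendsto_euler_symbol ht z).mul_const _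
    · filter_upwards [Filter.eventually_gt_atTop 0] with k hk
      have hk' : (0 : ℝ) < k := by exact_mod_cast hk
      exact (h.euler_mul_psiCalc (l := k / t) (by positivity) k hψ).1.1
    · filter_upwards [Filter.eventually_gt_atTop 0] with k hk ζ hζ
      have hk' : (0 : ℝ) < k := by exact_mod_cast hk
      rw [norm_mul, norm_pow]
      refine (mul_le_of_le_one_left (norm_nonneg _) (pow_le_one₀ (norm_nonneg _) ?_)).trans
        (hC ζ hζ)
      exact norm_euler_le_one (by positivity) (exp_re_pos (hζ.trans_lt h.lt_pi_div_two))
  refine tendsto_nhds_unique (((h.tendsto_euler ht).mul_const _).congr' ?_) h1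
  filter_upwards [Filter.eventually_gt_atTop 0] with k hk
  have hk' : (0 : ℝ) < k := by exact_mod_cast hk
  exact (h.euler_mul_psiCalc (by positivity) k hψ).2

theorem semigroup_mul_resOne (h : IsContourAngle L ω ((ω + Real.pi / 2) / 2)) {t : ℝ}
    (ht : 0 < t) : semigroup L ω t * resOne L = resOne L * semigroup L ω t := by
  rw [semigroup_eq L ω ht, add_mul, mul_add, h.psiCalc_mul_resOne (h.sectorDecay_semigroup ht)]

end IsContourAngle

end SemigroupCalculus

/-! ### The kernel with Laplace transform u^{-a} (1 - e^{-u})^n -/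

section DifferenceKernel

theorem integral_Ioi_eq_integral_exp {E : Type*} [NormedAddCommGroup E] [NormedSpace ℝ E]
    (g : ℝ → E) : ∫ t in Set.Ioi (0 : ℝ), g t = ∫ x : ℝ, Real.exp x • g (Real.exp x) := by
  have h := integral_image_eq_integral_abs_deriv_smul (s := Set.univ)
    (f := Real.exp) (f' := Real.exp) MeasurableSet.univ
    (fun x _ => (Real.hasDerivAt_exp x).hasDerivWithinAt) Real.exp_injective.injOn g
  rw [Set.image_univ, Real.range_exp, setIntegral_univ] at h
  simpa only [abs_of_pos (Real.exp_pos _)] using h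

/-- This is e^{-y} ≤ min(1, N! / y^N) with y = c e^{Re ζ}. For N > a it yields exponential decay at
both ends of the strip. -/
theorem norm_exp_sub_exp_le {a c : ℝ} (hc : 0 < c) (ζ : ℂ) (hζ : c ≤ Real.cos ζ.im) {N : ℕ} :
    ‖Complex.exp (a * ζ - Complex.exp ζ)‖ ≤
      (1 + N.factorial / c ^ N) * min (Real.exp (a * ζ.re)) (Real.exp ((a - N) * ζ.re)) := by
  have hp := Real.exp_pos ζ.re
  have h0 : ‖Complex.exp (a * ζ - Complex.exp ζ)‖ ≤
      Real.exp (a * ζ.re) * Real.exp (-(c * Real.exp ζ.re)) := by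
    rw [Complex.norm_exp, ← Real.exp_add, Complex.sub_re, Complex.re_ofReal_mul, Complex.exp_re,
      sub_eq_add_neg]
    refine Real.exp_le_exp.2 ?_
    have := mul_le_mul_of_nonneg_left hζ hp.le
    linarith
  refine h0.trans ?_
  have h1 : Real.exp (-(c * Real.exp ζ.re)) ≤ 1 := Real.exp_le_one_iff.2 (by
    have := mul_pos hc hp
    linarith)
  have h2 : Real.exp (-(c * Real.exp ζ.re)) ≤ N.factorial / c ^ N * Real.exp (-(N * ζ.re)) := by
    have := Real.pow_div_factorial_le_exp (x := c * Real.exp ζ.re) (by positivity) N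
    rw [Real.exp_neg, Real.exp_neg, Real.exp_nat_mul]
    refine (inv_anti₀ (by positivity) this).trans (le_of_eq ?_)
    rw [mul_pow]
    field_simp
  have h3 : (0 : ℝ) ≤ N.factorial / c ^ N := by positivity
  rw [mul_min_of_nonneg _ _ (by positivity)]
  refine le_min ?_ ?_
  · rw [mul_comm]
    gcongr
    linarith
  · calc _ ≤ Real.exp (a * ζ.re) * (N.factorial / c ^ N * Real.exp (-(N * ζ.re))) := by gcongr
      _ = N.factorial / c ^ N * Real.exp ((a - N) * ζ.re) := by
        rw [mul_left_comm, ← Real.exp_add]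
        ring_nf
      _ ≤ _ := by
        gcongr
        linarith

theorem min_exp_le {a b κ x : ℝ} (ha : κ ≤ a) (hb : b ≤ -κ) :
    min (Real.exp (a * x)) (Real.exp (b * x)) ≤ Real.exp (-κ * |x|) := by
  rcases le_total 0 x with h | h
  · refine (min_le_right _ _).trans (Real.exp_le_exp.2 ?_)
    rw [abs_of_nonneg h]
    nlinarith
  · refine (min_le_left _ _).trans (Real.exp_le_exp.2 ?_)
    rw [abs_of_nonpos h]
    nlinarith

/-- Euler's integral for `Γ(a) u^{-a}` in the right half plane. -/
theorem integral_rpow_mul_exp_neg {a : ℝ} (ha : 0 < a) {u : ℂ} (hu : 0 < u.re) :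
    ∫ t in Set.Ioi (0 : ℝ), ((t ^ (a - 1) : ℝ) : ℂ) * Complex.exp (-t * u) =
      Real.Gamma a * (u ^ (a : ℂ))⁻¹ := by
  have hu0 : u ≠ 0 := by rintro rfl; simp at hu
  set G : ℂ → ℂ := fun ζ => Complex.exp (a * ζ - Complex.exp ζ) with hG
  set φ := u.arg with hφ
  have hφ2 : |φ| < Real.pi / 2 := Complex.abs_arg_lt_pi_div_two_iff.2 (Or.inl hu)
  have hc : 0 < Real.cos φ := Real.cos_pos_of_mem_Ioo (abs_lt.1 hφ2)
  obtain ⟨N, hN⟩ := exists_nat_gt a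
  have hκ : 0 < min a (N - a) := lt_min ha (by linarith)
  have hb : ∀ ζ : ℂ, |ζ.im| ≤ |φ| →
      ‖G ζ‖ ≤ (1 + N.factorial / Real.cos φ ^ N) * Real.exp (-(min a (N - a)) * |ζ.re|) := by
    intro ζ hζ
    refine (norm_exp_sub_exp_le (N := N) hc ζ ?_).trans ?_
    · rw [← Real.cos_abs, ← Real.cos_abs ζ.im]
      exact Real.cos_le_cos_of_nonneg_of_le_pi (abs_nonneg _) (by linarith [Real.pi_pos]) hζ
    · gcongr
      refine min_exp_le (min_le_left _ _) ?_
      have := min_le_right a (N - a)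
      linarith
  have hd : Differentiable ℂ G := by fun_prop
  -- With t = e^x the integrand becomes G(x + log u) divided by u^a. Moving the line from height arg
  -- u to height 0 is the rotation of the ray of integration; the translation by log |u| is
  -- harmless.
  have hshift : ∫ x : ℝ, G (x + φ * Complex.I) = ∫ x : ℝ, G x := by
    have h0 : ∫ x : ℝ, G (x + (0 : ℝ) * Complex.I) = ∫ x : ℝ, G x := by simp
    rw [← h0]
    rcases le_total 0 φ with h | h
    · exact (integral_line_eq_integral_line h hκ hd.differentiableOn fun ζ hζ _ => hb ζ (by
        rw [abs_of_nonneg hζ.1, abs_of_nonneg h]; exact hζ.2)).symm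
    · exact integral_line_eq_integral_line h hκ hd.differentiableOn fun ζ hζ _ => hb ζ (by
        rw [abs_of_nonpos hζ.2, abs_of_nonpos h]; exact neg_le_neg hζ.1)
  have hGamma : ∫ x : ℝ, G x = Real.Gamma a := by
    rw [Real.Gamma_eq_integral ha, ← integral_complex_ofReal, integral_Ioi_eq_integral_exp]
    congr 1
    ext1 x
    simp only [hG]
    rw [Complex.real_smul, ← Complex.ofReal_mul, ← Complex.ofReal_exp, ← Complex.ofReal_mul,
      ← Complex.ofReal_sub, ← Complex.ofReal_exp, ← Real.exp_mul, ← Real.exp_add, ← Real.exp_add]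
    ring_nf
  have htrans : ∫ x : ℝ, G (x + φ * Complex.I) = ∫ x : ℝ, G (x + Complex.log u) := by
    rw [← integral_add_right_eq_self (fun x : ℝ => G (x + φ * Complex.I)) (Real.log ‖u‖)]
    congr 1
    ext1 x
    congr 1
    rw [Complex.log]
    push_cast
    ring
  rw [integral_Ioi_eq_integral_exp, ← hGamma, ← hshift, htrans, ← integral_mul_const]
  congr 1
  ext1 x
  rw [Complex.cpow_def_of_ne_zero hu0, ← Complex.exp_neg, hG, ← Complex.exp_add,
    Complex.real_smul, ← Real.exp_mul, ← mul_assoc, ← Complex.ofReal_mul, ← Real.exp_add,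
    Complex.ofReal_exp, ← Complex.exp_add, Complex.exp_add (x : ℂ) (Complex.log u),
    Complex.exp_log hu0]
  congr 1
  push_cast
  ring

/-- Integrability is read off from the nonzero value of the integral, which would be 0 otherwise. -/
theorem integrableOn_rpow_mul_exp_neg {a : ℝ} (ha : 0 < a) {u : ℂ} (hu : 0 < u.re) :
    IntegrableOn (fun t : ℝ => ((t ^ (a - 1) : ℝ) : ℂ) * Complex.exp (-t * u)) (Set.Ioi 0) := by
  by_contra hn
  have h1 := integral_rpow_mul_exp_neg ha hu
  rw [integral_undef hn] at h1
  have hu0 : u ≠ 0 := by rintro rfl; simp at hu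
  have h2 : (Real.Gamma a : ℂ) ≠ 0 := by exact_mod_cast (Real.Gamma_pos_of_pos ha).ne'
  have h3 : (u ^ (a : ℂ))⁻¹ ≠ 0 := inv_ne_zero (by simp [Complex.cpow_eq_zero_iff, hu0])
  exact mul_ne_zero h2 h3 h1.symm

/-- The truncated power `t_+^{a - 1}`. -/
def truncPow (a : ℝ) : ℝ → ℝ := Set.indicator (Set.Ioi 0) fun t => t ^ (a - 1)

/-- The kernel with Laplace transform `u^{-a} (1 - e^{-u})^n`. -/
def diffKernel (a : ℝ) (n : ℕ) (t : ℝ) : ℝ :=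
  (Real.Gamma a)⁻¹ * ∑ k ∈ Finset.range (n + 1), ((-1) ^ k * n.choose k) * truncPow a (t - k)

theorem measurable_truncPow (a : ℝ) : Measurable (truncPow a) :=
  Measurable.indicator (by fun_prop) measurableSet_Ioi

theorem measurable_diffKernel (a : ℝ) (n : ℕ) : Measurable (diffKernel a n) := by
  refine Measurable.const_mul (Finset.measurable_fun_sum _ fun k _ => ?_) _
  exact ((measurable_truncPow a).comp (measurable_id.sub_const _)).const_mul _

theorem truncPow_mul_exp (a : ℝ) (k : ℕ) (u : ℂ) (t : ℝ) :
    (truncPow a (t - k) : ℂ) * Complex.exp (-t * u) = Complex.exp (-k * u) *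
      (Set.indicator (Set.Ioi 0)
        (fun t : ℝ => ((t ^ (a - 1) : ℝ) : ℂ) * Complex.exp (-t * u)) (t - k)) := by
  by_cases h : t - k ∈ Set.Ioi (0 : ℝ)
  · rw [truncPow, Set.indicator_of_mem h, Set.indicator_of_mem h, mul_left_comm,
      ← Complex.exp_add]
    congr 2
    push_cast
    ring
  · rw [truncPow, Set.indicator_of_notMem h, Set.indicator_of_notMem h]
    simp

theorem integrable_truncPow_mul_exp {a : ℝ} (ha : 0 < a) (k : ℕ) {u : ℂ} (hu : 0 < u.re) :
    Integrable (fun t : ℝ => (truncPow a (t - k) : ℂ) * Complex.exp (-t * u)) := by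
  simp only [truncPow_mul_exp]
  exact (((integrable_indicator_iff measurableSet_Ioi).2
    (integrableOn_rpow_mul_exp_neg ha hu)).comp_sub_right (k : ℝ)).const_mul _

theorem integral_truncPow_mul_exp {a : ℝ} (ha : 0 < a) (k : ℕ) {u : ℂ} (hu : 0 < u.re) :
    ∫ t : ℝ, (truncPow a (t - k) : ℂ) * Complex.exp (-t * u) =
      Complex.exp (-k * u) * (Real.Gamma a * (u ^ (a : ℂ))⁻¹) := by
  simp only [truncPow_mul_exp]
  rw [integral_const_mul, integral_sub_right_eq_self (Set.indicator (Set.Ioi 0)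
    (fun t : ℝ => ((t ^ (a - 1) : ℝ) : ℂ) * Complex.exp (-t * u))) (k : ℝ),
    integral_indicator measurableSet_Ioi, integral_rpow_mul_exp_neg ha hu]

theorem diffKernel_of_nonpos {a : ℝ} {n : ℕ} {t : ℝ} (ht : t ≤ 0) : diffKernel a n t = 0 := by
  rw [diffKernel, Finset.sum_eq_zero, mul_zero]
  intro k _
  rw [truncPow, Set.indicator_of_notMem, mul_zero]
  have : (0 : ℝ) ≤ k := k.cast_nonneg
  simp only [Set.mem_Ioi, not_lt]
  linarith

theorem sum_choose_mul_exp (n : ℕ) (u : ℂ) :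
    ∑ k ∈ Finset.range (n + 1), ((-1 : ℂ) ^ k * n.choose k) * Complex.exp (-k * u) =
      (1 - Complex.exp (-u)) ^ n := by
  rw [sub_eq_neg_add, add_pow]
  refine Finset.sum_congr rfl fun k _ => ?_
  rw [one_pow, mul_one, neg_pow (Complex.exp (-u)), ← Complex.exp_nat_mul]
  ring_nf

/-- The Laplace transform of the difference kernel. -/
theorem integral_diffKernel_mul_exp {a : ℝ} (ha : 0 < a) (n : ℕ) {u : ℂ} (hu : 0 < u.re) :
    ∫ t in Set.Ioi (0 : ℝ), (diffKernel a n t : ℂ) * Complex.exp (-t * u) =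
      (u ^ (a : ℂ))⁻¹ * (1 - Complex.exp (-u)) ^ n := by
  rw [setIntegral_eq_integral_of_forall_compl_eq_zero fun t ht => by
    rw [diffKernel_of_nonpos (not_lt.1 ht)]; simp]
  have h1 : ∀ t : ℝ, (diffKernel a n t : ℂ) * Complex.exp (-t * u) = (Real.Gamma a : ℂ)⁻¹ *
      ∑ k ∈ Finset.range (n + 1), ((-1 : ℂ) ^ k * n.choose k) *
        ((truncPow a (t - k) : ℂ) * Complex.exp (-t * u)) := by
    intro t
    rw [diffKernel]
    push_cast
    rw [mul_assoc, Finset.sum_mul]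
    congr 1
    refine Finset.sum_congr rfl fun k _ => ?_
    ring
  have h2 : (Real.Gamma a : ℂ) ≠ 0 := by exact_mod_cast (Real.Gamma_pos_of_pos ha).ne'
  simp only [h1]
  rw [integral_const_mul, integral_finsetSum _
    fun k _ => (integrable_truncPow_mul_exp ha k hu).const_mul _]
  simp only [integral_const_mul, integral_truncPow_mul_exp ha _ hu]
  rw [← sum_choose_mul_exp, Finset.mul_sum, Finset.mul_sum]
  refine Finset.sum_congr rfl fun k _ => ?_
  field_simp

theorem rpow_le_of_mem_Icc {b y x : ℝ} (hy : 1 ≤ y) (hx : x ∈ Set.Icc y (y + 1)) :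
    x ^ b ≤ 2 ^ |b| * y ^ b := by
  have hy0 : 0 < y := by linarith
  have h1 : 1 ≤ x / y := (one_le_div hy0).2 hx.1
  have h2 : x / y ≤ 2 := (div_le_iff₀ hy0).2 (by linarith [hx.2])
  have h3 : x ^ b = (x / y) ^ b * y ^ b := by
    rw [← Real.mul_rpow (by positivity) hy0.le, div_mul_cancel₀ _ hy0.ne']
  rw [h3]
  gcongr
  exact (Real.rpow_le_rpow_of_exponent_le h1 (le_abs_self b)).trans (by gcongr)

theorem hasDerivAt_fwdDiff_rpow (n : ℕ) (a : ℝ) {y : ℝ} (hy : 0 < y) :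
    HasDerivAt ((fwdDiff (1 : ℝ))^[n] fun x : ℝ => x ^ a)
      (a * (fwdDiff (1 : ℝ))^[n] (fun x : ℝ => x ^ (a - 1)) y) y := by
  induction n generalizing y with
  | zero => exact Real.hasDerivAt_rpow_const (Or.inl hy.ne')
  | succ n ih =>
    rw [Function.iterate_succ_apply', Function.iterate_succ_apply']
    have h1 := (ih (y := y + 1) (by linarith)).comp_add_const y 1
    refine (h1.sub (ih hy)).congr_deriv ?_
    rw [fwdDiff, mul_sub]

/-- Finite differences of order `n` gain `n` powers of decay. -/
theorem abs_fwdDiff_rpow_le (n : ℕ) (a : ℝ) : ∃ C : ℝ, 0 ≤ C ∧ ∀ y : ℝ, 1 ≤ y →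
    |(fwdDiff (1 : ℝ))^[n] (fun x : ℝ => x ^ a) y| ≤ C * y ^ (a - n) := by
  induction n generalizing a with
  | zero =>
    refine ⟨1, zero_le_one, fun y hy => ?_⟩
    simp [abs_of_nonneg (Real.rpow_nonneg (zero_le_one.trans hy) a)]
  | succ n ih =>
    obtain ⟨C, hC, h⟩ := ih (a - 1)
    refine ⟨|a| * (C * 2 ^ |a - 1 - n|), by positivity, fun y hy => ?_⟩
    rw [Function.iterate_succ_apply', fwdDiff]
    -- Mean value inequality on [y, y + 1]: the derivative is `a` times the n-th difference of
    -- x^{a-1}, so the induction hypothesis for the exponent `a - 1` gains one more power.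
    have := Convex.norm_image_sub_le_of_norm_hasDerivWithin_le (𝕜 := ℝ) (s := Set.Icc y (y + 1))
      (x := y) (y := y + 1) (C := |a| * (C * (2 ^ |a - 1 - n| * y ^ (a - 1 - n))))
      (fun x hx => (hasDerivAt_fwdDiff_rpow n a (by linarith [hx.1])).hasDerivWithinAt)
      (fun x hx => by
        rw [norm_mul, Real.norm_eq_abs, Real.norm_eq_abs]
        gcongr
        refine (h x (hy.trans hx.1)).trans ?_
        gcongr
        exact rpow_le_of_mem_Icc hy hx)
      (convex_Icc _ _) ⟨le_rfl, by linarith⟩ ⟨by linarith, le_rfl⟩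
    rw [Real.norm_eq_abs] at this
    refine this.trans (le_of_eq ?_)
    rw [add_sub_cancel_left, norm_one, mul_one]
    push_cast
    rw [show a - (n + 1 : ℝ) = a - 1 - n by ring]
    ring

/-- Beyond `n` no truncation is active, so the sum is a genuine finite difference of a smooth power.
-/
theorem diffKernel_eq_fwdDiff (a : ℝ) (n : ℕ) {t : ℝ} (ht : n < t) : diffKernel a n t =
    (Real.Gamma a)⁻¹ * (fwdDiff (1 : ℝ))^[n] (fun x : ℝ => x ^ (a - 1)) (t - n) := by
  rw [diffKernel, fwdDiff_iter_eq_sum_shift, ← Finset.sum_range_reflect]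
  congr 1
  refine Finset.sum_congr rfl fun k hk => ?_
  have hk' : k ≤ n := Nat.lt_succ_iff.1 (Finset.mem_range.1 hk)
  rw [show n + 1 - 1 - k = n - k by omega, Nat.choose_symm hk', truncPow,
    Set.indicator_of_mem]
  · rw [zsmul_eq_mul]
    push_cast [Nat.cast_sub hk']
    simp
    left
    ring_nf
  · rw [Set.mem_Ioi, Nat.cast_sub hk']
    have : (0 : ℝ) ≤ k := k.cast_nonneg
    linarith

/-- The singularities at 0, …, n are of order a - 1 > -1, and the decay of order a - 1 - n < -1
gives integrability at infinity. -/
theorem integrableOn_diffKernel {a : ℝ} (ha : 0 < a) {n : ℕ} (hn : a < n) :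
    IntegrableOn (diffKernel a n) (Set.Ioi 0) := by
  have hn0 : (0 : ℝ) ≤ n := n.cast_nonneg
  have h1 : IntegrableOn (diffKernel a n) (Set.Ioc 0 (n + 1)) := by
    refine Integrable.const_mul (integrable_finsetSum _ fun k _ => Integrable.const_mul ?_ _) _
    -- Local integrability comes from the integrable function damped by e^{-t}, multiplied back by
    -- e^t, which is bounded on the interval.
    have := (integrable_truncPow_mul_exp ha k (u := 1) (by simp)).re
    have h2 := (this.integrableOn (s := Set.Ioc 0 ((n : ℝ) + 1))).bdd_mul
      (f := fun t : ℝ => Real.exp t) (c := Real.exp (n + 1))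
      (by exact Real.continuous_exp.aestronglyMeasurable)
      (by
        filter_upwards [ae_restrict_mem measurableSet_Ioc] with t ht
        rw [Real.norm_of_nonneg (Real.exp_pos _).le]
        exact Real.exp_le_exp.2 ht.2)
    refine h2.congr (Filter.Eventually.of_forall fun t => ?_)
    simp only [mul_one, ← Complex.ofReal_neg, ← Complex.ofReal_exp, ← Complex.ofReal_mul,
      RCLike.re_to_complex, Complex.ofReal_re]
    rw [mul_left_comm, ← Real.exp_add]
    simp
  have h2 : IntegrableOn (diffKernel a n) (Set.Ioi (n + 1)) := by
    obtain ⟨C, hC, h⟩ := abs_fwdDiff_rpow_le n (a - 1)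
    have h3 : IntegrableOn (fun t : ℝ => t ^ (a - 1 - n)) (Set.Ioi 1) :=
      integrableOn_Ioi_rpow_of_lt (by linarith) one_pos
    have h4 := ((integrable_indicator_iff measurableSet_Ioi).2 h3).comp_sub_right (n : ℝ)
    refine ((h4.const_mul (|(Real.Gamma a)⁻¹| * C)).integrableOn).mono'
      (measurable_diffKernel a n).aestronglyMeasurable ?_
    filter_upwards [ae_restrict_mem measurableSet_Ioi] with t ht
    rw [Set.mem_Ioi] at ht
    have h5 : t - n ∈ Set.Ioi (1 : ℝ) := by rw [Set.mem_Ioi]; linarith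
    rw [diffKernel_eq_fwdDiff a n (by linarith), Set.indicator_of_mem h5, Real.norm_eq_abs,
      abs_mul, mul_assoc]
    gcongr
    exact h _ (le_of_lt h5)
  rw [← Set.Ioc_union_Ioi_eq_Ioi (by linarith : (0 : ℝ) ≤ n + 1)]
  exact h1.union h2

theorem diffKernel_of_mem_Ioc {a : ℝ} {n : ℕ} {t : ℝ} (ht : t ∈ Set.Ioc (0 : ℝ) 1) :
    diffKernel a n t = (Real.Gamma a)⁻¹ * t ^ (a - 1) := by
  rw [diffKernel, Finset.sum_eq_single 0]
  · simp [truncPow, Set.indicator_of_mem (show t ∈ Set.Ioi (0 : ℝ) from ht.1)]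
  · intro k _ hk
    rw [truncPow, Set.indicator_of_notMem, mul_zero]
    have : (1 : ℝ) ≤ k := by exact_mod_cast Nat.one_le_iff_ne_zero.2 hk
    simp only [Set.mem_Ioi, not_lt]
    linarith [ht.2]
  · simp

/-- The weight differs from 1 only on (0, 1], where the kernel is a multiple of t^{a-1}; then
t^{a-1-κ} is integrable because κ < a. The Sobolev condition on the exponents enters here. -/
theorem integrableOn_diffKernel_mul {a κ : ℝ} (ha : 0 < a) {n : ℕ} (hn : a < n) (hκ : κ < a)
    (hκ0 : 0 ≤ κ) :
    IntegrableOn (fun t => |diffKernel a n t| * max 1 (t ^ (-κ))) (Set.Ioi 0) := by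
  rw [← Set.Ioc_union_Ioi_eq_Ioi (zero_le_one : (0 : ℝ) ≤ 1)]
  refine IntegrableOn.union ?_ ?_
  · have h1 : IntegrableOn (fun t : ℝ => t ^ (a - 1 - κ)) (Set.Ioc 0 1) := by
      rw [← intervalIntegrable_iff_integrableOn_Ioc_of_le zero_le_one]
      exact intervalIntegral.intervalIntegrable_rpow' (by linarith)
    refine IntegrableOn.congr_fun (Integrable.const_mul h1 |(Real.Gamma a)⁻¹|) (fun t ht => ?_)
      measurableSet_Ioc
    have h2 : 1 ≤ t ^ (-κ) :=
      Real.one_le_rpow_of_pos_of_le_one_of_nonpos ht.1 ht.2 (by linarith)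
    rw [diffKernel_of_mem_Ioc ht, max_eq_right h2, abs_mul,
      abs_of_nonneg (Real.rpow_nonneg ht.1.le _), mul_assoc, ← Real.rpow_add ht.1]
    ring_nf
  · refine IntegrableOn.congr_fun ((integrableOn_diffKernel ha hn).mono_set
      (Set.Ioi_subset_Ioi zero_le_one)).abs (fun t ht => ?_) measurableSet_Ioi
    have h2 : t ^ (-κ) ≤ 1 := Real.rpow_le_one_of_one_le_of_nonpos (le_of_lt ht) (by linarith)
    rw [max_eq_left h2, mul_one]

end DifferenceKernel

/-! ### The reproducing formula -/

section Reproducing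

variable {H : Type*} [NormedAddCommGroup H] [NormedSpace ℂ H] {L : H →ₗ.[ℂ] H} {ω θ : ℝ}

theorem norm_exp_neg_mul_le_one {t : ℝ} (ht : 0 ≤ t) {u : ℂ} (hu : 0 < u.re) :
    ‖Complex.exp (-t * u)‖ ≤ 1 := by
  rw [Complex.norm_exp, Real.exp_le_one_iff]
  simp
  positivity

theorem norm_cpow_mul_inv_le {a : ℝ} {n : ℕ} {u : ℂ} (hu : 0 < u.re) :
    ‖u ^ (a : ℂ) * ((1 + u) ^ n)⁻¹‖ ≤ min (‖u‖ ^ a) (‖u‖ ^ (a - n)) := by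
  have hu0 : 0 < ‖u‖ := norm_pos_iff.2 (by rintro rfl; simp at hu)
  have h1 : ‖(1 + u)⁻¹‖ ≤ 1 := by simpa using norm_inv_add_le one_pos hu
  have h2 : ‖(1 + u)⁻¹‖ ≤ ‖u‖⁻¹ := by simpa using norm_inv_add_le' one_pos hu
  rw [norm_mul, Complex.norm_cpow_real, ← inv_pow, norm_pow]
  refine le_min (mul_le_of_le_one_right (by positivity) (pow_le_one₀ (norm_nonneg _) h1)) ?_
  rw [Real.rpow_sub hu0, Real.rpow_natCast, div_eq_mul_inv, ← inv_pow]
  gcongr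

theorem sectorDecay_pow (hθ : θ < Real.pi / 2) {a : ℝ} (ha : 0 < a) {n : ℕ} (hn : a < n) :
    SectorDecay θ (fun u => u ^ (a : ℂ) * ((1 + u) ^ n)⁻¹) := by
  refine ⟨DifferentiableOn.mul ?_ (DifferentiableOn.inv (by fun_prop) fun z hz =>
    pow_ne_zero _ (one_add_ne_zero hz)), 1, min a (n - a), lt_min ha (by linarith),
    fun ζ hζ => ?_⟩
  · exact fun z hz => (differentiableAt_id.cpow_const (Or.inl hz)).differentiableWithinAt
  · rw [one_mul]
    refine (norm_cpow_mul_inv_le (exp_re_pos (hζ.trans_lt hθ))).trans ?_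
    rw [Complex.norm_exp, ← Real.exp_mul, ← Real.exp_mul, mul_comm, mul_comm ζ.re]
    refine min_exp_le (min_le_left _ _) ?_
    have := min_le_right a (n - a)
    linarith

namespace IsContourAngle

theorem resOne_pow_injective (h : IsContourAngle L ω θ) (k : ℕ) :
    Function.Injective (resOne L ^ k : H →L[ℂ] H) := by
  induction k with
  | zero => exact fun x y hxy => by simpa using hxy
  | succ k ih =>
    rw [pow_succ]
    exact ih.comp h.resOne_injective

/-- The contour integrand is jointly continuous in time and in the contour parameter, so its
parameter integral is measurable in operator norm. -/
theorem aestronglyMeasurable_semigroup (h : IsContourAngle L ω ((ω + Real.pi / 2) / 2)) :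
    AEStronglyMeasurable (fun t : ℝ => semigroup L ω t) (volume.restrict (Set.Ioi 0)) := by
  set θ := (ω + Real.pi / 2) / 2 with hθ
  have key : ∀ y : ℝ, |y| = θ → AEStronglyMeasurable (fun t : ℝ => ∫ x : ℝ,
      logKernel L (fun u => Complex.exp (-t * u) - (1 + u)⁻¹) (x + y * Complex.I))
      (volume.restrict (Set.Ioi 0)) := by
    intro y hy
    have hc : Continuous fun q : ℝ × ℝ => logKernel L
        (fun u => Complex.exp (-q.1 * u) - (1 + u)⁻¹) (q.2 + y * Complex.I) := by
      have h1 := (h.continuous_res_line hy).comp (continuous_snd (X := ℝ))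
      have h2 : Continuous fun x : ℝ => (1 + Complex.exp (x + y * Complex.I))⁻¹ :=
        Continuous.inv₀ (by fun_prop) fun x => one_add_ne_zero
          (exp_re_pos (by simpa [hy] using h.lt_pi_div_two))
      have h3 := h2.comp (continuous_snd (X := ℝ))
      exact ((Continuous.sub (by fun_prop) h3).mul (by fun_prop)).smul h1
    exact AEStronglyMeasurable.integral_prod_right' (ν := volume) hc.aestronglyMeasurable
  have h2 := (((key _ h.abs_neg_eq).sub (key _ h.abs_eq)).const_smul
    ((2 * Real.pi * Complex.I : ℂ)⁻¹)).const_add (resOne L)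
  refine h2.congr ?_
  filter_upwards [ae_restrict_mem measurableSet_Ioi] with t ht
  rw [semigroup_eq L ω ht, psiCalc_eq]
  rfl

variable [CompleteSpace H]

theorem resOne_pow_mul_psiCalc (h : IsContourAngle L ω θ) {ψ : ℂ → ℂ} (hψ : SectorDecay θ ψ)
    (k : ℕ) : SectorDecay θ (fun u => ((1 + u)⁻¹) ^ k * ψ u) ∧
    resOne L ^ k * psiCalc L θ ψ = psiCalc L θ (fun u => ((1 + u)⁻¹) ^ k * ψ u) := by
  induction k with
  | zero => simpa using hψ
  | succ k ih =>
    have h1 : ∀ u : ℂ, ((1 + u)⁻¹) ^ (k + 1) * ψ u =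
        (1 + u)⁻¹ * (((1 + u)⁻¹) ^ k * ψ u) := fun u => by ring
    simp only [h1]
    refine ⟨?_, ?_⟩
    · have := ih.1.div_add h.lt_pi_div_two one_pos
      simpa using this
    · rw [pow_succ', mul_assoc, ih.2, h.resOne_mul_psiCalc ih.1]

/-- Fubini's theorem for the functional calculus. -/
theorem integral_psiCalc (h : IsContourAngle L ω θ) {ψ b : ℂ → ℂ} (hψ : SectorDecay θ ψ)
    {k : ℝ → ℝ} (hk : IntegrableOn k (Set.Ioi 0))
    (hb : ∀ u : ℂ, 0 < u.re →
      ∫ t in Set.Ioi (0 : ℝ), (k t : ℂ) * Complex.exp (-t * u) = b u) :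
    ∫ t in Set.Ioi (0 : ℝ), (k t : ℂ) • psiCalc L θ (fun u => Complex.exp (-t * u) * ψ u) =
      psiCalc L θ (fun u => b u * ψ u) := by
  have hre : ∀ y : ℝ, |y| = θ → ∀ x : ℝ, 0 < (Complex.exp (x + y * Complex.I)).re :=
    fun y hy x => exp_re_pos (by simpa [hy] using h.lt_pi_div_two)
  have hker : ∀ (t : ℝ) (ζ : ℂ), logKernel L (fun u => Complex.exp (-t * u) * ψ u) ζ =
      Complex.exp (-t * Complex.exp ζ) • logKernel L ψ ζ := by
    intro t ζ
    simp only [logKernel, mul_assoc, smul_smul]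
  have hint : ∀ y : ℝ, |y| = θ → Integrable (Function.uncurry fun (t : ℝ) (x : ℝ) =>
      Complex.exp (-t * Complex.exp (x + y * Complex.I)) •
        ((k t : ℂ) • logKernel L ψ (x + y * Complex.I)))
      ((volume.restrict (Set.Ioi 0)).prod volume) := by
    intro y hy
    have h1 := Integrable.smul_prod (hk.ofReal (𝕜 := ℂ)) (h.integrable_logKernel hy hψ)
    refine h1.bdd_smul 1 (φ := fun q : ℝ × ℝ =>
      Complex.exp (-q.1 * Complex.exp (q.2 + y * Complex.I))) ?_ ?_
    · exact Continuous.aestronglyMeasurable (by fun_prop)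
    · have h2 : ∀ᵐ q : ℝ × ℝ ∂((volume.restrict (Set.Ioi 0)).prod volume), 0 < q.1 :=
        Measure.quasiMeasurePreserving_fst.ae (ae_restrict_mem measurableSet_Ioi)
      filter_upwards [h2] with q hq using norm_exp_neg_mul_le_one hq.le (hre y hy q.2)
  have hline : ∀ y : ℝ, |y| = θ →
      Integrable (fun t : ℝ => (k t : ℂ) • ∫ x : ℝ,
        logKernel L (fun u => Complex.exp (-t * u) * ψ u) (x + y * Complex.I))
        (volume.restrict (Set.Ioi 0)) ∧
      ∫ t in Set.Ioi (0 : ℝ), (k t : ℂ) • ∫ x : ℝ,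
        logKernel L (fun u => Complex.exp (-t * u) * ψ u) (x + y * Complex.I) =
      ∫ x : ℝ, logKernel L (fun u => b u * ψ u) (x + y * Complex.I) := by
    intro y hy
    have e1 : ∀ t : ℝ, (k t : ℂ) • ∫ x : ℝ,
        logKernel L (fun u => Complex.exp (-t * u) * ψ u) (x + y * Complex.I) =
        ∫ x : ℝ, Complex.exp (-t * Complex.exp (x + y * Complex.I)) •
        ((k t : ℂ) • logKernel L ψ (x + y * Complex.I)) := by
      intro t
      rw [← integral_smul]
      congr 1
      ext1 x
      rw [hker, smul_comm]
    simp only [e1]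
    refine ⟨(hint y hy).integral_prod_left, ?_⟩
    rw [integral_integral_swap (hint y hy)]
    congr 1
    ext1 x
    have e2 : ∀ t : ℝ, Complex.exp (-t * Complex.exp (x + y * Complex.I)) •
        ((k t : ℂ) • logKernel L ψ (x + y * Complex.I)) =
        ((k t : ℂ) * Complex.exp (-t * Complex.exp (x + y * Complex.I))) •
          logKernel L ψ (x + y * Complex.I) := fun t => by rw [smul_smul, mul_comm]
    simp only [e2]
    rw [integral_smul_const, hb _ (hre y hy x), logKernel, logKernel, smul_smul, mul_assoc]
  obtain ⟨i1, e1⟩ := hline _ h.abs_neg_eq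
  obtain ⟨i2, e2⟩ := hline _ h.abs_eq
  simp only [psiCalc_eq]
  rw [← e1, ← e2, ← integral_sub i1 i2, ← integral_smul]
  congr 1
  ext1 t
  rw [← smul_sub, smul_comm]

theorem sum_choose_shift (n : ℕ) (e : ℕ → ℂ) :
    ∑ k ∈ Finset.range (n + 1), ((-1 : ℂ) ^ k * n.choose k) * e k =
      e 0 - ∑ k ∈ Finset.range n, ((-1 : ℂ) ^ k * n.choose (k + 1)) * e (k + 1) := by
  rw [Finset.sum_range_succ', add_comm]
  simp only [pow_zero, Nat.choose_zero_right, Nat.cast_one, one_mul, sub_eq_add_neg,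
    ← Finset.sum_neg_distrib]
  congr 1
  refine Finset.sum_congr rfl fun k _ => ?_
  ring

/-- The operator `1 - (1 - e^{-L})^n`. -/
def binomSemigroup (L : H →ₗ.[ℂ] H) (ω : ℝ) (n : ℕ) : H →L[ℂ] H :=
  ∑ k ∈ Finset.range n, ((-1 : ℂ) ^ k * n.choose (k + 1)) • semigroup L ω ((k + 1 : ℕ) : ℝ)

/-- The symbol (1 - e^{-u})^n tends to 1 at infinity, and the factor (1 + u)^{-n} makes it
admissible. This lets the reproducing formula be compared after application of (1 + L)^{-n}. -/
theorem resOne_pow_mul_one_sub_binomSemigroup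
    (h : IsContourAngle L ω ((ω + Real.pi / 2) / 2)) {n : ℕ} (hn : 0 < n) :
    resOne L ^ n * (1 - binomSemigroup L ω n) = psiCalc L ((ω + Real.pi / 2) / 2)
      (fun u => (1 - Complex.exp (-u)) ^ n * ((1 + u)⁻¹) ^ n) := by
  set θ := (ω + Real.pi / 2) / 2 with hθ
  obtain ⟨j, rfl⟩ : ∃ j, n = j + 1 := ⟨n - 1, by omega⟩
  set n := j + 1 with hnj
  have hn0 : n ≠ 0 := hn.ne'
  set φ : ℕ → ℂ → ℂ := fun k u => ((-1 : ℂ) ^ k * n.choose (k + 1)) *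
    (Complex.exp (-(((k + 1 : ℕ) : ℝ) : ℂ) * u) - (1 + u)⁻¹) with hφ
  have hφd : ∀ k ∈ Finset.range n, SectorDecay θ (φ k) := fun k _ =>
    (h.sectorDecay_semigroup (by positivity)).const_mul _
  have hsum1 : ∑ k ∈ Finset.range n, ((-1 : ℂ) ^ k * n.choose (k + 1)) = 1 := by
    have h1 := sum_choose_shift n fun _ => 1
    have h2 := sum_choose_mul_exp n 0
    simp only [mul_zero, neg_zero, Complex.exp_zero, sub_self, zero_pow hn0, mul_one] at h1 h2
    rw [h2] at h1
    exact (sub_eq_zero.1 h1.symm).symm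
  have hA : binomSemigroup L ω n =
      resOne L + psiCalc L θ (fun u => ∑ k ∈ Finset.range n, φ k u) := by
    rw [h.psiCalc_sum _ hφd, binomSemigroup]
    have h1 : ∀ k : ℕ, ((-1 : ℂ) ^ k * n.choose (k + 1)) • semigroup L ω ((k + 1 : ℕ) : ℝ) =
        ((-1 : ℂ) ^ k * n.choose (k + 1)) • resOne L + psiCalc L θ (φ k) := by
      intro k
      rw [semigroup_eq L ω (by positivity), smul_add, hφ, psiCalc_const_mul]
    simp only [h1]
    rw [Finset.sum_add_distrib, ← Finset.sum_smul, hsum1, one_smul]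
  have hval : ∀ u : ℂ, ∑ k ∈ Finset.range n, φ k u =
      1 - (1 - Complex.exp (-u)) ^ n - (1 + u)⁻¹ := by
    intro u
    simp only [hφ, mul_sub]
    rw [Finset.sum_sub_distrib, ← Finset.sum_mul, hsum1, one_mul, ← sum_choose_mul_exp,
      sum_choose_shift n fun k => Complex.exp (-k * u)]
    simp
  have hsd := SectorDecay.sum (Finset.range n) hφd
  have hone : SectorDecay θ (fun u => u * ((1 + u)⁻¹ * ((1 : ℝ) + u)⁻¹)) :=
    sectorDecay_div_mul h.pos.le h.lt_pi_div_two one_pos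
  -- One of the n ≥ 1 factors is spent to write R(1 - R) as the operator with symbol u / (1 + u)².
  have e1 : resOne L ^ n * (1 - resOne L) = resOne L ^ j *
      psiCalc L θ (fun u => u * ((1 + u)⁻¹ * (((1 : ℝ) : ℂ) + u)⁻¹)) := by
    rw [h.psiCalc_div_mul one_pos, resAt_one]
    simp [n, pow_succ, mul_sub, mul_assoc]
  rw [hA, ← sub_sub, mul_sub, e1, (h.resOne_pow_mul_psiCalc hone j).2,
    (h.resOne_pow_mul_psiCalc hsd n).2, sub_eq_add_neg, ← neg_one_smul ℂ (psiCalc L θ _),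
    ← psiCalc_const_mul, ← h.psiCalc_add (h.resOne_pow_mul_psiCalc hone j).1
    ((h.resOne_pow_mul_psiCalc hsd n).1.const_mul _)]
  refine h.psiCalc_congr fun u hu => ?_
  have hne := one_add_ne_zero hu
  simp only [hval, n]
  push_cast
  rw [pow_succ (1 + u)⁻¹ j]
  have : (1 + u)⁻¹ * (1 + u) = 1 := inv_mul_cancel₀ hne
  linear_combination ((1 + u)⁻¹ ^ j * (1 + u)⁻¹) * this

/-- The reproducing formula: a function is recovered from itself and its fractional derivative
by means of the semigroup. -/
theorem reproducing_formula (h : IsContourAngle L ω ((ω + Real.pi / 2) / 2)) {α : ℝ} (hα : 0 < α)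
    {f g : H} (hfg : IsPow L ω α f g) {C : ℝ} (hT : ∀ t : ℝ, 0 < t → ‖semigroup L ω t‖ ≤ C) :
    f = binomSemigroup L ω (⌊α⌋₊ + 1) f +
      ∫ t in Set.Ioi (0 : ℝ), (diffKernel α (⌊α⌋₊ + 1) t : ℂ) • semigroup L ω t g := by
  set θ := (ω + Real.pi / 2) / 2 with hθ
  set n := ⌊α⌋₊ + 1 with hn
  have hαn : α < n := by rw [hn]; push_cast; exact Nat.lt_floor_add_one α
  have hψ := sectorDecay_pow h.lt_pi_div_two hα hαn
  have hk := integrableOn_diffKernel hα hαn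
  have hkT : IntegrableOn (fun t : ℝ => (diffKernel α n t : ℂ) • semigroup L ω t)
      (Set.Ioi 0) := by
    refine (hk.norm.mul_const C).mono'
      ((hk.ofReal (𝕜 := ℂ)).1.smul h.aestronglyMeasurable_semigroup) ?_
    filter_upwards [ae_restrict_mem measurableSet_Ioi] with t ht
    rw [norm_smul, Complex.norm_real]
    gcongr
    exact hT t ht
  have hcomm : ∀ t : ℝ, 0 < t → ∀ k : ℕ,
      resOne L ^ k * semigroup L ω t = semigroup L ω t * resOne L ^ k := fun t ht k =>
    (Commute.pow_left (h.semigroup_mul_resOne ht).symm k)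
  have hpsi : psiCalc L θ (fun u => u ^ (α : ℂ) * ((1 + u) ^ n)⁻¹) f = (resOne L ^ n) g := hfg
  -- Apply R^n, R = (1 + L)⁻¹: it commutes with the semigroup, and R^n g is the operator with symbol
  -- u^α (1 + u)^{-n} applied to f, by definition of the power. The Laplace transform of the kernel
  -- then cancels u^α. Injectivity of R^n finishes the proof.
  have hI : (resOne L ^ n) (∫ t in Set.Ioi (0 : ℝ), (diffKernel α n t : ℂ) • semigroup L ω t g) =
      psiCalc L θ (fun u => (1 - Complex.exp (-u)) ^ n * ((1 + u)⁻¹) ^ n) f := by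
    have i1 : IntegrableOn (fun t : ℝ => (diffKernel α n t : ℂ) • semigroup L ω t g)
      (Set.Ioi 0) := hkT.apply_continuousLinearMap g
    rw [← ContinuousLinearMap.integral_comp_comm _ i1]
    have e1 : ∀ t ∈ Set.Ioi (0 : ℝ),
        (resOne L ^ n) ((diffKernel α n t : ℂ) • semigroup L ω t g) =
        ((diffKernel α n t : ℂ) • psiCalc L θ
          (fun u => Complex.exp (-t * u) * (u ^ (α : ℂ) * ((1 + u) ^ n)⁻¹))) f := by
      intro t ht
      have h1 := congrArg (fun A : H →L[ℂ] H => A g) (hcomm t ht n)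
      change (resOne L ^ n) (semigroup L ω t g) = semigroup L ω t ((resOne L ^ n) g) at h1
      have h2 := congrArg (fun A : H →L[ℂ] H => A f) (h.semigroup_mul_psiCalc ht hψ)
      change semigroup L ω t (psiCalc L θ _ f) = _ at h2
      rw [map_smul, h1, ← hpsi, h2]
      rfl
    rw [setIntegral_congr_fun measurableSet_Ioi e1]
    have hi2 : IntegrableOn (fun t : ℝ => (diffKernel α n t : ℂ) • psiCalc L θ
          (fun u => Complex.exp (-t * u) * (u ^ (α : ℂ) * ((1 + u) ^ n)⁻¹))) (Set.Ioi 0) := by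
      refine IntegrableOn.congr_fun (f := fun t : ℝ => ((diffKernel α n t : ℂ) •
        semigroup L ω t) * psiCalc L θ (fun u => u ^ (α : ℂ) * ((1 + u) ^ n)⁻¹))
        (hkT.mul_const _) (fun t ht => ?_) measurableSet_Ioi
      simp only [smul_mul_assoc]
      rw [h.semigroup_mul_psiCalc ht hψ]
    rw [← ContinuousLinearMap.integral_apply hi2,
      h.integral_psiCalc hψ hk fun u hu => integral_diffKernel_mul_exp hα n hu]
    refine congrArg (fun A : H →L[ℂ] H => A f) (h.psiCalc_congr fun u hu => ?_)
    have hne := one_add_ne_zero hu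
    have hu0 : u ≠ 0 := by rintro rfl; simp at hu
    have hpow : u ^ (α : ℂ) ≠ 0 := by simp [Complex.cpow_eq_zero_iff, hu0]
    rw [inv_pow]
    field_simp
  refine h.resOne_pow_injective n ?_
  rw [map_add, hI, ← h.resOne_pow_mul_one_sub_binomSemigroup (Nat.succ_pos _)]
  simp [← hn]

end IsContourAngle

end Reproducing

/-! ### Averages over sets -/

section Average

variable {M : Type*} [MeasurableSpace M] {μ : Measure M}

theorem avgPow_eq_eLpNorm' (a : ℝ) (f : M → ℂ) (B : Set M) :
    avgPow μ a f B = eLpNorm' f a ((μ B)⁻¹ • μ.restrict B) := by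
  rw [avgPow, eLpNorm', lintegral_smul_measure, one_div, smul_eq_mul]

theorem avgPow_le_avgPow {a b : ℝ} (ha : 0 < a) (hab : a ≤ b) {f : M → ℂ}
    (hf : AEStronglyMeasurable f μ) {B : Set M} (h0 : μ B ≠ 0) (h1 : μ B ≠ ∞) :
    avgPow μ a f B ≤ avgPow μ b f B := by
  rw [avgPow_eq_eLpNorm', avgPow_eq_eLpNorm']
  have : IsProbabilityMeasure ((μ B)⁻¹ • μ.restrict B) :=
    ⟨by simp [ENNReal.inv_mul_cancel h0 h1]⟩
  exact eLpNorm'_le_eLpNorm'_of_exponent_le ha hab _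
    (hf.restrict.mono_ac Measure.smul_absolutelyContinuous)

theorem avgPow_le_mul_avgPow {a : ℝ} (ha : 0 < a) (f : M → ℂ) {B B' : Set M} {D : ℝ≥0∞}
    (hD : D ≠ ∞) (hB : B ⊆ B') (h0 : μ B ≠ 0) (h : μ B' ≤ D * μ B) :
    avgPow μ a f B ≤ D ^ a⁻¹ * avgPow μ a f B' := by
  rw [avgPow, avgPow, ← ENNReal.mul_rpow_of_nonneg _ _ (inv_nonneg.2 ha.le)]
  have h0' : μ B' ≠ 0 := fun h' => h0 (measure_mono_null hB h')
  have h1 : (μ B)⁻¹ ≤ D * (μ B')⁻¹ := by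
    rw [← div_eq_mul_inv, ENNReal.le_div_iff_mul_le (Or.inl h0') (Or.inr hD)]
    calc (μ B)⁻¹ * μ B' ≤ (μ B)⁻¹ * (D * μ B) := by gcongr
      _ = D * ((μ B)⁻¹ * μ B) := by ring
      _ ≤ D * 1 := by gcongr; exact ENNReal.inv_mul_le_one _
      _ = D := mul_one D
  rw [← mul_assoc]
  gcongr

theorem avgPow_le_mul_eLpNorm {p : ℝ} (hp : 0 < p) (f : M → ℂ) (B : Set M) :
    avgPow μ p f B ≤ (μ B)⁻¹ ^ p⁻¹ * eLpNorm f (ENNReal.ofReal p) μ := by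
  rw [eLpNorm_eq_lintegral_rpow_enorm_toReal (by simpa using hp) ENNReal.ofReal_ne_top,
    ENNReal.toReal_ofReal hp.le, avgPow, one_div,
    ← ENNReal.mul_rpow_of_nonneg _ _ (inv_nonneg.2 hp.le)]
  gcongr
  exact Measure.restrict_le_self

end Average

/-! ### Consequences of doubling and of the lower volume bound -/

section Doubling

variable {M : Type*} [MetricSpace M] [MeasurableSpace M] {μ : Measure M} {C₀ : ℝ}

/-- Take a maximal ε-separated set. The balls of radius ε/2 around its points are disjoint and of
positive measure, so there are only countably many. -/
theorem exists_countable_net_of_measure_ball_pos [OpensMeasurableSpace M] [SFinite μ]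
    (hpos : ∀ (x : M) (r : ℝ), 0 < r → 0 < μ (Metric.ball x r)) {ε : ℝ} (hε : 0 < ε) :
    ∃ s : Set M, s.Countable ∧ ∀ x, ∃ y ∈ s, dist x y ≤ ε := by
  obtain ⟨s, hs⟩ := zorn_subset {s : Set M | s.Pairwise fun x y => ε ≤ dist x y} (by
    intro c hc hchain
    refine ⟨⋃₀ c, ?_, fun t ht => Set.subset_sUnion_of_mem ht⟩
    exact (Set.pairwise_sUnion hchain.directedOn).2 hc)
  refine ⟨s, ?_, fun x => ?_⟩
  · have h := Measure.countable_meas_pos_of_disjoint_iUnion (μ := μ)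
      (As := fun y : s => Metric.ball (y : M) (ε / 2)) (fun y => Metric.isOpen_ball.measurableSet)
      fun y z hyz => Metric.ball_disjoint_ball (by
        have : ε ≤ dist (y : M) z := hs.prop y.2 z.2 (fun h => hyz (Subtype.ext h))
        linarith)
    have h2 : {y : s | 0 < μ (Metric.ball (y : M) (ε / 2))} = Set.univ :=
      Set.eq_univ_of_forall fun y => hpos _ _ (half_pos hε)
    rw [h2, Set.countable_univ_iff] at h
    exact Set.countable_coe_iff.1 h
  · by_contra! hcon
    have hx : x ∉ s := fun hx => by
      have := hcon x hx
      rw [dist_self] at this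
      linarith
    have hins : insert x s ∈ {s : Set M | s.Pairwise fun x y => ε ≤ dist x y} := by
      refine Set.pairwise_insert.2 ⟨hs.prop, fun y hy _ => ⟨(hcon y hy).le, ?_⟩⟩
      rw [dist_comm]
      exact (hcon y hy).le
    exact hx (hs.le_of_ge hins (Set.subset_insert x s) (Set.mem_insert x s))

namespace IsDoublingWith

theorem measure_ball_two_pow_le (hd : IsDoublingWith μ C₀) (x : M) {r : ℝ} (hr : 0 < r) (k : ℕ) :
    μ (Metric.ball x (2 ^ k * r)) ≤ ENNReal.ofReal C₀ ^ k * μ (Metric.ball x r) := by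
  induction k with
  | zero => simp
  | succ k ih =>
    rw [pow_succ', mul_assoc, pow_succ', mul_assoc]
    exact (hd.doubling x _ (by positivity)).trans (by gcongr)

theorem sigmaFinite (hd : IsDoublingWith μ C₀) : SigmaFinite μ := by
  rcases isEmpty_or_nonempty M with hM | ⟨⟨x₀⟩⟩
  · rw [Measure.eq_zero_of_isEmpty μ]
    infer_instance
  · exact ⟨⟨⟨fun n : ℕ => Metric.ball x₀ n, fun _ => trivial, fun n => hd.ball_lt_top x₀ n,
      Metric.iUnion_ball_nat x₀⟩⟩⟩

variable {c : ℝ}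

theorem measure_ball_pos (hd : IsDoublingWith μ C₀) (hc : 0 < c)
    (hvol : ∀ x : M, ENNReal.ofReal c ≤ μ (Metric.ball x 1)) (x : M) {r : ℝ} (hr : 0 < r) :
    0 < μ (Metric.ball x r) := by
  obtain ⟨k, hk⟩ := pow_unbounded_of_one_lt r⁻¹ (one_lt_two (α := ℝ))
  have h1 : ENNReal.ofReal c ≤ ENNReal.ofReal C₀ ^ k * μ (Metric.ball x r) := by
    refine (hvol x).trans (le_trans (measure_mono (Metric.ball_subset_ball ?_))
      (hd.measure_ball_two_pow_le x hr k))
    rw [inv_lt_iff_one_lt_mul₀ hr] at hk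
    linarith
  refine pos_iff_ne_zero.2 fun h0 => ?_
  rw [h0, mul_zero, nonpos_iff_eq_zero, ENNReal.ofReal_eq_zero] at h1
  linarith

/-- Separability is not assumed. It is needed for measurability on M × M in Tonelli's theorem and
for reducing to countably many balls. -/
theorem secondCountableTopology [OpensMeasurableSpace M] (hd : IsDoublingWith μ C₀) (hc : 0 < c)
    (hvol : ∀ x : M, ENNReal.ofReal c ≤ μ (Metric.ball x 1)) : SecondCountableTopology M := by
  have := hd.sigmaFinite
  exact Metric.secondCountable_of_almost_dense_set fun ε hε =>
    exists_countable_net_of_measure_ball_pos (fun x r hr => hd.measure_ball_pos hc hvol x hr) hε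

theorem one_le [Nonempty M] (hd : IsDoublingWith μ C₀) (hc : 0 < c)
    (hvol : ∀ x : M, ENNReal.ofReal c ≤ μ (Metric.ball x 1)) : 1 ≤ C₀ := by
  obtain ⟨x⟩ := ‹Nonempty M›
  have h0 := (hd.measure_ball_pos hc hvol x one_pos).ne'
  have h1 : 1 * μ (Metric.ball x 1) ≤ ENNReal.ofReal C₀ * μ (Metric.ball x 1) := by
    rw [one_mul]
    exact (measure_mono (Metric.ball_subset_ball (by norm_num))).trans (hd.doubling x 1 one_pos)
  rw [ENNReal.mul_le_mul_iff_left h0 (hd.ball_lt_top x 1).ne] at h1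
  by_contra! h2
  exact absurd (ENNReal.ofReal_lt_one.2 h2) (not_lt.2 h1)

theorem le_measure_ball [Nonempty M] (hd : IsDoublingWith μ C₀) (hc : 0 < c)
    (hvol : ∀ x : M, ENNReal.ofReal c ≤ μ (Metric.ball x 1)) (x : M) {r : ℝ} (hr : 0 < r) :
    ENNReal.ofReal (c / C₀ * min 1 (r ^ homDim C₀)) ≤ μ (Metric.ball x r) := by
  have hC := hd.one_le hc hvol
  have hC0 : 0 < C₀ := by linarith
  rcases le_total 1 r with h1 | h1
  · refine le_trans (ENNReal.ofReal_le_ofReal ?_) ((hvol x).trans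
      (measure_mono (Metric.ball_subset_ball h1)))
    calc c / C₀ * min 1 (r ^ homDim C₀) ≤ c / C₀ * 1 := by
          gcongr
          exact min_le_left _ _
      _ ≤ c := by rw [mul_one]; exact div_le_self hc.le hC
  -- The number of doublings that bring the radius r ≤ 1 up to at least 1. Rounding up costs at most
  -- one factor C₀, whence c / C₀, and C₀^{log₂(1/r)} = r^{-d}.
  · set k := ⌈Real.logb 2 r⁻¹⌉₊ with hk
    have hlog : 0 ≤ Real.logb 2 r⁻¹ :=
      Real.logb_nonneg one_lt_two ((one_le_inv₀ hr).2 h1)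
    have hk1 : r⁻¹ ≤ 2 ^ k := by
      rw [← Real.rpow_natCast, ← Real.logb_le_iff_le_rpow one_lt_two (by positivity)]
      exact Nat.le_ceil _
    have hk2 : (k : ℝ) ≤ Real.logb 2 r⁻¹ + 1 := (Nat.ceil_lt_add_one hlog).le
    have hk3 : C₀ ^ k ≤ C₀ * (r ^ homDim C₀)⁻¹ := by
      have e1 : C₀ ^ Real.logb 2 r⁻¹ = (r ^ homDim C₀)⁻¹ := by
        rw [homDim, ← Real.inv_rpow hr.le]
        nth_rw 1 [← Real.rpow_logb (b := 2) two_pos (by norm_num) hC0]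
        nth_rw 2 [← Real.rpow_logb (b := 2) (x := r⁻¹) two_pos (by norm_num) (by positivity)]
        rw [← Real.rpow_mul two_pos.le, ← Real.rpow_mul two_pos.le, mul_comm]
      rw [← Real.rpow_natCast, ← e1]
      calc C₀ ^ (k : ℝ) ≤ C₀ ^ (Real.logb 2 r⁻¹ + 1) := Real.rpow_le_rpow_of_exponent_le hC hk2
        _ = _ := by rw [Real.rpow_add hC0, Real.rpow_one, mul_comm]
    have h2 : ENNReal.ofReal c ≤ ENNReal.ofReal (C₀ ^ k) * μ (Metric.ball x r) := by
      rw [ENNReal.ofReal_pow hC0.le]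
      refine (hvol x).trans (le_trans (measure_mono (Metric.ball_subset_ball ?_))
        (hd.measure_ball_two_pow_le x hr k))
      calc (1 : ℝ) = r⁻¹ * r := (inv_mul_cancel₀ hr.ne').symm
        _ ≤ 2 ^ k * r := by gcongr
    have h3 : c / C₀ * min 1 (r ^ homDim C₀) ≤ c / C₀ ^ k := by
      have hp : 0 < r ^ homDim C₀ := Real.rpow_pos_of_pos hr _
      calc c / C₀ * min 1 (r ^ homDim C₀) ≤ c / C₀ * r ^ homDim C₀ := by
            gcongr
            exact min_le_right _ _
        _ = c / (C₀ * (r ^ homDim C₀)⁻¹) := by field_simp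
        _ ≤ c / C₀ ^ k := by gcongr
    refine (ENNReal.ofReal_le_ofReal h3).trans ?_
    rw [ENNReal.ofReal_div_of_pos (by positivity)]
    exact ENNReal.div_le_of_le_mul' h2

theorem measure_ball_le_of_mem (hd : IsDoublingWith μ C₀) {x y : M} {r : ℝ} (hr : 0 < r)
    (h : dist y x < r) : μ (Metric.ball x r) ≤ ENNReal.ofReal C₀ * μ (Metric.ball y r) := by
  refine (measure_mono fun z hz => ?_).trans (hd.doubling y r hr)
  rw [Metric.mem_ball] at hz ⊢
  have := dist_triangle_right z y x
  linarith

end IsDoublingWith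

theorem measurable_avgPow_integrand [OpensMeasurableSpace M] [SecondCountableTopology M]
    (hd : IsDoublingWith μ C₀) (p : ℝ) {f : M → ℂ} (hf : Measurable f) (r : ℝ) :
    Measurable ({q : M × M | dist q.2 q.1 < r}.indicator
      fun q => (μ (Metric.ball q.1 r))⁻¹ * ‖f q.2‖ₑ ^ p) := by
  have := hd.sigmaFinite
  have hEm : MeasurableSet {q : M × M | dist q.2 q.1 < r} :=
    (isOpen_lt (by fun_prop) continuous_const).measurableSet
  have hVm : Measurable fun y => μ (Metric.ball y r) := measurable_measure_prodMk_left hEm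
  exact ((hVm.comp measurable_fst).inv.mul
    ((hf.comp measurable_snd).enorm.pow_const p)).indicator hEm

theorem avgPow_rpow_eq_lintegral [OpensMeasurableSpace M] {p : ℝ} (hp : 0 < p) {f : M → ℂ}
    (hf : Measurable f) (r : ℝ) (y : M) :
    avgPow μ p f (Metric.ball y r) ^ p = ∫⁻ w, {q : M × M | dist q.2 q.1 < r}.indicator
      (fun q => (μ (Metric.ball q.1 r))⁻¹ * ‖f q.2‖ₑ ^ p) (y, w) ∂μ := by
  have e1 : ∀ w, {q : M × M | dist q.2 q.1 < r}.indicator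
      (fun q => (μ (Metric.ball q.1 r))⁻¹ * ‖f q.2‖ₑ ^ p) (y, w) =
      (Metric.ball y r).indicator (fun w => (μ (Metric.ball y r))⁻¹ * ‖f w‖ₑ ^ p) w := fun w => rfl
  simp only [e1]
  rw [lintegral_indicator Metric.isOpen_ball.measurableSet,
    lintegral_const_mul _ (hf.enorm.pow_const p), avgPow, ENNReal.rpow_inv_rpow hp.ne']

theorem measurable_avgPow_rpow [OpensMeasurableSpace M] [SecondCountableTopology M]
    (hd : IsDoublingWith μ C₀) {p : ℝ} (hp : 0 < p) {f : M → ℂ} (hf : Measurable f) (r : ℝ) :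
    Measurable fun y => avgPow μ p f (Metric.ball y r) ^ p := by
  have := hd.sigmaFinite
  simp only [avgPow_rpow_eq_lintegral hp hf r]
  exact (measurable_avgPow_integrand hd p hf r).lintegral_prod_right'

/-- Averaging over balls of a fixed radius is bounded on `L^p`. -/
theorem lintegral_avgPow_rpow_le [OpensMeasurableSpace M] [SecondCountableTopology M]
    (hd : IsDoublingWith μ C₀) (hpos : ∀ (x : M) (r : ℝ), 0 < r → 0 < μ (Metric.ball x r))
    {p : ℝ} (hp : 0 < p) {f : M → ℂ} (hf : Measurable f) {r : ℝ} (hr : 0 < r) :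
    ∫⁻ y, avgPow μ p f (Metric.ball y r) ^ p ∂μ ≤ ENNReal.ofReal C₀ * ∫⁻ y, ‖f y‖ₑ ^ p ∂μ := by
  have := hd.sigmaFinite
  set E : Set (M × M) := {q | dist q.2 q.1 < r} with hE
  set V : M → ℝ≥0∞ := fun y => μ (Metric.ball y r) with hV
  set F : M × M → ℝ≥0∞ := E.indicator fun q => (V q.1)⁻¹ * ‖f q.2‖ₑ ^ p with hF
  have hFm : Measurable F := measurable_avgPow_integrand hd p hf r
  have h1 : ∀ y, avgPow μ p f (Metric.ball y r) ^ p = ∫⁻ w, F (y, w) ∂μ :=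
    avgPow_rpow_eq_lintegral hp hf r
  simp only [h1]
  rw [lintegral_lintegral_swap (f := fun y w => F (y, w)) hFm.aemeasurable,
    ← lintegral_const_mul _ (hf.enorm.pow_const p)]
  refine lintegral_mono fun w => ?_
  -- After the exchange of integrals, doubling replaces 1/μ(B(y,r)) by C₀/μ(B(w,r)), which no longer
  -- depends on y and is cancelled by integrating over y in B(w,r).
  have h2 : ∀ y, F (y, w) ≤ (Metric.ball w r).indicator
      (fun _ => ENNReal.ofReal C₀ * (V w)⁻¹ * ‖f w‖ₑ ^ p) y := by
    intro y
    by_cases hy : dist w y < r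
    · have hyE : (y, w) ∈ E := hy
      have hyB : y ∈ Metric.ball w r := by rwa [Metric.mem_ball, dist_comm]
      rw [hF, Set.indicator_of_mem hyE, Set.indicator_of_mem hyB]
      gcongr
      have h3 := hd.measure_ball_le_of_mem hr (x := w) (y := y) hyB
      rw [← div_eq_mul_inv, ENNReal.le_div_iff_mul_le (Or.inl (hpos w r hr).ne')
        (Or.inr ENNReal.ofReal_ne_top)]
      calc (V y)⁻¹ * V w ≤ (V y)⁻¹ * (ENNReal.ofReal C₀ * V y) := by gcongr
        _ = ENNReal.ofReal C₀ * ((V y)⁻¹ * V y) := by ring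
        _ ≤ ENNReal.ofReal C₀ * 1 := by gcongr; exact ENNReal.inv_mul_le_one _
        _ = ENNReal.ofReal C₀ := mul_one _
    · have hyE : (y, w) ∉ E := hy
      rw [hF, Set.indicator_of_notMem hyE]
      exact zero_le
  calc ∫⁻ y, F (y, w) ∂μ ≤ ∫⁻ y, (Metric.ball w r).indicator
        (fun _ => ENNReal.ofReal C₀ * (V w)⁻¹ * ‖f w‖ₑ ^ p) y ∂μ := lintegral_mono h2
    _ = ENNReal.ofReal C₀ * (V w)⁻¹ * ‖f w‖ₑ ^ p * V w := by
        rw [lintegral_indicator_const Metric.isOpen_ball.measurableSet]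
    _ = ENNReal.ofReal C₀ * ‖f w‖ₑ ^ p * ((V w)⁻¹ * V w) := by ring
    _ ≤ ENNReal.ofReal C₀ * ‖f w‖ₑ ^ p * 1 := by gcongr; exact ENNReal.inv_mul_le_one _
    _ = _ := mul_one _


end Doubling

/-! ### From off-diagonal decay to bounds on L^p and into L^∞ -/

section OffDiagonal

/-- Weighted sums are controlled by `ℓ^p` sums, at the cost of half of the weight. -/
theorem tsum_mul_le_mul_tsum_rpow {p : ℝ} (hp : 0 < p) (w A : ℕ → ℝ≥0∞) :
    ∑' k, w k * w k * A k ≤ (∑' k, w k) * (∑' k, w k ^ p * A k ^ p) ^ p⁻¹ := by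
  rw [← ENNReal.tsum_mul_right]
  refine ENNReal.tsum_le_tsum fun k => ?_
  rw [mul_assoc]
  gcongr
  calc w k * A k = ((w k * A k) ^ p) ^ p⁻¹ := (ENNReal.rpow_rpow_inv hp.ne' _).symm
    _ ≤ _ := by
      rw [ENNReal.mul_rpow_of_nonneg _ _ hp.le]
      gcongr
      exact ENNReal.le_tsum (f := fun k => w k ^ p * A k ^ p) k

theorem tsum_ofReal_two_rpow_ne_top {δ : ℝ} (hδ : 0 < δ) :
    ∑' k : ℕ, ENNReal.ofReal ((2 : ℝ) ^ (-δ * k)) ≠ ∞ := by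
  have h1 : ∀ k : ℕ, (2 : ℝ) ^ (-δ * k) = ((2 : ℝ) ^ (-δ)) ^ k := fun k => by
    rw [Real.rpow_mul two_pos.le, Real.rpow_natCast]
  have h2 : Summable fun k : ℕ => (2 : ℝ) ^ (-δ * k) := by
    simp only [h1]
    exact summable_geometric_of_lt_one (by positivity)
      (Real.rpow_lt_one_of_one_lt_of_neg one_lt_two (by linarith))
  exact h2.tsum_ofReal_ne_top

variable {M : Type*} [MetricSpace M] [MeasurableSpace M] [OpensMeasurableSpace M]
  [SecondCountableTopology M] {μ : Measure M} {C₀ a p δ r : ℝ} {K : ℝ≥0∞} {f u : M → ℂ}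

/-- Off-diagonal decay over balls of a fixed radius gives a pointwise bound by averages over
balls centred at the point. -/
theorem ae_enorm_le_tsum_avgPow (hd : IsDoublingWith μ C₀)
    (hpos : ∀ (x : M) (r : ℝ), 0 < r → 0 < μ (Metric.ball x r)) (ha : 0 < a) (hap : a ≤ p)
    (hf : Measurable f) (hr : 0 < r)
    (h : ∀ x : M, eLpNorm u ∞ (μ.restrict (Metric.ball x r)) ≤
      K * ∑' k : ℕ, ENNReal.ofReal ((2 : ℝ) ^ (-δ * k)) *
        avgPow μ a f (Metric.ball x ((2 : ℝ) ^ k * r))) :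
    ∀ᵐ y ∂μ, ‖u y‖ₑ ≤ K * (ENNReal.ofReal C₀ ^ 2) ^ a⁻¹ *
      ∑' k : ℕ, ENNReal.ofReal ((2 : ℝ) ^ (-δ * k)) *
        avgPow μ p f (Metric.ball y ((2 : ℝ) ^ (k + 1) * r)) := by
  rcases isEmpty_or_nonempty M with hM | hM
  · exact Filter.Eventually.of_forall fun y => (hM.false y).elim
  -- Balls centred at a dense sequence cover the space, so there is one exceptional null set for all
  -- of them.
  have h1 : ∀ i : ℕ, ∀ᵐ y ∂μ, y ∈ Metric.ball (TopologicalSpace.denseSeq M i) r →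
      ‖u y‖ₑ ≤ eLpNorm u ∞ (μ.restrict (Metric.ball (TopologicalSpace.denseSeq M i) r)) := by
    intro i
    rw [← ae_restrict_iff' Metric.isOpen_ball.measurableSet, eLpNorm_exponent_top]
    exact enorm_ae_le_eLpNormEssSup u _
  filter_upwards [ae_all_iff.2 h1] with y hy
  obtain ⟨i, hi⟩ := (TopologicalSpace.denseRange_denseSeq M).exists_dist_lt y hr
  set x := TopologicalSpace.denseSeq M i
  refine (hy i hi).trans ((h x).trans ?_)
  rw [mul_assoc, ← ENNReal.tsum_mul_left (a := (ENNReal.ofReal C₀ ^ 2) ^ a⁻¹)]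
  refine mul_le_mul_right (ENNReal.tsum_le_tsum fun k => ?_) K
  rw [mul_left_comm]
  refine mul_le_mul_right ?_ _
  have hk : 0 < (2 : ℝ) ^ k * r := by positivity
  have hsub : Metric.ball x (2 ^ k * r) ⊆ Metric.ball y (2 ^ (k + 1) * r) := by
    refine Metric.ball_subset_ball' ?_
    have h2 : dist x y ≤ 2 ^ k * r := by
      rw [dist_comm]
      exact hi.le.trans (le_mul_of_one_le_left hr.le (one_le_pow₀ one_le_two))
    rw [pow_succ]
    linarith
  -- Two doublings, because B(y, 2^{k+1} r) is contained in B(x, 2^{k+2} r).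
  have hmeas : μ (Metric.ball y (2 ^ (k + 1) * r)) ≤
      ENNReal.ofReal C₀ ^ 2 * μ (Metric.ball x (2 ^ k * r)) := by
    refine (measure_mono (Metric.ball_subset_ball' ?_)).trans
      (hd.measure_ball_two_pow_le x hk 2)
    have h2 : dist y x ≤ 2 ^ k * r :=
      hi.le.trans (le_mul_of_one_le_left hr.le (one_le_pow₀ one_le_two))
    rw [pow_succ]
    linarith
  refine (avgPow_le_mul_avgPow ha f (by finiteness) hsub (hpos x _ hk).ne' hmeas).trans ?_
  gcongr
  exact avgPow_le_avgPow ha hap hf.aestronglyMeasurable (hpos y _ (by positivity)).ne'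
    (hd.ball_lt_top y _).ne

theorem eLpNorm_top_le_of_offDiagonal (hd : IsDoublingWith μ C₀)
    (hpos : ∀ (x : M) (r : ℝ), 0 < r → 0 < μ (Metric.ball x r)) (ha : 0 < a) (hap : a ≤ p)
    (hf : Measurable f) (hr : 0 < r) {V : ℝ≥0∞} (hV : ∀ x : M, V ≤ μ (Metric.ball x r))
    (h : ∀ x : M, eLpNorm u ∞ (μ.restrict (Metric.ball x r)) ≤
      K * ∑' k : ℕ, ENNReal.ofReal ((2 : ℝ) ^ (-δ * k)) *
        avgPow μ a f (Metric.ball x ((2 : ℝ) ^ k * r))) :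
    eLpNorm u ∞ μ ≤ K * (ENNReal.ofReal C₀ ^ 2) ^ a⁻¹ *
      (∑' k : ℕ, ENNReal.ofReal ((2 : ℝ) ^ (-δ * k))) * V⁻¹ ^ p⁻¹ *
        eLpNorm f (ENNReal.ofReal p) μ := by
  have hp : 0 < p := ha.trans_le hap
  rw [eLpNorm_exponent_top]
  refine eLpNormEssSup_le_of_ae_enorm_bound ?_
  filter_upwards [ae_enorm_le_tsum_avgPow hd hpos ha hap hf hr h] with y hy
  refine hy.trans ?_
  rw [mul_assoc _ (V⁻¹ ^ p⁻¹), mul_assoc _ (∑' k : ℕ, _), ← ENNReal.tsum_mul_right]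
  gcongr with k
  refine (avgPow_le_mul_eLpNorm hp f _).trans ?_
  gcongr
  refine (hV y).trans (measure_mono (Metric.ball_subset_ball ?_))
  exact le_mul_of_one_le_left hr.le (one_le_pow₀ one_le_two)

/-- The weight 2^{-δk} is split into two halves: one is summed, the other stays inside an ℓ^p sum.
The p-th power can then be integrated term by term, and averaging over balls of any radius has L^p
bound depending only on C₀, so the constant does not depend on `r`. -/
theorem eLpNorm_le_of_offDiagonal (hd : IsDoublingWith μ C₀)
    (hpos : ∀ (x : M) (r : ℝ), 0 < r → 0 < μ (Metric.ball x r)) (ha : 0 < a) (hap : a ≤ p)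
    (hf : Measurable f) (hr : 0 < r)
    (h : ∀ x : M, eLpNorm u ∞ (μ.restrict (Metric.ball x r)) ≤
      K * ∑' k : ℕ, ENNReal.ofReal ((2 : ℝ) ^ (-δ * k)) *
        avgPow μ a f (Metric.ball x ((2 : ℝ) ^ k * r))) :
    eLpNorm u (ENNReal.ofReal p) μ ≤ K * (ENNReal.ofReal C₀ ^ 2) ^ a⁻¹ *
      (∑' k : ℕ, ENNReal.ofReal ((2 : ℝ) ^ (-(δ / 2) * k))) *
      ((∑' k : ℕ, ENNReal.ofReal ((2 : ℝ) ^ (-(δ / 2 * p) * k))) * ENNReal.ofReal C₀) ^ p⁻¹ *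
        eLpNorm f (ENNReal.ofReal p) μ := by
  have hp : 0 < p := ha.trans_le hap
  set w : ℕ → ℝ≥0∞ := fun k => ENNReal.ofReal ((2 : ℝ) ^ (-(δ / 2) * k)) with hw
  have hww : ∀ k : ℕ, ENNReal.ofReal ((2 : ℝ) ^ (-δ * k)) = w k * w k := fun k => by
    simp only [hw]
    rw [← ENNReal.ofReal_mul (by positivity), ← Real.rpow_add two_pos]
    ring_nf
  have hwp : ∀ k : ℕ, ENNReal.ofReal ((2 : ℝ) ^ (-(δ / 2 * p) * k)) = w k ^ p := fun k => by
    simp only [hw]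
    rw [ENNReal.ofReal_rpow_of_nonneg (by positivity) hp.le, ← Real.rpow_mul two_pos.le]
    ring_nf
  set D := K * (ENNReal.ofReal C₀ ^ 2) ^ a⁻¹ with hD
  set A : ℕ → M → ℝ≥0∞ := fun k y => avgPow μ p f (Metric.ball y ((2 : ℝ) ^ (k + 1) * r)) with hA
  have hpt : ∀ᵐ y ∂μ, ‖u y‖ₑ ^ p ≤ (D * ∑' k, w k) ^ p * ∑' k, w k ^ p * A k y ^ p := by
    filter_upwards [ae_enorm_le_tsum_avgPow hd hpos ha hap hf hr h] with y hy
    simp only [hww] at hy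
    calc ‖u y‖ₑ ^ p ≤ (D * ((∑' k, w k) * (∑' k, w k ^ p * A k y ^ p) ^ p⁻¹)) ^ p := by
          gcongr
          exact hy.trans (by gcongr; exact tsum_mul_le_mul_tsum_rpow hp w fun k => A k y)
      _ = _ := by
          rw [← mul_assoc, ENNReal.mul_rpow_of_nonneg _ _ hp.le, ENNReal.rpow_inv_rpow hp.ne']
  have hint : ∫⁻ y, ‖u y‖ₑ ^ p ∂μ ≤ (D * ∑' k, w k) ^ p *
      ((∑' k, w k ^ p) * ENNReal.ofReal C₀ * ∫⁻ y, ‖f y‖ₑ ^ p ∂μ) := by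
    refine (lintegral_mono_ae hpt).trans ?_
    have hAm : ∀ k, Measurable fun y => w k ^ p * A k y ^ p := fun k =>
      (measurable_avgPow_rpow hd hp hf _).const_mul _
    rw [lintegral_const_mul _ (Measurable.tsum hAm),
      lintegral_tsum fun k => (hAm k).aemeasurable, mul_assoc (∑' k, _), ← ENNReal.tsum_mul_right]
    gcongr with k
    rw [lintegral_const_mul _ (measurable_avgPow_rpow hd hp hf _)]
    gcongr
    exact lintegral_avgPow_rpow_le hd hpos hp hf (by positivity)
  simp only [hwp]
  rw [eLpNorm_eq_lintegral_rpow_enorm_toReal (by simpa using hp) ENNReal.ofReal_ne_top,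
    eLpNorm_eq_lintegral_rpow_enorm_toReal (by simpa using hp) ENNReal.ofReal_ne_top,
    ENNReal.toReal_ofReal hp.le, one_div]
  calc (∫⁻ y, ‖u y‖ₑ ^ p ∂μ) ^ p⁻¹ ≤ _ := ENNReal.rpow_le_rpow hint (inv_nonneg.2 hp.le)
    _ = _ := by
      rw [ENNReal.mul_rpow_of_nonneg _ _ (inv_nonneg.2 hp.le), ENNReal.rpow_rpow_inv hp.ne',
        ENNReal.mul_rpow_of_nonneg _ _ (inv_nonneg.2 hp.le), mul_assoc (D * _)]

end OffDiagonal

/-! ### Minkowski's inequality, Fatou's lemma and interpolation -/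

section Minkowski

/-- The integral inequality `N(∫ F) ≤ ∫ N(F)` for a lower semicontinuous, possibly infinite,
norm `N`. -/
theorem apply_integral_le_of_isClosed {H : Type*} [NormedAddCommGroup H] [NormedSpace ℂ H]
    [CompleteSpace H] {X : Type*} [MeasurableSpace X] {ν : Measure X} {N : H → ℝ≥0∞}
    (hzero : N 0 = 0) (hadd : ∀ x y, N (x + y) ≤ N x + N y)
    (hsmul : ∀ (c : ℂ) x, N (c • x) ≤ ‖c‖ₑ * N x)
    (hinj : ∀ x, N x = 0 → x = 0) (hclosed : ∀ ρ, IsClosed {x | N x ≤ ρ})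
    {F : X → H} {b : X → ℝ} (hb : Integrable b ν)
    (hb0 : 0 ≤ᵐ[ν] b) (hF : ∀ᵐ t ∂ν, N (F t) ≤ ENNReal.ofReal (b t)) :
    N (∫ t, F t ∂ν) ≤ ENNReal.ofReal (∫ t, b t ∂ν) := by
  -- If `F` is not integrable its integral is 0 by convention, and the claim is trivial.
  by_cases hFi : Integrable F ν
  swap
  · rw [integral_undef hFi, hzero]
    exact zero_le
  rcases (integral_nonneg_of_ae hb0).eq_or_lt with hρ | hρ
  · have h1 : b =ᵐ[ν] 0 := (integral_eq_zero_iff_of_nonneg_ae hb0 hb).1 hρ.symm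
    have h2 : F =ᵐ[ν] 0 := by
      filter_upwards [h1, hF] with t ht hFt
      exact hinj _ (by simpa [ht] using hFt)
    rw [integral_congr_ae h2]
    simp [hzero]
  set ρ := ∫ t, b t ∂ν with hρdef
  set S : Set H := {x | N x ≤ ENNReal.ofReal ρ} with hS
  have hsmul' : ∀ (r : ℝ) x, 0 ≤ r → N (r • x) ≤ ENNReal.ofReal r * N x := fun r x hr => by
    have := hsmul (r : ℂ) x
    rwa [Complex.coe_smul, ← ofReal_norm, Complex.norm_real, Real.norm_of_nonneg hr] at this
  have hconv : Convex ℝ S := by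
    intro x hx y hy α β hα hβ hαβ
    calc N (α • x + β • y) ≤ ENNReal.ofReal α * N x + ENNReal.ofReal β * N y :=
          (hadd _ _).trans (add_le_add (hsmul' _ _ hα) (hsmul' _ _ hβ))
      _ ≤ ENNReal.ofReal α * ENNReal.ofReal ρ + ENNReal.ofReal β * ENNReal.ofReal ρ := by
          gcongr
          exacts [hx, hy]
      _ = ENNReal.ofReal ρ := by
          rw [← add_mul, ← ENNReal.ofReal_add hα hβ, hαβ, ENNReal.ofReal_one, one_mul]
  -- Otherwise Hahn–Banach separates the integral from the closed convex set N ≤ ρ by a real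
  -- functional `l`.
  by_contra hcon
  obtain ⟨l, σ, hl, hlσ⟩ := geometric_hahn_banach_closed_point hconv (hclosed _)
    (show ∫ t, F t ∂ν ∉ S from hcon)
  -- Rescaling by ρ / b(t) puts F(t) into the set, where l < σ. Integrating gives l(∫ F) ≤ σ, a
  -- contradiction.
  have hle : ∀ᵐ t ∂ν, l (F t) ≤ b t * (σ / ρ) := by
    filter_upwards [hb0, hF] with t ht hFt
    rcases (show 0 ≤ b t from ht).eq_or_lt with h0 | h0
    · rw [← h0, hinj (F t) (by simpa [← h0] using hFt)]
      simp
    · have hmem : (ρ / b t) • F t ∈ S := by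
        refine (hsmul' _ _ (by positivity)).trans ?_
        calc ENNReal.ofReal (ρ / b t) * N (F t)
            ≤ ENNReal.ofReal (ρ / b t) * ENNReal.ofReal (b t) := by gcongr
          _ = ENNReal.ofReal ρ := by
            rw [← ENNReal.ofReal_mul (by positivity), div_mul_cancel₀ _ h0.ne']
      have h3 := hl _ hmem
      rw [map_smul, smul_eq_mul] at h3
      calc l (F t) = (b t / ρ) * (ρ / b t * l (F t)) := by field_simp
        _ ≤ (b t / ρ) * σ := by gcongr
        _ = _ := by ring
  have h4 : l (∫ t, F t ∂ν) ≤ ρ * (σ / ρ) := by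
    rw [← l.integral_comp_comm hFi, hρdef, ← integral_mul_const]
    exact integral_mono_ae (l.integrable_comp hFi) (hb.mul_const _) hle
  rw [mul_div_cancel₀ _ hρ.ne'] at h4
  exact h4.not_gt hlσ

variable {X : Type*} [MeasurableSpace X] {μ : Measure X} {p q r : ℝ≥0∞}

/-- Fatou's lemma for two exponents: the `L^q` norm is lower semicontinuous on `L^p`. -/
theorem eLpNorm_le_of_tendsto_Lp [Fact (1 ≤ p)] {u : ℕ → Lp ℂ p μ} {v : Lp ℂ p μ}
    (hu : Filter.Tendsto u Filter.atTop (nhds v)) {B : ℕ → ℝ≥0∞} {b : ℝ≥0∞}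
    (hB : Filter.Tendsto B Filter.atTop (nhds b)) (h : ∀ n, eLpNorm (u n) q μ ≤ B n) :
    eLpNorm v q μ ≤ b := by
  obtain ⟨ns, hns, hae⟩ := (tendstoInMeasure_of_tendsto_Lp hu).exists_seq_tendsto_ae
  refine (Lp.eLpNorm_lim_le_liminf_eLpNorm (fun n => Lp.aestronglyMeasurable (u (ns n)))
    _ hae).trans ?_
  rw [← (hB.comp hns.tendsto_atTop).liminf_eq]
  exact Filter.liminf_le_liminf (Filter.Eventually.of_forall fun n => h (ns n))

theorem isClosed_setOf_eLpNorm_le [Fact (1 ≤ p)] (ρ : ℝ≥0∞) :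
    IsClosed {u : Lp ℂ p μ | eLpNorm u q μ ≤ ρ} := by
  refine isSeqClosed_iff_isClosed.1 fun u v hu huv => ?_
  exact eLpNorm_le_of_tendsto_Lp huv tendsto_const_nhds hu

theorem eLpNorm_coeFn_zero : eLpNorm (0 : Lp ℂ p μ) q μ = 0 := by
  rw [eLpNorm_congr_ae (Lp.coeFn_zero ℂ p μ), eLpNorm_zero]

theorem eLpNorm_coeFn_add_le (hq : 1 ≤ q) (u v : Lp ℂ p μ) :
    eLpNorm (u + v : Lp ℂ p μ) q μ ≤ eLpNorm u q μ + eLpNorm v q μ := by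
  rw [eLpNorm_congr_ae (Lp.coeFn_add u v)]
  exact eLpNorm_add_le (Lp.aestronglyMeasurable u) (Lp.aestronglyMeasurable v) hq

theorem eLpNorm_coeFn_smul (z : ℂ) (u : Lp ℂ p μ) :
    eLpNorm (z • u : Lp ℂ p μ) q μ = ‖z‖ₑ * eLpNorm u q μ := by
  rw [eLpNorm_congr_ae (Lp.coeFn_smul z u), eLpNorm_const_smul]

/-- The integral is taken in L^p while the bound is in L^q: the L^q norm is a possibly infinite norm
on L^p, and its sublevel sets are closed there by Fatou's lemma. -/
theorem eLpNorm_integral_le [Fact (1 ≤ p)] (hq : 1 ≤ q) {Y : Type*} [MeasurableSpace Y]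
    {ν : Measure Y} {F : Y → Lp ℂ p μ} {b : Y → ℝ} (hb : Integrable b ν)
    (hb0 : 0 ≤ᵐ[ν] b) (hF : ∀ᵐ t ∂ν, eLpNorm (F t) q μ ≤ ENNReal.ofReal (b t)) :
    letI := NormedSpace.complexToReal (E := Lp ℂ p μ)
    eLpNorm (∫ t, F t ∂ν : Lp ℂ p μ) q μ ≤ ENNReal.ofReal (∫ t, b t ∂ν) := by
  refine apply_integral_le_of_isClosed (N := fun u : Lp ℂ p μ => eLpNorm u q μ)
    eLpNorm_coeFn_zero (eLpNorm_coeFn_add_le hq) (fun z u => (eLpNorm_coeFn_smul z u).le)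
    (fun u hu => ?_) isClosed_setOf_eLpNorm_le hb hb0 hF
  rw [eLpNorm_eq_zero_iff (Lp.aestronglyMeasurable u) (one_pos.trans_le hq).ne'] at hu
  exact (Lp.eq_zero_iff_ae_eq_zero).2 hu

/-- Interpolation of a bound in `L^p` and a bound in `L^∞`. -/
theorem eLpNorm_le_of_eLpNorm_top_le {E : Type*} [NormedAddCommGroup E] {u : X → E}
    (hu : AEStronglyMeasurable u μ) (hp0 : p ≠ 0) (hp : p ≠ ∞) (hpq : p ≤ q) {A B : ℝ≥0∞}
    (hA : eLpNorm u p μ ≤ A) (hB : eLpNorm u ∞ μ ≤ B * A) :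
    eLpNorm u q μ ≤ B ^ (1 - p.toReal * (q⁻¹).toReal) * A := by
  rcases eq_or_ne q ∞ with rfl | hq
  · simpa using hB
  have hq0 : q ≠ 0 := (hp0.bot_lt.trans_le hpq).ne'
  have hP : 0 < p.toReal := ENNReal.toReal_pos hp0 hp
  have hQ : 0 < q.toReal := ENNReal.toReal_pos hq0 hq
  have hPQ : p.toReal ≤ q.toReal := ENNReal.toReal_mono hq hpq
  rw [ENNReal.toReal_inv]
  set P := p.toReal
  set Q := q.toReal
  have hθ : P * Q⁻¹ ≤ 1 := by
    rw [← div_eq_mul_inv]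
    exact (div_le_one hQ).2 hPQ
  have h1 : ∫⁻ x, ‖u x‖ₑ ^ Q ∂μ ≤ eLpNorm u ∞ μ ^ (Q - P) * ∫⁻ x, ‖u x‖ₑ ^ P ∂μ := by
    rw [← lintegral_const_mul'' _ (hu.enorm.pow_const P)]
    refine lintegral_mono_ae ?_
    filter_upwards [enorm_ae_le_eLpNormEssSup u μ] with x hx
    calc ‖u x‖ₑ ^ Q = ‖u x‖ₑ ^ (Q - P) * ‖u x‖ₑ ^ P := by
          rw [← ENNReal.rpow_add_of_nonneg _ _ (by linarith) hP.le, sub_add_cancel]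
      _ ≤ _ := by
          gcongr
          exact hx
  have h2 : eLpNorm u q μ ≤ eLpNorm u ∞ μ ^ (1 - P * Q⁻¹) * eLpNorm u p μ ^ (P * Q⁻¹) := by
    rw [eLpNorm_eq_lintegral_rpow_enorm_toReal hq0 hq, one_div]
    refine (ENNReal.rpow_le_rpow h1 (by positivity)).trans_eq ?_
    rw [ENNReal.mul_rpow_of_nonneg _ _ (by positivity), ← ENNReal.rpow_mul,
      eLpNorm_eq_lintegral_rpow_enorm_toReal hp0 hp, ← ENNReal.rpow_mul]
    congr 2
    · change (Q - P) * Q⁻¹ = 1 - P * Q⁻¹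
      field_simp
    · change Q⁻¹ = 1 / P * (P * Q⁻¹)
      field_simp
  calc eLpNorm u q μ ≤ (B * A) ^ (1 - P * Q⁻¹) * A ^ (P * Q⁻¹) := by
        refine h2.trans ?_
        gcongr
    _ = B ^ (1 - P * Q⁻¹) * A := by
        rw [ENNReal.mul_rpow_of_nonneg _ _ (by linarith), mul_assoc,
          ← ENNReal.rpow_add_of_nonneg _ _ (by linarith) (by positivity), sub_add_cancel,
          ENNReal.rpow_one]

end Minkowski

/-! ### Bounds for the semigroup from L^p to L^q -/

section SemigroupBounds

theorem max_one_rpow {x e : ℝ} (hx : 0 ≤ x) (he : 0 ≤ e) : max 1 x ^ e = max 1 (x ^ e) := by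
  have := (Real.monotoneOn_rpow_Ici_of_exponent_nonneg he).map_max
    (show (1 : ℝ) ∈ Set.Ici 0 from Set.mem_Ici.2 zero_le_one)
    (show x ∈ Set.Ici 0 from Set.mem_Ici.2 hx)
  simpa using this

theorem volume_factor_eq {b d m P t : ℝ} (hb : 0 < b) (hm : 0 < m) (hP : 0 < P) (ht : 0 < t) :
    (ENNReal.ofReal (b * min 1 ((t ^ m⁻¹) ^ d)))⁻¹ ^ P⁻¹ =
      ENNReal.ofReal (max 1 (t ^ (-(d / (m * P))))) * ENNReal.ofReal (b⁻¹ ^ P⁻¹) := by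
  have hx : 0 < (t ^ m⁻¹) ^ d := by positivity
  have hmin : 0 < min 1 ((t ^ m⁻¹) ^ d) := lt_min one_pos hx
  have h1 : (min 1 ((t ^ m⁻¹) ^ d))⁻¹ = max 1 ((t ^ m⁻¹) ^ d)⁻¹ := by
    rcases le_total 1 ((t ^ m⁻¹) ^ d) with h | h
    · rw [min_eq_left h, max_eq_left (inv_le_one_of_one_le₀ h), inv_one]
    · rw [min_eq_right h, max_eq_right ((one_le_inv₀ hx).2 h)]
  rw [← ENNReal.ofReal_inv_of_pos (by positivity),
    ENNReal.ofReal_rpow_of_nonneg (by positivity) (by positivity),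
    ← ENNReal.ofReal_mul (by positivity), mul_inv, h1,
    Real.mul_rpow (by positivity) (by positivity), max_one_rpow (by positivity) (by positivity),
    mul_comm]
  congr 3
  rw [← Real.rpow_mul ht.le, ← Real.rpow_neg ht.le, ← Real.rpow_mul ht.le]
  congr 1
  field_simp

variable {M : Type*} [MetricSpace M] [MeasurableSpace M] [BorelSpace M] [Nonempty M]
  {μ : Measure M} {C₀ c : ℝ} {L : Lp ℂ 2 μ →ₗ.[ℂ] Lp ℂ 2 μ} {ω m a δ : ℝ}

/-- The semigroup is bounded on `L^p`, and maps `L^p` to `L^∞` with norm at most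
`C max(1, t^{-d/(mp)})`. -/
theorem HasOffDiagonalDecay.exists_eLpNorm_le (hdecay : HasOffDiagonalDecay μ L ω m a δ)
    (hd : IsDoublingWith μ C₀) (hc : 0 < c)
    (hvol : ∀ x : M, ENNReal.ofReal c ≤ μ (Metric.ball x 1))
    (hω : ω < Real.pi / 2) (hm : 0 < m) (ha : 0 < a) (hδ : 0 < δ) {P : ℝ} (haP : a ≤ P) :
    ∃ C : ℝ≥0, ∀ t : ℝ, 0 < t → ∀ f : Lp ℂ 2 μ,
      eLpNorm (semigroup L ω t f) (ENNReal.ofReal P) μ ≤ C * eLpNorm f (ENNReal.ofReal P) μ ∧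
      eLpNorm (semigroup L ω t f) ∞ μ ≤
        ENNReal.ofReal (max 1 (t ^ (-(homDim C₀ / (m * P))))) *
          (C * eLpNorm f (ENNReal.ofReal P) μ) := by
  have hP : 0 < P := ha.trans_le haP
  have hsec := hd.secondCountableTopology hc hvol
  have hpos := fun x r => hd.measure_ball_pos hc hvol x (r := r)
  have hC₀ : 0 < C₀ := one_pos.trans_le (hd.one_le hc hvol)
  -- Only real times occur, so the sector of half-angle 0 suffices.
  obtain ⟨K, hK⟩ := hdecay 0 (by linarith)
  set K₁ : ℝ≥0∞ := K * (ENNReal.ofReal C₀ ^ 2) ^ a⁻¹ *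
      (∑' k : ℕ, ENNReal.ofReal ((2 : ℝ) ^ (-(δ / 2) * k))) *
      ((∑' k : ℕ, ENNReal.ofReal ((2 : ℝ) ^ (-(δ / 2 * P) * k))) * ENNReal.ofReal C₀) ^ P⁻¹
  set K₂ : ℝ≥0∞ := K * (ENNReal.ofReal C₀ ^ 2) ^ a⁻¹ *
      (∑' k : ℕ, ENNReal.ofReal ((2 : ℝ) ^ (-δ * k)))
  set K₃ : ℝ≥0∞ := ENNReal.ofReal ((c / C₀)⁻¹ ^ P⁻¹)
  have hs := fun {δ : ℝ} (hδ : 0 < δ) => tsum_ofReal_two_rpow_ne_top hδ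
  have h0 : (K : ℝ≥0∞) * (ENNReal.ofReal C₀ ^ 2) ^ a⁻¹ ≠ ∞ := by
    have : (ENNReal.ofReal C₀ ^ 2) ^ a⁻¹ ≠ ∞ :=
      ENNReal.rpow_ne_top_of_nonneg (by positivity) (by finiteness)
    finiteness
  have h1 : K₁ ≠ ∞ := ENNReal.mul_ne_top (ENNReal.mul_ne_top h0 (hs (by positivity)))
    (ENNReal.rpow_ne_top_of_nonneg (by positivity)
      (ENNReal.mul_ne_top (hs (by positivity)) ENNReal.ofReal_ne_top))
  have h2 : K₂ * K₃ ≠ ∞ := ENNReal.mul_ne_top (ENNReal.mul_ne_top h0 (hs hδ)) ENNReal.ofReal_ne_top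
  refine ⟨(K₁ + K₂ * K₃).toNNReal, fun t ht f => ?_⟩
  rw [ENNReal.coe_toNNReal (ENNReal.add_ne_top.2 ⟨h1, h2⟩)]
  have hr : 0 < t ^ m⁻¹ := by positivity
  have hf : Measurable f := (Lp.stronglyMeasurable f).measurable
  have hb : ∀ x : M, eLpNorm (semigroup L ω t f) ∞ (μ.restrict (Metric.ball x (t ^ m⁻¹))) ≤
      K * ∑' k : ℕ, ENNReal.ofReal ((2 : ℝ) ^ (-δ * k)) *
        avgPow μ a f (Metric.ball x ((2 : ℝ) ^ k * t ^ m⁻¹)) := fun x => by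
    have := hK (t : ℂ) (by exact_mod_cast ht.ne') (by simp [Complex.arg_ofReal_of_nonneg ht.le]) x f
    rwa [Complex.norm_real, Real.norm_of_nonneg ht.le] at this
  constructor
  · refine (eLpNorm_le_of_offDiagonal hd hpos ha haP hf hr hb).trans ?_
    gcongr
    exact le_self_add
  · refine (eLpNorm_top_le_of_offDiagonal hd hpos ha haP hf hr
      (fun x => hd.le_measure_ball hc hvol x hr) hb).trans ?_
    rw [volume_factor_eq (by positivity) hm hP ht]
    calc _ = ENNReal.ofReal (max 1 (t ^ (-(homDim C₀ / (m * P))))) *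
          (K₂ * K₃ * eLpNorm f (ENNReal.ofReal P) μ) := by ring
      _ ≤ _ := by
        gcongr
        exact le_add_self

/-- The semigroup maps `L^p` to `L^q` with norm at most `C max(1, t^{-(d/m)(1/p-1/q)})`. -/
theorem HasOffDiagonalDecay.exists_eLpNorm_le_of_le (hdecay : HasOffDiagonalDecay μ L ω m a δ)
    (hd : IsDoublingWith μ C₀) (hc : 0 < c)
    (hvol : ∀ x : M, ENNReal.ofReal c ≤ μ (Metric.ball x 1))
    (hω : ω < Real.pi / 2) (hm : 0 < m) (ha : 0 < a) (hδ : 0 < δ) {p q : ℝ≥0∞}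
    (hap : ENNReal.ofReal a ≤ p) (hp : p ≠ ∞) (hpq : p ≤ q) :
    ∃ C : ℝ≥0, ∀ t : ℝ, 0 < t → ∀ f : Lp ℂ 2 μ, eLpNorm (semigroup L ω t f) q μ ≤
      ENNReal.ofReal (max 1 (t ^ (-(homDim C₀ * ((p⁻¹).toReal - (q⁻¹).toReal) / m)))) *
        (C * eLpNorm f p μ) := by
  have haP : a ≤ p.toReal := (ENNReal.ofReal_le_iff_le_toReal hp).1 hap
  have hP : 0 < p.toReal := ha.trans_le haP
  have hp0 : p ≠ 0 := fun h => by simp [h] at hP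
  obtain ⟨C, hC⟩ := hdecay.exists_eLpNorm_le hd hc hvol hω hm ha hδ haP
  refine ⟨C, fun t ht f => ?_⟩
  have h1 := hC t ht f
  rw [ENNReal.ofReal_toReal hp] at h1
  refine (eLpNorm_le_of_eLpNorm_top_le (Lp.aestronglyMeasurable _) hp0 hp hpq h1.1 h1.2).trans_eq ?_
  have hθ : 0 ≤ 1 - p.toReal * (q⁻¹).toReal := by
    have h2 : (q⁻¹).toReal ≤ (p⁻¹).toReal :=
      ENNReal.toReal_mono (ENNReal.inv_ne_top.2 hp0) (ENNReal.inv_le_inv.2 hpq)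
    rw [ENNReal.toReal_inv p] at h2
    have h3 := mul_le_mul_of_nonneg_left h2 hP.le
    rw [mul_inv_cancel₀ hP.ne'] at h3
    linarith
  rw [ENNReal.ofReal_rpow_of_nonneg (by positivity) hθ, max_one_rpow (by positivity) hθ,
    ← Real.rpow_mul ht.le, ENNReal.toReal_inv p]
  -- The exponents agree because (d/(mp))(1 - p/q) = d(1/p - 1/q)/m.
  congr 4
  field_simp

end SemigroupBounds

/-! ### The embedding -/

section Embedding

variable {M : Type*} [MeasurableSpace M] {μ : Measure M} {L : Lp ℂ 2 μ →ₗ.[ℂ] Lp ℂ 2 μ}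
  {ω m s : ℝ} {p q : ℝ≥0∞}

/-- If the semigroup maps `L^p` to `L^q` with norm at most `C max(1, t^{-κ})` for some `κ < α`,
then the domain of `L^α` in `L^p` embeds into `L^q`. -/
theorem IsContourAngle.exists_eLpNorm_le_of_isPow
    (h : IsContourAngle L ω ((ω + Real.pi / 2) / 2)) {α κ : ℝ} (hα : 0 < α) (hκ0 : 0 ≤ κ)
    (hκ : κ < α) (hq : 1 ≤ q) {B : ℝ} (hB : ∀ t : ℝ, 0 < t → ‖semigroup L ω t‖ ≤ B) {C : ℝ≥0}
    (hC : ∀ t : ℝ, 0 < t → ∀ f : Lp ℂ 2 μ, eLpNorm (semigroup L ω t f) q μ ≤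
      ENNReal.ofReal (max 1 (t ^ (-κ))) * (C * eLpNorm f p μ)) :
    ∃ D : ℝ≥0, ∀ f g : Lp ℂ 2 μ, IsPow L ω α f g → eLpNorm g p μ ≠ ∞ →
      eLpNorm f q μ ≤ D * (eLpNorm f p μ + eLpNorm g p μ) := by
  set n := ⌊α⌋₊ + 1
  have hn : α < n := by exact_mod_cast Nat.lt_floor_add_one α
  have hint := integrableOn_diffKernel_mul hα hn hκ hκ0
  set w : ℝ → ℝ := fun t => |diffKernel α n t| * max 1 (t ^ (-κ))
  have hw : ∀ t, 0 ≤ w t := fun t => by positivity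
  set D₁ : ℝ≥0 := ∑ k ∈ Finset.range n, ‖((-1 : ℂ) ^ k * n.choose (k + 1))‖₊ * C
  set D₂ : ℝ≥0 := (∫ t in Set.Ioi 0, w t).toNNReal * C
  refine ⟨D₁ + D₂, fun f g hfg hg => ?_⟩
  have h1 : eLpNorm (binomSemigroup L ω n f) q μ ≤ D₁ * eLpNorm f p μ := by
    rw [binomSemigroup, sum_apply]
    refine (Finset.le_sum_of_subadditive (fun u : Lp ℂ 2 μ => eLpNorm u q μ)
      eLpNorm_coeFn_zero.le (eLpNorm_coeFn_add_le hq) _ _).trans ?_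
    rw [ENNReal.ofNNReal_finsetSum, Finset.sum_mul]
    refine Finset.sum_le_sum fun k _ => ?_
    rw [smul_apply, eLpNorm_coeFn_smul, ENNReal.coe_mul, mul_assoc]
    have hk : (0 : ℝ) < ((k + 1 : ℕ) : ℝ) := by positivity
    -- The semigroup is evaluated at times at least 1, where the factor max(1, t^{-κ}) equals 1.
    have h2 : (((k + 1 : ℕ) : ℝ)) ^ (-κ) ≤ 1 :=
      Real.rpow_le_one_of_one_le_of_nonpos (by simp) (by linarith)
    have h3 := hC _ hk f
    rw [max_eq_left h2, ENNReal.ofReal_one, one_mul] at h3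
    exact mul_le_mul_right h3 _
  have h2 : eLpNorm (∫ t in Set.Ioi 0, (diffKernel α n t : ℂ) • semigroup L ω t g : Lp ℂ 2 μ) q μ ≤
      D₂ * eLpNorm g p μ := by
    refine (eLpNorm_integral_le (b := fun t => w t * (C * (eLpNorm g p μ).toReal)) hq
      (hint.mul_const _) (Filter.Eventually.of_forall fun t =>
        mul_nonneg (hw t) (by positivity)) ?_).trans_eq ?_
    · filter_upwards [ae_restrict_mem measurableSet_Ioi] with t ht
      rw [eLpNorm_coeFn_smul, ENNReal.ofReal_mul (hw t), ENNReal.ofReal_mul C.coe_nonneg,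
        ENNReal.ofReal_coe_nnreal, ENNReal.ofReal_toReal hg, ENNReal.ofReal_mul (abs_nonneg _),
        mul_assoc, ← ofReal_norm, Complex.norm_real, Real.norm_eq_abs]
      exact mul_le_mul_right (hC t ht g) _
    · rw [integral_mul_const, ENNReal.ofReal_mul (setIntegral_nonneg measurableSet_Ioi
        fun t _ => hw t), ENNReal.ofReal_mul C.coe_nonneg, ENNReal.ofReal_coe_nnreal,
        ENNReal.ofReal_toReal hg, ENNReal.coe_mul, mul_assoc]
      rfl
  rw [h.reproducing_formula hα hfg hB]
  refine (eLpNorm_coeFn_add_le hq _ _).trans ((add_le_add h1 h2).trans ?_)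
  rw [← h.reproducing_formula hα hfg hB, ENNReal.coe_add, mul_add]
  gcongr
  · exact le_self_add
  · exact le_add_self

/-- A bound for functions in `L²` passes to the closure of the fractional power in `L^p`. -/
theorem embedsInto_of_isPow [Fact (1 ≤ p)] {D : ℝ≥0}
    (hD : ∀ f g : Lp ℂ 2 μ, IsPow L ω (s / m) f g → eLpNorm g p μ ≠ ∞ →
      eLpNorm f q μ ≤ D * (eLpNorm f p μ + eLpNorm g p μ)) :
    EmbedsInto μ L ω m s p q := by
  have key : ∀ f g : Lp ℂ p μ, IsPowLp μ L ω (s / m) p f g →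
      eLpNorm f q μ ≤ D * (eLpNorm f p μ + eLpNorm g p μ) := by
    intro f g hfg
    obtain ⟨u, hu, hlim⟩ := mem_closure_iff_seq_limit.1 hfg
    have hlim1 : Filter.Tendsto (fun n => (u n).1) Filter.atTop (nhds f) :=
      (continuous_fst.tendsto _).comp hlim
    have hlim2 : Filter.Tendsto (fun n => (u n).2) Filter.atTop (nhds g) :=
      (continuous_snd.tendsto _).comp hlim
    have hN : ∀ {v : ℕ → Lp ℂ p μ} {w : Lp ℂ p μ}, Filter.Tendsto v Filter.atTop (nhds w) →
        Filter.Tendsto (fun n => eLpNorm (v n) p μ) Filter.atTop (nhds (eLpNorm w p μ)) := by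
      intro v w hvw
      simp only [← Lp.enorm_def]
      exact (continuous_enorm.tendsto _).comp hvw
    refine eLpNorm_le_of_tendsto_Lp hlim1
      (ENNReal.Tendsto.const_mul ((hN hlim1).add (hN hlim2)) (Or.inr ENNReal.coe_ne_top))
      fun n => ?_
    obtain ⟨f₂, g₂, hpow, h1, h2⟩ := hu n
    have h3 := hD f₂ g₂ hpow (by rw [← eLpNorm_congr_ae h2]; exact Lp.eLpNorm_ne_top _)
    rwa [← eLpNorm_congr_ae h1, ← eLpNorm_congr_ae h1, ← eLpNorm_congr_ae h2] at h3
  refine ⟨D, fun f ⟨g, hg⟩ => ⟨⟨Lp.aestronglyMeasurable f, (key f g hg).trans_lt ?_⟩, key f⟩⟩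
  exact ENNReal.mul_lt_top ENNReal.coe_lt_top
    (ENNReal.add_lt_top.2 ⟨Lp.eLpNorm_lt_top f, Lp.eLpNorm_lt_top g⟩)

variable [MetricSpace M] [BorelSpace M] {C₀ c a δ : ℝ}

/-- The exponent 2 is admissible in the L^p bound because `a ≤ 2`. Uniform boundedness on L² is what
makes the operator integral in the reproducing formula converge. -/
theorem HasOffDiagonalDecay.exists_norm_semigroup_le [Nonempty M]
    (hdecay : HasOffDiagonalDecay μ L ω m a δ)
    (hd : IsDoublingWith μ C₀) (hc : 0 < c)
    (hvol : ∀ x : M, ENNReal.ofReal c ≤ μ (Metric.ball x 1))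
    (hω : ω < Real.pi / 2) (hm : 0 < m) (ha : 0 < a) (ha2 : a ≤ 2) (hδ : 0 < δ) :
    ∃ C : ℝ, ∀ t : ℝ, 0 < t → ‖semigroup L ω t‖ ≤ C := by
  obtain ⟨C, hC⟩ := hdecay.exists_eLpNorm_le hd hc hvol hω hm ha hδ ha2
  refine ⟨C, fun t ht => ContinuousLinearMap.opNorm_le_bound _ C.2 fun f => ?_⟩
  have h1 := (hC t ht f).1
  rw [ENNReal.ofReal_ofNat] at h1
  rw [Lp.norm_def, Lp.norm_def, ← ENNReal.coe_toReal C, ← ENNReal.toReal_mul]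
  exact ENNReal.toReal_mono (ENNReal.mul_ne_top ENNReal.coe_ne_top (Lp.eLpNorm_ne_top f)) h1

theorem HasOffDiagonalDecay.embedsInto (hdecay : HasOffDiagonalDecay μ L ω m a δ)
    (hd : IsDoublingWith μ C₀) (hc : 0 < c)
    (hvol : ∀ x : M, ENNReal.ofReal c ≤ μ (Metric.ball x 1))
    (hω : 0 ≤ ω) (hω' : ω < Real.pi / 2) (hL : IsOfType L ω) (hm : 0 < m) (ha : 0 < a)
    (ha2 : a ≤ 2) (hδ : 0 < δ) (hs : 0 < s) [Fact (1 ≤ p)] (hp : p ≠ ∞)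
    (hap : ENNReal.ofReal a ≤ p) (hpq : p ≤ q)
    (hspq : homDim C₀ * ((p⁻¹).toReal - (q⁻¹).toReal) < s) :
    EmbedsInto μ L ω m s p q := by
  have hp1 : 1 ≤ p := Fact.out
  rcases isEmpty_or_nonempty M with hM | hM
  · refine embedsInto_of_isPow (D := 0) fun f g _ _ => ?_
    rw [eLpNorm_congr_ae (g := 0) (Filter.Eventually.of_forall fun x => (hM.false x).elim),
      eLpNorm_zero]
    exact zero_le
  · have hcont : IsContourAngle L ω ((ω + Real.pi / 2) / 2) :=
      ⟨hL, hω, by linarith, by linarith⟩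
    obtain ⟨B, hB⟩ := hdecay.exists_norm_semigroup_le hd hc hvol hω' hm ha ha2 hδ
    obtain ⟨C, hC⟩ := hdecay.exists_eLpNorm_le_of_le hd hc hvol hω' hm ha hδ hap hp hpq
    have hκ0 : 0 ≤ homDim C₀ * ((p⁻¹).toReal - (q⁻¹).toReal) / m := by
      have h1 : 0 ≤ homDim C₀ := Real.logb_nonneg one_lt_two (hd.one_le hc hvol)
      have h2 : (q⁻¹).toReal ≤ (p⁻¹).toReal :=
        ENNReal.toReal_mono (ENNReal.inv_ne_top.2 (one_pos.trans_le hp1).ne')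
          (ENNReal.inv_le_inv.2 hpq)
      have h3 := sub_nonneg.2 h2
      positivity
    obtain ⟨D, hD⟩ := hcont.exists_eLpNorm_le_of_isPow (div_pos hs hm) hκ0
      (div_lt_div_of_pos_right hspq hm) (hp1.trans hpq) hB hC
    exact embedsInto_of_isPow hD

end Embedding

end SemigroupSobolev

end

theorem mainTheorem10 {M : Type*} [MetricSpace M] [MeasurableSpace M] [BorelSpace M]
    (μ : MeasureTheory.Measure M)
    (C₀ : ℝ) (hdoubling : SemigroupSobolev.IsDoublingWith μ C₀)
    (c : ℝ) (hc : 0 < c) (hvol : ∀ x : M, ENNReal.ofReal c ≤ μ (Metric.ball x 1))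
    (L : MeasureTheory.Lp ℂ 2 μ →ₗ.[ℂ] MeasureTheory.Lp ℂ 2 μ)
    (ω : ℝ) (hω : 0 ≤ ω) (hω' : ω < Real.pi / 2) (hL : SemigroupSobolev.IsOfType L ω)
    (m : ℝ) (hm : 1 < m) (sMinus : ℝ) (hsMinus : 0 < sMinus) (hsMinus' : sMinus < 2)
    (δ : ℝ) (hδ : 1 < δ)
    (hdecay : SemigroupSobolev.HasOffDiagonalDecay μ L ω m sMinus δ)
    (s : ℝ) (hs : 0 < s)
    (p : ENNReal) [Fact (1 ≤ p)] (hp : p ≠ ⊤) (hp' : ENNReal.ofReal sMinus ≤ p) :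
    (∀ q : ENNReal, p ≤ q →
      SemigroupSobolev.homDim C₀ * ((p⁻¹).toReal - (q⁻¹).toReal) < s →
      SemigroupSobolev.EmbedsInto μ L ω m s p q) ∧
    (SemigroupSobolev.homDim C₀ / p.toReal < s →
      SemigroupSobolev.EmbedsInto μ L ω m s p ⊤) := by
  have hm0 : 0 < m := one_pos.trans hm
  have hδ0 : 0 < δ := one_pos.trans hδ
  refine ⟨fun q hpq hspq => hdecay.embedsInto hdoubling hc hvol hω hω' hL hm0 hsMinus hsMinus'.le
    hδ0 hs hp hp' hpq hspq, fun h => hdecay.embedsInto hdoubling hc hvol hω hω' hL hm0 hsMinus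
      hsMinus'.le hδ0 hs hp hp' le_top ?_⟩
  simpa [ENNReal.toReal_inv, div_eq_mul_inv] using h
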